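/- Let $N\ge 1$ be an integer, $p>1$ and $\lambda\in\mathbf R$. Put $p^*=\frac{Np}{N-p}$ if $p<N$ and $p^*=+\infty$ if $p\ge N$, and assume: (B) $b\in C(\mathbf R^N,\mathbf R)$, there is $b_0>0$ with $b(x)\ge b_0$ for all $x$, and $\mathrm{meas}\{x: b(x)\le M\}<\infty$ for every $M>0$; (V) $V\in L^\infty(\mathbf R^N,\mathbf R)$; (f$_1$) $f\in C(\mathbf R^N\times\mathbf R,\mathbf R)$, there are $q\in(p,p^*)$ and a constant $C$ with $|f(x,t)|\le C(1+|t|^{q-1})$ for all $(x,t)$, and $f(x,t)t\ge 0$ for all $(x,t)$; (f$_2$) $f(x,t)t/|t|^p\to+\infty$ as $|t|\to\infty$, uniformly in $x\in\mathbf R^N$; (f$_3$) $f(x,t)=o(|t|^{p-1})$ as $|t|\to 0$, uniformly in $x\in\mathbf R^N$; (f$_4$) there is $\theta\ge 1$ with $\theta\mathcal F(x,t)\ge\mathcal F(x,st)$ for all $(x,t)\in\mathbf R^N\times\mathbf R$ and $s\in[0,1]$, where $F(x,t)=\int_0^t f(x,s)\,ds$ and $\mathcal F(x,t)=f(x,t)t-pF(x,t)$.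 Let $\mathcal W=\{u\in W^{1,p}(\mathbf R^N,\mathbf R):\int_{\mathbf R^N}(|\nabla u|^p+b(x)|u|^p)\,dx<\infty\}$, normed by $\|u\|=\big(\int_{\mathbf R^N}(|\nabla u|^p+b(x)|u|^p)\,dx\big)^{1/p}$, and define $\Phi:\mathcal W\to\mathbf R$ by $$\Phi(u)=\frac1p\int_{\mathbf R^N}\big(|\nabla u|^p+b(x)|u|^p\big)dx-\frac{\lambda}{p}\int_{\mathbf R^N}V(x)|u|^p\,dx-\int_{\mathbf R^N}F(x,u)\,dx .$$ Then the integrals defining $\Phi$ converge for every $u\in\mathcal W$, $\Phi\in C^1(\mathcal W,\mathbf R)$, and $\Phi$ satisfies the Cerami condition: every sequence $\{u_k\}$ in $\mathcal W$ such that $(1+\|u_k\|)\Phi'(u_k)\to 0$ in $\mathcal W^*$ and $\Phi(u_k)\to c$ for some $c\in\mathbf R$ has a subsequence that converges in $\mathcal W$. -/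

import Mathlib

open MeasureTheory Filter Topology
open scoped ContDiff

noncomputable section

namespace PLaplace

/-- Euclidean space `ℝ^N`. -/
abbrev Euc (N : ℕ) : Type := EuclideanSpace ℝ (Fin N)

/-! ### Assumptions on the data -/

/-- The critical exponent: `p* = N p / (N - p)` if `p < N` and `p* = +∞` if `p ≥ N`. -/
def criticalExponent (N : ℕ) (p : ℝ) : EReal :=
  if p < (N : ℝ) then (((N : ℝ) * p / ((N : ℝ) - p) : ℝ) : EReal) else ⊤

/-- Condition (B) on the potential `b`. -/
structure ConditionB {N : ℕ} (b : Euc N → ℝ) : Prop where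
  continuous : Continuous b
  lower_bound : ∃ b₀ : ℝ, 0 < b₀ ∧ ∀ x, b₀ ≤ b x
  finite_sublevel : ∀ M : ℝ, 0 < M → volume {x : Euc N | b x ≤ M} < ⊤

/-- Condition (V): `V ∈ L^∞(ℝ^N)`. -/
def ConditionV {N : ℕ} (V : Euc N → ℝ) : Prop :=
  MemLp V ⊤ (volume : Measure (Euc N))

/-- The primitive `F(x, t) = ∫₀ᵗ f(x, s) ds`. -/
def primitive {N : ℕ} (f : Euc N → ℝ → ℝ) (x : Euc N) (t : ℝ) : ℝ :=
  ∫ s in (0 : ℝ)..t, f x s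

/-- The function `𝓕(x, t) = f(x, t) t - p F(x, t)`. -/
def calF {N : ℕ} (p : ℝ) (f : Euc N → ℝ → ℝ) (x : Euc N) (t : ℝ) : ℝ :=
  f x t * t - p * primitive f x t

/-- Condition (f₁): continuity, subcritical growth (uniformly in `x`) and the sign condition. -/
structure ConditionF1 {N : ℕ} (p : ℝ) (f : Euc N → ℝ → ℝ) : Prop where
  continuous : Continuous (fun z : Euc N × ℝ => f z.1 z.2)
  growth : ∃ q : ℝ, p < q ∧ (q : EReal) < criticalExponent N p ∧
    ∃ C : ℝ, ∀ x t, |f x t| ≤ C * (1 + |t| ^ (q - 1))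
  sign : ∀ x t, 0 ≤ f x t * t

/-- Condition (f₂): `f(x, t) t / |t|^p → +∞` as `|t| → ∞`, uniformly in `x`. -/
def ConditionF2 {N : ℕ} (p : ℝ) (f : Euc N → ℝ → ℝ) : Prop :=
  ∀ M : ℝ, ∃ R : ℝ, 0 < R ∧ ∀ x t, R ≤ |t| → M ≤ f x t * t / |t| ^ p

/-- Condition (f₃): `f(x, t) = o(|t|^(p-1))` as `|t| → 0`, uniformly in `x`. -/
def ConditionF3 {N : ℕ} (p : ℝ) (f : Euc N → ℝ → ℝ) : Prop :=
  ∀ ε : ℝ, 0 < ε → ∃ δ : ℝ, 0 < δ ∧ ∀ x t, |t| < δ → |f x t| ≤ ε * |t| ^ (p - 1)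

/-- Condition (f₄): `θ 𝓕(x, t) ≥ 𝓕(x, s t)` for some `θ ≥ 1` and all `x`, `t`, `s ∈ [0, 1]`. -/
def ConditionF4 {N : ℕ} (p : ℝ) (f : Euc N → ℝ → ℝ) : Prop :=
  ∃ θ : ℝ, 1 ≤ θ ∧ ∀ x t s, 0 ≤ s → s ≤ 1 → calF p f x (s * t) ≤ θ * calF p f x t

/-! ### Weak gradients -/

/-- `g` is the weak (distributional) gradient of `u` on `ℝ^N`:
both are locally integrable and `∫ u ∇φ = - ∫ φ g` for every test function `φ`. -/
structure HasWeakGradient {N : ℕ} (u : Euc N → ℝ) (g : Euc N → Euc N) : Prop where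
  locallyIntegrable : LocallyIntegrable u volume
  locallyIntegrable_grad : LocallyIntegrable g volume
  integral_eq : ∀ φ : Euc N → ℝ, ContDiff ℝ ∞ φ → HasCompactSupport φ →
    ∫ x, u x • gradient φ x = - ∫ x, φ x • g x

theorem HasWeakGradient.congr {N : ℕ} {u u' : Euc N → ℝ} {g g' : Euc N → Euc N}
    (h : HasWeakGradient u g) (hu : u =ᵐ[volume] u') (hg : g =ᵐ[volume] g') :
    HasWeakGradient u' g' where
  locallyIntegrable := h.1.congr hu
  locallyIntegrable_grad := h.2.congr hg
  integral_eq φ hφ hc := by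
    rw [← integral_congr_ae (hu.mono fun x hx => by simp only [hx] :
        (fun x => u x • gradient φ x) =ᵐ[volume] fun x => u' x • gradient φ x),
      ← integral_congr_ae (hg.mono fun x hx => by simp only [hx] :
        (fun x => φ x • g x) =ᵐ[volume] fun x => φ x • g' x)]
    exact h.3 φ hφ hc

theorem continuous_gradient {N : ℕ} {φ : Euc N → ℝ} (hφ : ContDiff ℝ ∞ φ) :
    Continuous (gradient φ) :=
  (InnerProductSpace.toDual ℝ (Euc N)).symm.continuous.comp (hφ.continuous_fderiv (by simp))

theorem hasCompactSupport_gradient {N : ℕ} {φ : Euc N → ℝ} (hc : HasCompactSupport φ) :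
    HasCompactSupport (gradient φ) :=
  (hc.fderiv (𝕜 := ℝ)).comp_left (g := (InnerProductSpace.toDual ℝ (Euc N)).symm) (map_zero _)

theorem HasWeakGradient.add {N : ℕ} {u v : Euc N → ℝ} {g h : Euc N → Euc N}
    (hu : HasWeakGradient u g) (hv : HasWeakGradient v h) :
    HasWeakGradient (u + v) (g + h) where
  locallyIntegrable := hu.1.add hv.1
  locallyIntegrable_grad := hu.2.add hv.2
  integral_eq φ hφ hc := by
    simp only [Pi.add_apply, add_smul, smul_add]
    rw [integral_add, integral_add, hu.3 φ hφ hc, hv.3 φ hφ hc, neg_add]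
    · exact hu.2.integrable_smul_left_of_hasCompactSupport hφ.continuous hc
    · exact hv.2.integrable_smul_left_of_hasCompactSupport hφ.continuous hc
    · exact hu.1.integrable_smul_right_of_hasCompactSupport (continuous_gradient hφ)
        (hasCompactSupport_gradient hc)
    · exact hv.1.integrable_smul_right_of_hasCompactSupport (continuous_gradient hφ)
        (hasCompactSupport_gradient hc)

theorem HasWeakGradient.smul {N : ℕ} {u : Euc N → ℝ} {g : Euc N → Euc N}
    (hu : HasWeakGradient u g) (c : ℝ) : HasWeakGradient (c • u) (c • g) where
  locallyIntegrable := hu.1.smul c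
  locallyIntegrable_grad := hu.2.smul c
  integral_eq φ hφ hc := by
    have h1 : ∀ x, (c • u) x • gradient φ x = c • (u x • gradient φ x) := fun x => by
      simp [mul_smul]
    have h2 : ∀ x, φ x • (c • g) x = c • (φ x • g x) := fun x => by
      rw [Pi.smul_apply, smul_comm]
    simp only [h1, h2, integral_smul, hu.3 φ hφ hc, smul_neg]

theorem HasWeakGradient.unique {N : ℕ} {u : Euc N → ℝ} {g h : Euc N → Euc N}
    (hg : HasWeakGradient u g) (hh : HasWeakGradient u h) : g =ᵐ[volume] h := by
  have key := ae_eq_zero_of_integral_contDiff_smul_eq_zero (μ := (volume : Measure (Euc N)))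
    (hg.2.sub hh.2) (fun φ hφ hc => by
      simp only [Pi.sub_apply, smul_sub]
      rw [integral_sub
        (hg.2.integrable_smul_left_of_hasCompactSupport hφ.continuous hc)
        (hh.2.integrable_smul_left_of_hasCompactSupport hφ.continuous hc)]
      have := (hg.3 φ hφ hc).symm.trans (hh.3 φ hφ hc)
      rw [neg_inj.mp this, sub_self])
  filter_upwards [key] with x hx
  exact sub_eq_zero.mp hx

/-! ### The weighted Sobolev space -/

theorem fact_one_le {p : ℝ} (hp : 1 < p) : Fact (1 ≤ ENNReal.ofReal p) :=
  ⟨by simpa using ENNReal.ofReal_le_ofReal hp.le⟩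

theorem integrable_weight_iff {N : ℕ} {p : ℝ} {b : Euc N → ℝ} (hp : 1 < p) (hb : ConditionB b)
    {u : Euc N → ℝ} (hu : AEStronglyMeasurable u volume) :
    Integrable (fun x => b x * |u x| ^ p) volume ↔
      MemLp (fun x => b x ^ (1 / p) * u x) (ENNReal.ofReal p) volume := by
  obtain ⟨b₀, hb₀, hb₁⟩ := hb.lower_bound
  have hm : AEStronglyMeasurable (fun x => b x ^ (1 / p) * u x) volume :=
    (hb.continuous.rpow_const fun x => Or.inr (by positivity)).aestronglyMeasurable.mul hu
  rw [← integrable_norm_rpow_iff hm (by simpa using by linarith) ENNReal.ofReal_ne_top,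
    ENNReal.toReal_ofReal (by linarith)]
  have : ∀ x, ‖b x ^ (1 / p) * u x‖ ^ p = b x * |u x| ^ p := fun x => by
    have hbx : 0 ≤ b x := hb₀.le.trans (hb₁ x)
    rw [norm_mul, Real.mul_rpow (norm_nonneg _) (norm_nonneg _), Real.norm_eq_abs,
      Real.norm_eq_abs, abs_of_nonneg (Real.rpow_nonneg hbx _), ← Real.rpow_mul hbx,
      one_div_mul_cancel (by linarith), Real.rpow_one]
  simp only [this]

/-- The set of all `u ∈ W^{1,p}(ℝ^N)` (that is, `u ∈ L^p` having a weak gradient in `L^p`) with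
`∫ b |u|^p < ∞`, as a linear subspace of `L^p(ℝ^N)`. -/
def weightedSubspace {N : ℕ} {p : ℝ} {b : Euc N → ℝ} (hp : 1 < p) (hb : ConditionB b) :
    Submodule ℝ (Lp ℝ (ENNReal.ofReal p) (volume : Measure (Euc N))) where
  carrier := {u | (∃ g : Lp (Euc N) (ENNReal.ofReal p) (volume : Measure (Euc N)),
      HasWeakGradient u g) ∧ Integrable (fun x => b x * |u x| ^ p) volume}
  zero_mem' := by
    refine ⟨⟨0, ?_⟩, ?_⟩
    · refine HasWeakGradient.congr (u := 0) (g := 0) ⟨?_, ?_, ?_⟩ (Lp.coeFn_zero ..).symm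
        (Lp.coeFn_zero ..).symm
      · exact locallyIntegrable_zero
      · exact locallyIntegrable_zero
      · intro φ _ _
        simp
    · refine (integrable_zero _ _ _).congr ?_
      filter_upwards [Lp.coeFn_zero ℝ (ENNReal.ofReal p) (volume : Measure (Euc N))] with x hx
      simp [Real.zero_rpow (by linarith : p ≠ 0)]
  add_mem' := by
    rintro u v ⟨⟨g, hg⟩, hu⟩ ⟨⟨h, hh⟩, hv⟩
    refine ⟨⟨g + h, (hg.add hh).congr (Lp.coeFn_add u v).symm (Lp.coeFn_add g h).symm⟩, ?_⟩
    rw [integrable_weight_iff hp hb (Lp.aestronglyMeasurable _)] at hu hv ⊢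
    refine (hu.add hv).ae_eq ?_
    filter_upwards [Lp.coeFn_add u v] with x hx
    rw [hx, Pi.add_apply, Pi.add_apply, mul_add]
  smul_mem' := by
    rintro c u ⟨⟨g, hg⟩, hu⟩
    refine ⟨⟨c • g, (hg.smul c).congr (Lp.coeFn_smul c u).symm (Lp.coeFn_smul c g).symm⟩, ?_⟩
    rw [integrable_weight_iff hp hb (Lp.aestronglyMeasurable _)] at hu ⊢
    refine (hu.const_smul c).ae_eq ?_
    filter_upwards [Lp.coeFn_smul c u] with x hx
    rw [hx, Pi.smul_apply, Pi.smul_apply, smul_eq_mul, smul_eq_mul, mul_left_comm]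

/-- The space `𝒲` of all `u ∈ W^{1,p}(ℝ^N)` with `∫ (|∇u|^p + b |u|^p) < ∞`. It is a type of its
own because it carries its own norm, not the one of `L^p`. -/
def WSpace {N : ℕ} {p : ℝ} {b : Euc N → ℝ} (hp : 1 < p) (hb : ConditionB b) : Type :=
  ↥(weightedSubspace hp hb)

section WSpace

variable {N : ℕ} {p : ℝ} {b : Euc N → ℝ} {hp : 1 < p} {hb : ConditionB b}

instance : AddCommGroup (WSpace hp hb) :=
  inferInstanceAs (AddCommGroup ↥(weightedSubspace hp hb))

instance : Module ℝ (WSpace hp hb) :=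
  inferInstanceAs (Module ℝ ↥(weightedSubspace hp hb))

/-- The `L^p` class of an element of `𝒲`. -/
def WSpace.toLp : WSpace hp hb →ₗ[ℝ] Lp ℝ (ENNReal.ofReal p) (volume : Measure (Euc N)) :=
  (weightedSubspace hp hb).subtype

/-- Elements of `𝒲` as functions. -/
instance : CoeFun (WSpace hp hb) (fun _ => Euc N → ℝ) := ⟨fun u => ⇑(WSpace.toLp u)⟩

/-- The weak gradient of an element of `𝒲` (it is unique as an element of `L^p`). -/
def WSpace.grad (u : WSpace hp hb) : Lp (Euc N) (ENNReal.ofReal p) (volume : Measure (Euc N)) :=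
  u.2.1.choose

theorem WSpace.hasWeakGradient (u : WSpace hp hb) : HasWeakGradient u u.grad :=
  u.2.1.choose_spec

theorem WSpace.integrable_weight (u : WSpace hp hb) :
    Integrable (fun x => b x * |u x| ^ p) volume :=
  u.2.2

theorem WSpace.grad_eq {u : WSpace hp hb}
    {g : Lp (Euc N) (ENNReal.ofReal p) (volume : Measure (Euc N))} (h : HasWeakGradient u g) :
    u.grad = g :=
  Lp.ext (u.hasWeakGradient.unique h)

theorem WSpace.grad_add (u v : WSpace hp hb) : (u + v).grad = u.grad + v.grad :=
  WSpace.grad_eq ((u.hasWeakGradient.add v.hasWeakGradient).congr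
    (Lp.coeFn_add (WSpace.toLp u) (WSpace.toLp v)).symm (Lp.coeFn_add _ _).symm)

theorem WSpace.grad_smul (c : ℝ) (u : WSpace hp hb) : (c • u).grad = c • u.grad :=
  WSpace.grad_eq ((u.hasWeakGradient.smul c).congr
    (Lp.coeFn_smul c (WSpace.toLp u)).symm (Lp.coeFn_smul _ _).symm)

theorem WSpace.memLp_weight (u : WSpace hp hb) :
    MemLp (fun x => b x ^ (1 / p) * u x) (ENNReal.ofReal p) volume :=
  (integrable_weight_iff hp hb (Lp.aestronglyMeasurable _)).1 u.2.2

/-- The norm `‖u‖ = (∫ (|∇u|^p + b |u|^p))^{1/p}`. -/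
instance : Norm (WSpace hp hb) :=
  ⟨fun u => (∫ x, (‖u.grad x‖ ^ p + b x * |u x| ^ p)) ^ (1 / p)⟩

theorem WSpace.norm_def (u : WSpace hp hb) :
    ‖u‖ = (∫ x, (‖u.grad x‖ ^ p + b x * |u x| ^ p)) ^ (1 / p) := rfl

theorem WSpace.integrable_grad (u : WSpace hp hb) :
    Integrable (fun x => ‖u.grad x‖ ^ p) volume := by
  have h := (Lp.memLp u.grad).integrable_norm_rpow (by simpa using by linarith)
    ENNReal.ofReal_ne_top
  rwa [ENNReal.toReal_ofReal (by linarith)] at h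

/-- The linear map `u ↦ (b^{1/p} u, ∇u)` into the `ℓ^p`-product of two `L^p` spaces. -/
def WSpace.embed : WSpace hp hb →ₗ[ℝ] WithLp (ENNReal.ofReal p)
    (Lp ℝ (ENNReal.ofReal p) (volume : Measure (Euc N)) ×
      Lp (Euc N) (ENNReal.ofReal p) (volume : Measure (Euc N))) where
  toFun u := WithLp.toLp _ (u.memLp_weight.toLp, u.grad)
  map_add' u v := by
    have h : (u + v).memLp_weight.toLp = u.memLp_weight.toLp + v.memLp_weight.toLp := by
      rw [← MemLp.toLp_add]
      refine MemLp.toLp_congr _ _ ?_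
      filter_upwards [Lp.coeFn_add (WSpace.toLp u) (WSpace.toLp v)] with x hx
      rw [map_add, hx, Pi.add_apply, Pi.add_apply, mul_add]
    rw [h, WSpace.grad_add]
    rfl
  map_smul' c u := by
    have h : (c • u).memLp_weight.toLp = c • u.memLp_weight.toLp := by
      rw [← MemLp.toLp_const_smul]
      refine MemLp.toLp_congr _ _ ?_
      filter_upwards [Lp.coeFn_smul c (WSpace.toLp u)] with x hx
      rw [map_smul, hx, Pi.smul_apply, Pi.smul_apply, smul_eq_mul, smul_eq_mul, mul_left_comm]
    rw [h, WSpace.grad_smul]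
    rfl

theorem WSpace.norm_embed (u : WSpace hp hb) :
    have := fact_one_le hp
    ‖WSpace.embed u‖ = ‖u‖ := by
  have := fact_one_le hp
  have hp0 : 0 < p := by linarith
  have hpE : ENNReal.ofReal p ≠ 0 := by simpa using hp0
  obtain ⟨b₀, hb₀, hb₁⟩ := hb.lower_bound
  have hpow : ∀ x, ‖b x ^ (1 / p) * u x‖ ^ p = b x * |u x| ^ p := fun x => by
    have hbx : 0 ≤ b x := hb₀.le.trans (hb₁ x)
    rw [norm_mul, Real.mul_rpow (norm_nonneg _) (norm_nonneg _), Real.norm_eq_abs,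
      Real.norm_eq_abs, abs_of_nonneg (Real.rpow_nonneg hbx _), ← Real.rpow_mul hbx,
      one_div_mul_cancel hp0.ne', Real.rpow_one]
  have e1 : ‖u.memLp_weight.toLp‖ ^ p = ∫ x, b x * |u x| ^ p := by
    rw [Lp.norm_toLp, u.memLp_weight.eLpNorm_eq_integral_rpow_norm hpE ENNReal.ofReal_ne_top,
      ENNReal.toReal_ofReal hp0.le, ENNReal.toReal_ofReal (by positivity),
      ← Real.rpow_mul (by positivity), inv_mul_cancel₀ hp0.ne', Real.rpow_one]
    simp only [hpow]
  have e2 : ‖u.grad‖ ^ p = ∫ x, ‖u.grad x‖ ^ p := by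
    rw [Lp.norm_def, (Lp.memLp u.grad).eLpNorm_eq_integral_rpow_norm hpE ENNReal.ofReal_ne_top,
      ENNReal.toReal_ofReal hp0.le, ENNReal.toReal_ofReal (by positivity),
      ← Real.rpow_mul (by positivity), inv_mul_cancel₀ hp0.ne', Real.rpow_one]
  rw [WSpace.norm_def, integral_add u.integrable_grad u.integrable_weight, ← e1, ← e2,
    WithLp.prod_norm_eq_add (by rwa [ENNReal.toReal_ofReal hp0.le]),
    ENNReal.toReal_ofReal hp0.le, add_comm]
  rfl

theorem WSpace.normedSpaceCore : NormedSpace.Core ℝ (WSpace hp hb) := by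
  have := fact_one_le hp
  refine ⟨⟨fun u => ?_, fun c u => ?_, fun u v => ?_⟩, fun u => ⟨fun h => ?_, fun h => ?_⟩⟩
  · rw [← WSpace.norm_embed]
    exact norm_nonneg _
  · rw [← WSpace.norm_embed, ← WSpace.norm_embed, map_smul, norm_smul]
  · rw [← WSpace.norm_embed, ← WSpace.norm_embed, ← WSpace.norm_embed, map_add]
    exact norm_add_le _ _
  · rw [← WSpace.norm_embed, norm_eq_zero] at h
    have h0 : u.memLp_weight.toLp = 0 := congrArg (fun z => (WithLp.ofLp z).1) h
    obtain ⟨b₀, hb₀, hb₁⟩ := hb.lower_bound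
    refine Subtype.ext (Lp.ext ?_)
    have h1 := (Lp.ext_iff.1 h0).symm.trans u.memLp_weight.coeFn_toLp |>.symm
    filter_upwards [h1, Lp.coeFn_zero ℝ (ENNReal.ofReal p) (volume : Measure (Euc N))]
      with x hx h2
    rw [h2] at hx
    have hbx : 0 < b x ^ (1 / p) := Real.rpow_pos_of_pos (hb₀.trans_le (hb₁ x)) _
    exact ((mul_eq_zero.1 hx).resolve_left hbx.ne').trans h2.symm
  · rw [← WSpace.norm_embed, h, map_zero, norm_zero]

instance : NormedAddCommGroup (WSpace hp hb) :=
  NormedAddCommGroup.ofCore WSpace.normedSpaceCore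

instance : NormedSpace ℝ (WSpace hp hb) :=
  NormedSpace.ofCore WSpace.normedSpaceCore

/-! ### The functionals -/

/-- `H(u) = (1/p) ∫ (|∇u|^p + b |u|^p)`. -/
def functionalH (u : WSpace hp hb) : ℝ :=
  1 / p * ∫ x, (‖u.grad x‖ ^ p + b x * |u x| ^ p)

/-- `I(u) = (1/p) ∫ V |u|^p`. -/
def functionalI (V : Euc N → ℝ) (u : WSpace hp hb) : ℝ :=
  1 / p * ∫ x, V x * |u x| ^ p

/-- `J(u) = ∫ F(x, u)`. -/
def functionalJ (f : Euc N → ℝ → ℝ) (u : WSpace hp hb) : ℝ :=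
  ∫ x, primitive f x (u x)

/-- `Φ = H - λ I - J`. -/
def energy (lam : ℝ) (V : Euc N → ℝ) (f : Euc N → ℝ → ℝ) (u : WSpace hp hb) : ℝ :=
  functionalH u - lam * functionalI V u - functionalJ f u

end WSpace

/-- The Cerami condition for a differentiable functional `Φ` on a normed space: every sequence with
`(1 + ‖u_k‖) Φ'(u_k) → 0` in the dual space and `Φ(u_k) → c ∈ ℝ` has a convergent subsequence. -/
def CeramiCondition {X : Type*} [NormedAddCommGroup X] [NormedSpace ℝ X] (Φ : X → ℝ) : Prop :=
  ∀ (u : ℕ → X) (c : ℝ),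
    Tendsto (fun k => (1 + ‖u k‖) • fderiv ℝ Φ (u k)) atTop (𝓝 0) →
    Tendsto (fun k => Φ (u k)) atTop (𝓝 c) →
    ∃ (u₀ : X) (σ : ℕ → ℕ), StrictMono σ ∧ Tendsto (fun k => u (σ k)) atTop (𝓝 u₀)

end PLaplace

end

noncomputable section

open scoped ENNReal

namespace PLaplace

/-! ### Superposition operators between Lebesgue spaces -/

section Nemytskii

variable {α E F : Type*} [MeasurableSpace α] {μ : Measure α}
  [NormedAddCommGroup E] [NormedAddCommGroup F]

/-! Write Φ = H - λI - J with H(u) = ‖u‖^p / p. The part λI + J sees u only through its classes in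
L^p and in L^q with q subcritical, where bounded subsets of 𝒲 are precompact; the leading part H is
governed by uniform convexity.

Embeddings. In L^p a function differs from its averages over balls of radius τ by at most τ‖∇u‖_p
(`HasWeakGradient.lintegral_sub_ballAvg_le`). Balancing τ against an L^r bound improves the exponent
r (`SobolevBound.improve`), and iteration reaches every exponent below p* (`sobolevBound_of_lt`).
The same estimate gives compactness in L^p (`WSpace.exists_subseq_cauchySeq`): on the finite-measure
set {b ≤ M} the averages converge, and outside it ∫|u|^p ≤ ‖u‖^p / M. Interpolation carries
smallness from L^p to L^q (`WSpace.tendsto_embedding_zero`).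

Regularity. An integrand whose derivative grows like |ξ|^(r-1) defines a C^1 functional on L^r
(`IsPotential.exists_hasFDerivAt`). The nonlinearity f is split into terms of growth p - 1 and q - 1
(`exists_splitting`), and Φ is assembled by composing with the embeddings
(`exists_hasFDerivAt_energy`).

Boundedness of Cerami sequences (`exists_norm_le_of_cerami`). If ‖u_k‖ → ∞, let v be an L^p limit of
v_k = u_k/‖u_k‖. Since Φ'(u_k)u_k → 0, the integral of f(x,u_k)u_k is O(‖u_k‖^p), and superlinearity
(f₂) forces v = 0. Then λI + J vanishes along m v_k, so Φ(m v_k) is close to m^p / p, as large as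
desired. Hence Φ has a high interior maximum on the segment [0, u_k], where the radial derivative is
zero; (f₄) bounds pΦ there by θ(pΦ(u_k) - Φ'(u_k)u_k) → θpc, a contradiction
(`false_of_large_on_rays`).

Convergence (`ceramiCondition_energy`). For a bounded sequence, Cauchy in L^p along a subsequence,
the lower-order derivatives tested on differences vanish, hence so does (H'(u_k) - H'(u_l))(u_k -
u_l). Convexity turns this into a vanishing midpoint defect of ‖·‖^p, and uniform convexity makes
the subsequence Cauchy in the complete space 𝒲. -/

theorem rpow_add_le {a b s : ℝ} (ha : 0 ≤ a) (hb : 0 ≤ b) (hs : 0 ≤ s) :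
    (a + b) ^ s ≤ 2 ^ s * (a ^ s + b ^ s) := by
  have h1 : (a + b) ^ s ≤ (2 * max a b) ^ s := by
    refine Real.rpow_le_rpow (by positivity) ?_ hs
    linarith [le_max_left a b, le_max_right a b]
  rw [Real.mul_rpow (by positivity) (by positivity)] at h1
  refine h1.trans (mul_le_mul_of_nonneg_left ?_ (by positivity))
  rcases max_cases a b with h | h <;> rw [h.1]
  · linarith [Real.rpow_nonneg hb s]
  · linarith [Real.rpow_nonneg ha s]

theorem ofReal_ne_zero_of_pos {r : ℝ} (hr : 0 < r) : ENNReal.ofReal r ≠ 0 := by simpa using hr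

theorem memLp_ofReal_iff {r : ℝ} (hr : 0 < r) {u : α → E} (hu : AEStronglyMeasurable u μ) :
    MemLp u (ENNReal.ofReal r) μ ↔ Integrable (fun x => ‖u x‖ ^ r) μ := by
  rw [← integrable_norm_rpow_iff hu (ofReal_ne_zero_of_pos hr) ENNReal.ofReal_ne_top,
    ENNReal.toReal_ofReal hr.le]

theorem Lp.integrable_norm_rpow {r : ℝ} (hr : 0 < r) (u : Lp E (ENNReal.ofReal r) μ) :
    Integrable (fun x => ‖u x‖ ^ r) μ :=
  (memLp_ofReal_iff hr (Lp.aestronglyMeasurable u)).1 (Lp.memLp u)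

theorem Lp.norm_rpow_eq_integral {r : ℝ} (hr : 0 < r) (u : Lp E (ENNReal.ofReal r) μ) :
    ‖u‖ ^ r = ∫ x, ‖u x‖ ^ r ∂μ := by
  rw [Lp.norm_def, (Lp.memLp u).eLpNorm_eq_integral_rpow_norm (ofReal_ne_zero_of_pos hr)
    ENNReal.ofReal_ne_top, ENNReal.toReal_ofReal hr.le, ENNReal.toReal_ofReal (by positivity),
    ← Real.rpow_mul (by positivity), inv_mul_cancel₀ hr.ne', Real.rpow_one]

theorem Lp.norm_sub_rpow_eq_integral {r : ℝ} (hr : 0 < r) (u v : Lp E (ENNReal.ofReal r) μ) :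
    ‖u - v‖ ^ r = ∫ x, ‖u x - v x‖ ^ r ∂μ := by
  rw [Lp.norm_rpow_eq_integral hr]
  refine integral_congr_ae ?_
  filter_upwards [Lp.coeFn_sub u v] with x hx
  rw [hx, Pi.sub_apply]

theorem Lp.integrable_norm_sub_rpow {r : ℝ} (hr : 0 < r) (u v : Lp E (ENNReal.ofReal r) μ) :
    Integrable (fun x => ‖u x - v x‖ ^ r) μ := by
  refine (Lp.integrable_norm_rpow hr (u - v)).congr ?_
  filter_upwards [Lp.coeFn_sub u v] with x hx
  rw [hx, Pi.sub_apply]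

/-- A sequence of nonnegative functions bounded by `w + c |u_k - u|^r`, with `u_k → u` in `L^r`,
that tends to zero a.e., tends to zero in mean. -/
theorem tendsto_integral_zero_of_le {r : ℝ} (hr : 0 < r) {u : ℕ → Lp E (ENNReal.ofReal r) μ}
    {u₀ : Lp E (ENNReal.ofReal r) μ} [Fact (1 ≤ ENNReal.ofReal r)]
    (hu : Tendsto u atTop (𝓝 u₀)) {f : ℕ → α → ℝ} {w : α → ℝ} {c : ℝ} (hc : 0 ≤ c)
    (hw : Integrable w μ) (hw0 : ∀ x, 0 ≤ w x) (hfm : ∀ k, AEStronglyMeasurable (f k) μ)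
    (hf0 : ∀ k x, 0 ≤ f k x) (hle : ∀ k, ∀ᵐ x ∂μ, f k x ≤ w x + c * ‖u k x - u₀ x‖ ^ r)
    (hae : ∀ᵐ x ∂μ, Tendsto (fun k => f k x) atTop (𝓝 0)) :
    Tendsto (fun k => ∫ x, f k x ∂μ) atTop (𝓝 0) := by
  -- Truncation at w makes dominated convergence applicable; the excess of f_k over w is at most
  -- c|u_k - u|^r, whose integral tends to zero.
  have h1 : Tendsto (fun k => ∫ x, min (f k x) (w x) ∂μ) atTop (𝓝 (∫ _, (0 : ℝ) ∂μ)) := by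
    refine tendsto_integral_of_dominated_convergence w
      (fun k => (hfm k).inf hw.aestronglyMeasurable) hw (fun k => ?_) ?_
    · refine Eventually.of_forall fun x => ?_
      rw [Real.norm_eq_abs, abs_of_nonneg (le_min (hf0 k x) (hw0 x))]
      exact min_le_right _ _
    · filter_upwards [hae] with x hx
      have := hx.min (tendsto_const_nhds (x := w x))
      rwa [min_eq_left (hw0 x)] at this
  have h2 : Tendsto (fun k => c * ‖u k - u₀‖ ^ r) atTop (𝓝 0) := by
    have : Tendsto (fun k => ‖u k - u₀‖) atTop (𝓝 0) := tendsto_iff_norm_sub_tendsto_zero.1 hu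
    have h3 := (this.rpow_const (Or.inr hr.le)).const_mul c
    rwa [Real.zero_rpow hr.ne', mul_zero] at h3
  rw [integral_zero] at h1
  have h12 := h1.add h2
  rw [add_zero] at h12
  refine squeeze_zero (fun k => integral_nonneg (hf0 k)) (fun k => ?_) h12
  rw [Lp.norm_sub_rpow_eq_integral hr, ← integral_const_mul, ← integral_add]
  · refine integral_mono_of_nonneg (Eventually.of_forall (hf0 k)) ?_ ?_
    · refine Integrable.add ?_ ((Lp.integrable_norm_sub_rpow hr _ _).const_mul c)
      refine hw.mono' ((hfm k).inf hw.aestronglyMeasurable) (Eventually.of_forall fun x => ?_)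
      rw [Real.norm_eq_abs]
      rw [abs_of_nonneg (le_min (hf0 k x) (hw0 x))]
      exact min_le_right _ _
    · filter_upwards [hle k] with x hx
      have h0 : 0 ≤ c * ‖u k x - u₀ x‖ ^ r := by positivity
      rcases min_cases (f k x) (w x) with h | h <;> simp only [h.1] <;> linarith
  · refine hw.mono' ((hfm k).inf hw.aestronglyMeasurable) (Eventually.of_forall fun x => ?_)
    rw [Real.norm_eq_abs]
    rw [abs_of_nonneg (le_min (hf0 k x) (hw0 x))]
    exact min_le_right _ _
  · exact (Lp.integrable_norm_sub_rpow hr _ _).const_mul c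

theorem norm_rpow_superposition_le {a ξ C r s : ℝ} (ha : 0 ≤ a) (hξ : 0 ≤ ξ) (hs : 0 < s)
    (h : a ≤ C * ξ ^ (r / s)) : a ^ s ≤ |C| ^ s * ξ ^ r := by
  have h1 : a ≤ |C| * ξ ^ (r / s) :=
    h.trans (mul_le_mul_of_nonneg_right (le_abs_self C) (by positivity))
  calc a ^ s ≤ (|C| * ξ ^ (r / s)) ^ s := Real.rpow_le_rpow ha h1 hs.le
    _ = |C| ^ s * ξ ^ r := by
      rw [Real.mul_rpow (abs_nonneg _) (by positivity), ← Real.rpow_mul hξ,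
        div_mul_cancel₀ _ hs.ne']

theorem aestronglyMeasurable_norm_rpow {u : α → E} (hu : AEStronglyMeasurable u μ) {s : ℝ}
    (hs : 0 ≤ s) : AEStronglyMeasurable (fun x => ‖u x‖ ^ s) μ :=
  (Real.continuous_rpow_const hs).comp_aestronglyMeasurable hu.norm

theorem memLp_superposition {h : α → E → F} {r s C : ℝ} (hr : 0 < r) (hs : 0 < s)
    (hm : ∀ u : α → E, AEStronglyMeasurable u μ → AEStronglyMeasurable (fun x => h x (u x)) μ)
    (hbound : ∀ᵐ x ∂μ, ∀ ξ, ‖h x ξ‖ ≤ C * ‖ξ‖ ^ (r / s)) {u : α → E}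
    (hu : MemLp u (ENNReal.ofReal r) μ) :
    MemLp (fun x => h x (u x)) (ENNReal.ofReal s) μ := by
  have hum := hu.1
  rw [memLp_ofReal_iff hs (hm u hum)]
  rw [memLp_ofReal_iff hr hum] at hu
  refine (hu.const_mul (|C| ^ s)).mono' (aestronglyMeasurable_norm_rpow (hm u hum) hs.le) ?_
  filter_upwards [hbound] with x hx
  rw [Real.norm_of_nonneg (by positivity)]
  exact norm_rpow_superposition_le (norm_nonneg _) (norm_nonneg _) hs (hx _)

/-- The superposition operator `u ↦ h(·, u(·))` from `L^r` to `L^s`. -/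
def superposition {h : α → E → F} {r s C : ℝ} (hr : 0 < r) (hs : 0 < s)
    (hm : ∀ u : α → E, AEStronglyMeasurable u μ → AEStronglyMeasurable (fun x => h x (u x)) μ)
    (hbound : ∀ᵐ x ∂μ, ∀ ξ, ‖h x ξ‖ ≤ C * ‖ξ‖ ^ (r / s))
    (u : Lp E (ENNReal.ofReal r) μ) : Lp F (ENNReal.ofReal s) μ :=
  (memLp_superposition hr hs hm hbound (Lp.memLp u)).toLp

theorem superposition_ae {h : α → E → F} {r s C : ℝ} (hr : 0 < r) (hs : 0 < s)
    (hm : ∀ u : α → E, AEStronglyMeasurable u μ → AEStronglyMeasurable (fun x => h x (u x)) μ)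
    (hbound : ∀ᵐ x ∂μ, ∀ ξ, ‖h x ξ‖ ≤ C * ‖ξ‖ ^ (r / s)) (u : Lp E (ENNReal.ofReal r) μ) :
    superposition hr hs hm hbound u =ᵐ[μ] fun x => h x (u x) :=
  MemLp.coeFn_toLp _

/-- Every subsequence of an L^r-convergent sequence has an a.e. convergent further subsequence, and
there |h(u_k) - h(u)|^s has the majorant w + c|u_k - u|^r required by `tendsto_integral_zero_of_le`.
No common majorant of the u_k has to be extracted. -/
theorem continuous_superposition {h : α → E → F} {r s C : ℝ} (hr : 0 < r) (hs : 0 < s)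
    [Fact (1 ≤ ENNReal.ofReal r)] [Fact (1 ≤ ENNReal.ofReal s)]
    (hm : ∀ u : α → E, AEStronglyMeasurable u μ → AEStronglyMeasurable (fun x => h x (u x)) μ)
    (hbound : ∀ᵐ x ∂μ, ∀ ξ, ‖h x ξ‖ ≤ C * ‖ξ‖ ^ (r / s)) (hcont : ∀ x, Continuous (h x)) :
    Continuous (superposition hr hs hm hbound) := by
  refine SeqContinuous.continuous fun u u₀ hu => ?_
  refine tendsto_of_subseq_tendsto fun ns hns => ?_
  have huns := hu.comp hns
  obtain ⟨ms, hms, hae⟩ := (tendstoInMeasure_of_tendsto_Lp huns).exists_seq_tendsto_ae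
  refine ⟨ms, ?_⟩
  have hums := huns.comp hms.tendsto_atTop
  set N := superposition hr hs hm hbound with hN
  rw [tendsto_iff_norm_sub_tendsto_zero]
  set K := 2 ^ s * |C| ^ s with hK
  have hK0 : 0 ≤ K := by positivity
  have key : Tendsto (fun k => ∫ x, ‖h x (u (ns (ms k)) x) - h x (u₀ x)‖ ^ s ∂μ) atTop (𝓝 0) := by
    refine tendsto_integral_zero_of_le hr hums (w := fun x => (K * 2 ^ r + K) * ‖u₀ x‖ ^ r)
      (c := K * 2 ^ r) (by positivity) ((Lp.integrable_norm_rpow hr u₀).const_mul _)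
      (fun x => by positivity) (fun k => ?_) (fun k x => by positivity) (fun k => ?_) ?_
    · exact aestronglyMeasurable_norm_rpow ((hm _ (Lp.aestronglyMeasurable _)).sub
        (hm _ (Lp.aestronglyMeasurable _))) hs.le
    · filter_upwards [hbound] with x hx
      have e1 := norm_rpow_superposition_le (norm_nonneg _) (norm_nonneg _) hs (hx (u (ns (ms k)) x))
      have e2 := norm_rpow_superposition_le (norm_nonneg _) (norm_nonneg _) hs (hx (u₀ x))
      have e3 : ‖h x (u (ns (ms k)) x) - h x (u₀ x)‖ ^ s ≤
          2 ^ s * (‖h x (u (ns (ms k)) x)‖ ^ s + ‖h x (u₀ x)‖ ^ s) :=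
        (Real.rpow_le_rpow (norm_nonneg _) (norm_sub_le _ _) hs.le).trans
          (rpow_add_le (norm_nonneg _) (norm_nonneg _) hs.le)
      have e4 : ‖u (ns (ms k)) x‖ ^ r ≤
          2 ^ r * (‖u₀ x‖ ^ r + ‖u (ns (ms k)) x - u₀ x‖ ^ r) :=
        (Real.rpow_le_rpow (norm_nonneg _) (norm_le_insert' _ _) hr.le).trans
          (rpow_add_le (norm_nonneg _) (norm_nonneg _) hr.le)
      calc _ ≤ 2 ^ s * (|C| ^ s * (2 ^ r * (‖u₀ x‖ ^ r + ‖u (ns (ms k)) x - u₀ x‖ ^ r)) +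
              |C| ^ s * ‖u₀ x‖ ^ r) := by
            refine e3.trans (mul_le_mul_of_nonneg_left (add_le_add (e1.trans ?_) e2)
              (by positivity))
            exact mul_le_mul_of_nonneg_left e4 (by positivity)
        _ = _ := by simp only [hK, Function.comp_apply]; ring
    · filter_upwards [hae] with x hx
      have h1 : Tendsto (fun k => h x (u (ns (ms k)) x)) atTop (𝓝 (h x (u₀ x))) :=
        ((hcont x).tendsto _).comp hx
      have h2 := (tendsto_iff_norm_sub_tendsto_zero.1 h1).rpow_const (p := s) (Or.inr hs.le)
      rwa [Real.zero_rpow hs.ne'] at h2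
  have h2 := key.rpow_const (p := 1 / s) (Or.inr (by positivity))
  rw [Real.zero_rpow (by positivity)] at h2
  refine h2.congr fun k => ?_
  have : ∫ x, ‖h x (u (ns (ms k)) x) - h x (u₀ x)‖ ^ s ∂μ = ‖N (u (ns (ms k))) - N u₀‖ ^ s := by
    rw [Lp.norm_sub_rpow_eq_integral hs]
    refine integral_congr_ae ?_
    filter_upwards [superposition_ae hr hs hm hbound (u (ns (ms k))),
      superposition_ae hr hs hm hbound u₀] with x h1 h2
    rw [h1, h2]
  rw [this, ← Real.rpow_mul (norm_nonneg _), mul_one_div_cancel hs.ne', Real.rpow_one]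
  rfl

end Nemytskii

/-- A function with directional derivatives given by a continuous map into the dual space is
Fréchet differentiable. -/
theorem hasFDerivAt_of_hasDerivAt_line {X : Type*} [NormedAddCommGroup X] [NormedSpace ℝ X]
    {Ψ : X → ℝ} {D : X → X →L[ℝ] ℝ}
    (h : ∀ u v : X, ∀ t : ℝ, HasDerivAt (fun t : ℝ => Ψ (u + t • v)) (D (u + t • v) v) t)
    (hD : Continuous D) (u : X) : HasFDerivAt Ψ (D u) u := by
  rw [hasFDerivAt_iff_isLittleO_nhds_zero, Asymptotics.isLittleO_iff]
  intro ε hε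
  obtain ⟨δ, hδ, hball⟩ := Metric.continuous_iff.1 hD u ε hε
  filter_upwards [Metric.ball_mem_nhds (0 : X) hδ] with v hv
  rw [mem_ball_zero_iff] at hv
  -- After subtraction of the linear term the derivative along the segment is (D(u + tv) - D u)v,
  -- small by continuity of D; the mean value inequality on [0, 1] concludes.
  have h1 : ∀ t ∈ Set.Icc (0 : ℝ) 1, HasDerivWithinAt (fun t : ℝ => Ψ (u + t • v) - t * D u v)
      (D (u + t • v) v - D u v) (Set.Icc 0 1) t := fun t _ => by
    have := ((h u v t).sub ((hasDerivAt_id t).mul_const (D u v))).hasDerivWithinAt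
      (s := Set.Icc 0 1)
    rwa [one_mul] at this
  have h2 := norm_image_sub_le_of_norm_deriv_le_segment_01' h1 (C := ε * ‖v‖) fun t ht => by
    rw [← sub_apply]
    refine (ContinuousLinearMap.le_opNorm _ _).trans
      (mul_le_mul_of_nonneg_right ?_ (norm_nonneg _))
    rw [← dist_eq_norm]
    refine (hball _ ?_).le
    rw [dist_eq_norm, add_sub_cancel_left, norm_smul, Real.norm_of_nonneg ht.1]
    refine lt_of_le_of_lt ?_ hv
    exact mul_le_of_le_one_left (norm_nonneg _) ht.2.le
  simp only [one_smul, one_mul, zero_smul, add_zero, zero_mul, sub_zero] at h2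
  rwa [sub_right_comm] at h2

/-! ### Integral functionals of power growth are C^1 on L^r -/

section Potential

variable {α E : Type*} [MeasurableSpace α] {μ : Measure α}
  [NormedAddCommGroup E] [NormedSpace ℝ E]

/-- `G` is a potential of growth `r`: it vanishes at zero and its derivative `g` in the second
variable is a Carathéodory function bounded by a multiple of `|ξ|^(r-1)`. -/
structure IsPotential (μ : Measure α) (r : ℝ) (G : α → E → ℝ) (g : α → E → E →L[ℝ] ℝ) : Prop where
  measurable : ∀ u : α → E, AEStronglyMeasurable u μ →
    AEStronglyMeasurable (fun x => G x (u x)) μ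
  measurable_deriv : ∀ u : α → E, AEStronglyMeasurable u μ →
    AEStronglyMeasurable (fun x => g x (u x)) μ
  zero : ∀ x, G x 0 = 0
  hasFDerivAt : ∀ x ξ, HasFDerivAt (G x) (g x ξ) ξ
  continuous_deriv : ∀ x, Continuous (g x)
  bound : ∃ C, ∀ᵐ x ∂μ, ∀ ξ, ‖g x ξ‖ ≤ C * ‖ξ‖ ^ (r - 1)

namespace IsPotential

variable {r : ℝ} {G : α → E → ℝ} {g : α → E → E →L[ℝ] ℝ}

/-- On the closed ball of radius |ξ| the derivative is at most |C||ξ|^(r-1), so the mean value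
inequality from 0 to ξ gains one power. -/
theorem growth (hG : IsPotential μ r G g) (hr : 1 < r) :
    ∃ C, 0 ≤ C ∧ ∀ᵐ x ∂μ, ∀ ξ, |G x ξ| ≤ C * ‖ξ‖ ^ r := by
  obtain ⟨C, hC⟩ := hG.bound
  refine ⟨|C|, abs_nonneg _, ?_⟩
  filter_upwards [hC] with x hx ξ
  have h := (convex_closedBall (0 : E) ‖ξ‖).norm_image_sub_le_of_norm_hasFDerivWithin_le
    (f := G x) (f' := g x) (C := |C| * ‖ξ‖ ^ (r - 1))
    (fun η _ => (hG.hasFDerivAt x η).hasFDerivWithinAt) (fun η hη => ?_)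
    (x := 0) (y := ξ) (by simp) (by simp)
  · rw [hG.zero, sub_zero, sub_zero, mul_assoc] at h
    refine h.trans_eq ?_
    rcases eq_or_ne ξ 0 with rfl | h0
    · simp [Real.zero_rpow (by linarith : r ≠ 0)]
    · rw [← Real.rpow_add_one (by simpa using h0), sub_add_cancel]
  · rw [mem_closedBall_zero_iff] at hη
    refine (hx η).trans (mul_le_mul (le_abs_self C) ?_ (by positivity) (abs_nonneg _))
    exact Real.rpow_le_rpow (norm_nonneg _) hη (by linarith)

theorem integrable (hG : IsPotential μ r G g) (hr : 1 < r) {u : α → E}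
    (hu : MemLp u (ENNReal.ofReal r) μ) : Integrable (fun x => G x (u x)) μ := by
  obtain ⟨C, -, hC⟩ := hG.growth hr
  have hr0 : 0 < r := by linarith
  have hum := hu.1
  rw [memLp_ofReal_iff hr0 hum] at hu
  refine (hu.const_mul C).mono' (hG.measurable u hum) ?_
  filter_upwards [hC] with x hx
  exact hx _

theorem hasDerivAt_line (hG : IsPotential μ r G g) (hr : 1 < r) {u v : α → E}
    (hu : MemLp u (ENNReal.ofReal r) μ) (hv : MemLp v (ENNReal.ofReal r) μ) (t₀ : ℝ) :
    HasDerivAt (fun t : ℝ => ∫ x, G x (u x + t • v x) ∂μ)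
      (∫ x, g x (u x + t₀ • v x) (v x) ∂μ) t₀ := by
  obtain ⟨C, hC⟩ := hG.bound
  have hr0 : 0 < r := by linarith
  -- A bounds |t| on the unit ball around t₀, and A ≥ 1, so m = ‖u‖ + A‖v‖ dominates both u + tv and
  -- v.
  set A := |t₀| + 1 with hA
  have hA0 : 0 ≤ A := by positivity
  have hm : ∀ t : ℝ, AEStronglyMeasurable (fun x => u x + t • v x) μ := fun t =>
    hu.1.add (hv.1.const_smul t)
  refine (hasDerivAt_integral_of_dominated_loc_of_deriv_le (Metric.ball_mem_nhds t₀ one_pos)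
    (bound := fun x => |C| * (2 ^ r * (‖u x‖ ^ r + A ^ r * ‖v x‖ ^ r)))
    (F' := fun t x => g x (u x + t • v x) (v x))
    (Eventually.of_forall fun t => hG.measurable _ (hm t))
    (hG.integrable hr (hu.add (hv.const_smul t₀))) ?_ ?_ ?_ ?_).2
  · exact (ContinuousLinearMap.id ℝ (E →L[ℝ] ℝ)).aestronglyMeasurable_comp₂
      (hG.measurable_deriv _ (hm t₀)) hv.1
  · filter_upwards [hC] with x hx t ht
    have ht' : |t| ≤ A := by
      rw [Metric.mem_ball, Real.dist_eq] at ht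
      have := abs_sub_abs_le_abs_sub t t₀
      linarith
    have hle : ‖u x + t • v x‖ ≤ ‖u x‖ + A * ‖v x‖ := by
      refine (norm_add_le _ _).trans ?_
      rw [norm_smul, Real.norm_eq_abs]
      gcongr
    have hv1 : ‖v x‖ ≤ ‖u x‖ + A * ‖v x‖ := by
      have : 1 * ‖v x‖ ≤ A * ‖v x‖ := by gcongr; rw [hA]; linarith [abs_nonneg t₀]
      linarith [norm_nonneg (u x)]
    set m := ‖u x‖ + A * ‖v x‖ with hm
    have hm0 : 0 ≤ m := by positivity
    calc ‖g x (u x + t • v x) (v x)‖ ≤ ‖g x (u x + t • v x)‖ * ‖v x‖ :=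
          ContinuousLinearMap.le_opNorm _ _
      _ ≤ (|C| * m ^ (r - 1)) * m := by
          refine mul_le_mul ((hx _).trans (mul_le_mul (le_abs_self C) ?_ (by positivity)
            (abs_nonneg _))) hv1 (norm_nonneg _) (by positivity)
          exact Real.rpow_le_rpow (norm_nonneg _) hle (by linarith)
      _ = |C| * m ^ r := by
          rcases eq_or_ne m 0 with h0 | h0
          · simp [h0, Real.zero_rpow (by linarith : r ≠ 0)]
          · rw [mul_assoc, ← Real.rpow_add_one h0, sub_add_cancel]
      _ ≤ _ := by
          refine mul_le_mul_of_nonneg_left ?_ (abs_nonneg _)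
          rw [← Real.mul_rpow hA0 (norm_nonneg _)]
          exact rpow_add_le (norm_nonneg _) (by positivity) hr0.le
  · exact ((((memLp_ofReal_iff hr0 hu.1).1 hu).add
      (((memLp_ofReal_iff hr0 hv.1).1 hv).const_mul _)).const_mul _).const_mul _
  · refine Eventually.of_forall fun x t _ => ?_
    have h1 : HasDerivAt (fun t : ℝ => u x + t • v x) (v x) t := by
      simpa using ((hasDerivAt_id t).smul_const (v x)).const_add (u x)
    exact (hG.hasFDerivAt x (u x + t • v x)).comp_hasDerivAt t h1

/-- For s conjugate to r one has r - 1 = r/s, so the superposition operator of g is continuous from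
L^r to L^s. Pairing L^s with L^r turns it into a continuous map D into the dual, and directional
derivatives given by such a D are Fréchet derivatives. -/
theorem exists_hasFDerivAt (hG : IsPotential μ r G g) (hr : 1 < r)
    [Fact (1 ≤ ENNReal.ofReal r)] :
    ∃ D : Lp E (ENNReal.ofReal r) μ → Lp E (ENNReal.ofReal r) μ →L[ℝ] ℝ,
      Continuous D ∧ (∀ u, HasFDerivAt (fun w : Lp E (ENNReal.ofReal r) μ =>
        ∫ x, G x (w x) ∂μ) (D u) u) ∧ (∀ u v, D u v = ∫ x, g x (u x) (v x) ∂μ) ∧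
      ∃ K, ∀ u, ‖D u‖ ≤ K * ‖u‖ ^ (r - 1) := by
  have hr0 : 0 < r := by linarith
  have hconj : r.HolderConjugate r.conjExponent := Real.HolderConjugate.conjExponent hr
  set s := r.conjExponent with hs
  have hs0 : 0 < s := hconj.symm.pos
  have : Fact (1 ≤ ENNReal.ofReal s) := fact_one_le hconj.symm.lt
  have : ENNReal.HolderConjugate (ENNReal.ofReal s) (ENNReal.ofReal r) :=
    ⟨by simpa using hconj.symm.inv_add_inv_ennreal⟩
  have hrs : r / s = r - 1 := hconj.div_conj_eq_sub_one
  obtain ⟨C, hC⟩ := hG.bound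
  rw [← hrs] at hC
  let B : (E →L[ℝ] ℝ) →L[ℝ] E →L[ℝ] ℝ := ContinuousLinearMap.id ℝ (E →L[ℝ] ℝ)
  let S := superposition hr0 hs0 hG.measurable_deriv hC
  let D : Lp E (ENNReal.ofReal r) μ → Lp E (ENNReal.ofReal r) μ →L[ℝ] ℝ :=
    fun u => B.lpPairing μ (ENNReal.ofReal s) (ENNReal.ofReal r) (S u)
  have hDc : Continuous D := (ContinuousLinearMap.continuous _).comp
    (continuous_superposition hr0 hs0 hG.measurable_deriv hC hG.continuous_deriv)
  have hD : ∀ u v, D u v = ∫ x, g x (u x) (v x) ∂μ := fun u v => by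
    simp only [D]
    rw [ContinuousLinearMap.lpPairing_eq_integral]
    refine integral_congr_ae ?_
    filter_upwards [superposition_ae hr0 hs0 hG.measurable_deriv hC u] with x hx
    simp only [S, hx]
    rfl
  refine ⟨D, hDc, fun u => hasFDerivAt_of_hasDerivAt_line (fun u v t => ?_) hDc u, hD,
    ‖B.lpPairing μ (ENNReal.ofReal s) (ENNReal.ofReal r)‖ * |C|, fun u => ?_⟩
  · rw [hD]
    have hae : ∀ t : ℝ, (u + t • v : Lp E (ENNReal.ofReal r) μ) =ᵐ[μ] fun x => u x + t • v x :=
      fun t => by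
        filter_upwards [Lp.coeFn_add u (t • v), Lp.coeFn_smul t v] with x h1 h2
        rw [h1, Pi.add_apply, h2, Pi.smul_apply]
    have e1 : ∀ t : ℝ, ∫ x, G x ((u + t • v : Lp E (ENNReal.ofReal r) μ) x) ∂μ =
        ∫ x, G x (u x + t • v x) ∂μ := fun t =>
      integral_congr_ae ((hae t).mono fun x hx => by simp only [hx])
    simp only [e1]
    convert hG.hasDerivAt_line hr (Lp.memLp u) (Lp.memLp v) t using 1
    exact integral_congr_ae ((hae t).mono fun x hx => by simp only [hx])
  · have h1 : ‖S u‖ ≤ |C| * ‖u‖ ^ (r - 1) := by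
      have h2 : ‖S u‖ ^ s ≤ (|C| * ‖u‖ ^ (r / s)) ^ s := by
        rw [Real.mul_rpow (abs_nonneg _) (by positivity), ← Real.rpow_mul (norm_nonneg _),
          div_mul_cancel₀ _ hs0.ne', Lp.norm_rpow_eq_integral hs0, Lp.norm_rpow_eq_integral hr0,
          ← integral_const_mul]
        refine integral_mono_ae (Lp.integrable_norm_rpow hs0 _)
          ((Lp.integrable_norm_rpow hr0 _).const_mul _) ?_
        filter_upwards [hC, superposition_ae hr0 hs0 hG.measurable_deriv hC u] with x hx h3
        simp only [S, h3]
        exact norm_rpow_superposition_le (norm_nonneg _) (norm_nonneg _) hs0 (hx _)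
      rw [hrs] at h2
      exact (Real.rpow_le_rpow_iff (norm_nonneg _) (by positivity) hs0).1 h2
    refine (ContinuousLinearMap.le_opNorm _ _).trans ?_
    rw [mul_assoc]
    exact mul_le_mul_of_nonneg_left h1 (norm_nonneg _)

end IsPotential

end Potential

/-! ### Weak gradients and translations -/

section Translation

variable {N : ℕ}

/-- Since |th| ≤ |h| for t in (0, 1], all translates ψ(· - th) live in one ball, where w is
integrable. This is the hypothesis of Fubini's theorem in `HasWeakGradient.translate_sub`. -/
theorem integrable_prod_translate_mul {w : Euc N → ℝ} (hw : LocallyIntegrable w volume)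
    {ψ : Euc N → ℝ} (hψ : StronglyMeasurable ψ) {C R : ℝ} (hC : ∀ x, |ψ x| ≤ C)
    (hR : ∀ x, R < ‖x‖ → ψ x = 0) (h : Euc N) :
    Integrable (fun z : ℝ × Euc N => ψ (z.2 - z.1 • h) * w z.2)
      ((volume.restrict (Set.Ioc (0 : ℝ) 1)).prod volume) := by
  have hC0 : 0 ≤ C := (abs_nonneg _).trans (hC 0)
  set K := Metric.closedBall (0 : Euc N) (R + ‖h‖) with hK
  have hwK : Integrable (K.indicator fun x => ‖w x‖) volume :=
    (integrable_indicator_iff Metric.isClosed_closedBall.measurableSet).2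
      (hw.integrableOn_isCompact (isCompact_closedBall _ _)).norm
  have hdom : Integrable (fun z : ℝ × Euc N => C * K.indicator (fun x => ‖w x‖) z.2)
      ((volume.restrict (Set.Ioc (0 : ℝ) 1)).prod volume) :=
    (hwK.comp_snd _).const_mul C
  refine hdom.mono' ?_ ?_
  · refine AEStronglyMeasurable.mul ?_ hw.aestronglyMeasurable.comp_snd
    have : Measurable fun z : ℝ × Euc N => z.2 - z.1 • h := by fun_prop
    exact (hψ.comp_measurable this).aestronglyMeasurable
  · have hae : ∀ᵐ z : ℝ × Euc N ∂((volume.restrict (Set.Ioc (0 : ℝ) 1)).prod volume),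
        z.1 ∈ Set.Ioc (0 : ℝ) 1 :=
      Measure.quasiMeasurePreserving_fst.ae (ae_restrict_mem measurableSet_Ioc)
    filter_upwards [hae] with z hz
    rw [norm_mul, Real.norm_eq_abs]
    by_cases hzK : z.2 ∈ K
    · rw [Set.indicator_of_mem hzK]
      exact mul_le_mul_of_nonneg_right (hC _) (norm_nonneg _)
    · rw [hR, abs_zero, zero_mul]
      · exact mul_nonneg hC0 (Set.indicator_nonneg (fun _ _ => norm_nonneg _) _)
      · rw [hK, mem_closedBall_zero_iff, not_le] at hzK
        have h1 := norm_sub_norm_le z.2 (z.1 • h)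
        have h2 : ‖z.1 • h‖ ≤ ‖h‖ := by
          rw [norm_smul, Real.norm_of_nonneg hz.1.le]
          exact mul_le_of_le_one_left (norm_nonneg _) hz.2
        linarith

/-- The shear transports joint measurability and integrability from w(x) to w(x + th), for functions
that are only a.e. measurable. -/
theorem measurePreserving_shear (h : Euc N) :
    MeasurePreserving (fun z : ℝ × Euc N => (z.1, z.2 + z.1 • h))
      ((volume.restrict (Set.Ioc (0 : ℝ) 1)).prod volume)
      ((volume.restrict (Set.Ioc (0 : ℝ) 1)).prod volume) := by
  refine (MeasurePreserving.id _).skew_product (g := fun (t : ℝ) (x : Euc N) => x + t • h)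
    (by fun_prop) (Eventually.of_forall fun t => ?_)
  exact (measurePreserving_add_right volume (t • h)).map_eq

theorem integrable_prod_mul_translate {w : Euc N → ℝ} (hw : LocallyIntegrable w volume)
    {ψ : Euc N → ℝ} (hψ : StronglyMeasurable ψ) {C R : ℝ} (hC : ∀ x, |ψ x| ≤ C)
    (hR : ∀ x, R < ‖x‖ → ψ x = 0) (h : Euc N) :
    Integrable (fun z : ℝ × Euc N => ψ z.2 * w (z.2 + z.1 • h))
      ((volume.restrict (Set.Ioc (0 : ℝ) 1)).prod volume) := by
  have h1 := (measurePreserving_shear h).integrable_comp_of_integrable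
    (integrable_prod_translate_mul hw hψ hC hR h)
  simpa [Function.comp_def] using h1

/-- The translation difference of a function is the integral of its weak gradient along the
segment. -/
theorem HasWeakGradient.translate_sub {u : Euc N → ℝ} {g : Euc N → Euc N}
    (hu : HasWeakGradient u g) (h : Euc N) :
    ∀ᵐ x, u (x + h) - u x = ∫ t in Set.Ioc (0 : ℝ) 1, inner ℝ (g (x + t • h)) h := by
  set w : Euc N → ℝ := fun x => inner ℝ (g x) h with hw
  have hwl : LocallyIntegrable w volume := fun x => by
    obtain ⟨s, hs, hi⟩ := hu.2 x
    exact ⟨s, hs, hi.inner_const h⟩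
  have hut : LocallyIntegrable (fun x => u (x + h)) volume := by
    rw [locallyIntegrable_iff]
    intro K hK
    have hK' : IsCompact ((fun x => x + h) '' K) := hK.image (by fun_prop)
    have := hu.1.integrableOn_isCompact hK'
    exact ((measurePreserving_add_right volume h).integrableOn_image
      (MeasurableEquiv.addRight h).measurableEmbedding).1 this
  have hIl : LocallyIntegrable (fun x => ∫ t in Set.Ioc (0 : ℝ) 1, w (x + t • h)) volume := by
    rw [locallyIntegrable_iff]
    intro K hK
    obtain ⟨R, hR⟩ := hK.isBounded.subset_closedBall 0
    have h1 := (integrable_prod_mul_translate hwl (ψ := K.indicator fun _ => (1 : ℝ)) (C := 1)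
      (R := R) (stronglyMeasurable_const.indicator hK.measurableSet) (fun x => ?_)
      (fun x hx => ?_) h).integral_prod_right
    · rw [← integrable_indicator_iff hK.measurableSet]
      refine h1.congr (Eventually.of_forall fun x => ?_)
      by_cases hx : x ∈ K <;> simp [hx]
    · by_cases hx : x ∈ K <;> simp [hx]
    · refine Set.indicator_of_notMem (fun hxK => ?_) _
      have := hR hxK
      rw [mem_closedBall_zero_iff] at this
      linarith
  -- Both sides are tested against φ. The translation moves onto φ, the fundamental theorem of
  -- calculus expresses φ(x - h) - φ(x) through ψ = ⟨∇φ, h⟩, and for each t the definition of the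
  -- weak gradient is applied to the translate φ(· - th); Fubini exchanges x and t before and after.
  have key := ae_eq_of_integral_contDiff_smul_eq (μ := (volume : Measure (Euc N)))
    (hut.sub hu.1) hIl fun φ hφ hc => ?_
  · filter_upwards [key] with x hx
    exact hx
  obtain ⟨R, hR⟩ := hc.isCompact.isBounded.subset_closedBall 0
  obtain ⟨C, hC⟩ := hφ.continuous.bounded_above_of_compact_support hc
  have hφR : ∀ x, R < ‖x‖ → φ x = 0 := fun x hx => by
    refine image_eq_zero_of_notMem_tsupport fun hxK => ?_
    have := hR hxK
    rw [mem_closedBall_zero_iff] at this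
    linarith
  have hφm : StronglyMeasurable φ := hφ.continuous.stronglyMeasurable
  set ψ : Euc N → ℝ := fun x => inner ℝ (gradient φ x) h with hψ
  have hψc : Continuous ψ := (continuous_gradient hφ).inner continuous_const
  have hψs : HasCompactSupport ψ :=
    (hasCompactSupport_gradient hc).comp_left (g := fun v => inner ℝ v h) (inner_zero_left _)
  obtain ⟨R', hR'⟩ := hψs.isCompact.isBounded.subset_closedBall 0
  obtain ⟨C', hC'⟩ := hψc.bounded_above_of_compact_support hψs
  have hψR : ∀ x, R' < ‖x‖ → ψ x = 0 := fun x hx => by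
    refine image_eq_zero_of_notMem_tsupport fun hxK => ?_
    have := hR' hxK
    rw [mem_closedBall_zero_iff] at this
    linarith
  have hftc : ∀ x, φ (x - h) - φ x = -∫ t in Set.Ioc (0 : ℝ) 1, ψ (x - t • h) := fun x => by
    have h1 : ∀ t ∈ Set.uIcc (0 : ℝ) 1, HasDerivAt (fun t : ℝ => φ (x - t • h))
        (-ψ (x - t • h)) t := fun t _ => by
      have h2 : HasDerivAt (fun t : ℝ => x - t • h) (-h) t := by
        simpa using ((hasDerivAt_id t).smul_const h).const_sub x
      have h3 : HasFDerivAt φ (fderiv ℝ φ (x - t • h)) (x - t • h) :=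
        (hφ.differentiable (by simp) _).hasFDerivAt
      have h4 := h3.comp_hasDerivAt t h2
      have h6 : ψ (x - t • h) = fderiv ℝ φ (x - t • h) h := by
        simp only [hψ, gradient, InnerProductSpace.toDual_symm_apply]
      rw [h6, ← map_neg]
      exact h4
    have h5 := intervalIntegral.integral_eq_sub_of_hasDerivAt h1
      (Continuous.intervalIntegrable (by fun_prop) _ _)
    rw [intervalIntegral.integral_of_le zero_le_one, integral_neg] at h5
    simpa using h5.symm
  have hslice : ∀ t : ℝ, ∫ x, ψ (x - t • h) * u x = -∫ x, φ (x - t • h) * w x := fun t => by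
    set φt : Euc N → ℝ := fun x => φ (x - t • h) with hφt
    have hφtd : ContDiff ℝ ∞ φt := hφ.comp (contDiff_id.sub contDiff_const)
    have hφtc : HasCompactSupport φt :=
      hc.comp_homeomorph (Homeomorph.subRight (t • h))
    have h1 := hu.3 φt hφtd hφtc
    have hgrad : ∀ x, gradient φt x = gradient φ (x - t • h) := fun x => by
      simp only [gradient, hφt, sub_eq_add_neg, fderiv_comp_add_right]
    have i1 : Integrable (fun x => u x • gradient φt x) volume :=
      hu.1.integrable_smul_right_of_hasCompactSupport (continuous_gradient hφtd)
        (hasCompactSupport_gradient hφtc)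
    have i2 : Integrable (fun x => φt x • g x) volume :=
      hu.2.integrable_smul_left_of_hasCompactSupport hφtd.continuous hφtc
    have h2 := congrArg (fun v => inner ℝ h v) h1
    simp only [inner_neg_right] at h2
    rw [← integral_inner i1, ← integral_inner i2] at h2
    have e1 : ∀ x, ψ (x - t • h) * u x = inner ℝ h (u x • gradient φt x) := fun x => by
      rw [inner_smul_right, hgrad, real_inner_comm, mul_comm]
    have e2 : ∀ x, φ (x - t • h) * w x = inner ℝ h (φt x • g x) := fun x => by
      rw [inner_smul_right, real_inner_comm]
    simp only [e1, e2]
    exact h2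
  simp only [Pi.sub_apply, smul_eq_mul]
  have i3 : Integrable (fun x => φ x * u (x + h)) volume := by
    simpa using hut.integrable_smul_left_of_hasCompactSupport hφ.continuous hc
  have i4 : Integrable (fun x => φ x * u x) volume := by
    simpa using hu.1.integrable_smul_left_of_hasCompactSupport hφ.continuous hc
  have i5 : Integrable (fun x => φ (x - h) * u x) volume := by
    have := i3.comp_sub_right h
    simpa using this
  calc ∫ x, φ x * (u (x + h) - u x)
      = ∫ x, (φ (x - h) - φ x) * u x := by
        have e1 : ∫ x, φ x * u (x + h) = ∫ x, φ (x - h) * u x := by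
          rw [← integral_add_right_eq_self (fun x => φ (x - h) * u x) h]
          simp
        simp only [mul_sub, sub_mul]
        rw [integral_sub i3 i4, integral_sub i5 i4, e1]
    _ = -∫ x, ∫ t in Set.Ioc (0 : ℝ) 1, ψ (x - t • h) * u x := by
        rw [← integral_neg]
        refine integral_congr_ae (Eventually.of_forall fun x => ?_)
        simp only [hftc, integral_mul_const, neg_mul]
    _ = -∫ t in Set.Ioc (0 : ℝ) 1, ∫ x, ψ (x - t • h) * u x := by
        rw [← integral_integral_swap (f := fun (t : ℝ) (x : Euc N) => ψ (x - t • h) * u x)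
          (integrable_prod_translate_mul hu.1 hψc.stronglyMeasurable hC' hψR h)]
    _ = ∫ t in Set.Ioc (0 : ℝ) 1, ∫ x, φ x * w (x + t • h) := by
        simp only [hslice, integral_neg, neg_neg]
        refine integral_congr_ae (Eventually.of_forall fun t => ?_)
        simp only
        rw [← integral_add_right_eq_self (fun x => φ (x - t • h) * w x) (t • h)]
        simp
    _ = ∫ x, ∫ t in Set.Ioc (0 : ℝ) 1, φ x * w (x + t • h) :=
        integral_integral_swap (f := fun (t : ℝ) (x : Euc N) => φ x * w (x + t • h))
          (integrable_prod_mul_translate hwl hφm hC hφR h)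
    _ = _ := by simp only [integral_const_mul]

end Translation

/-- Jensen's inequality, read off from the monotonicity of L^p norms on a probability space. -/
theorem enorm_integral_rpow_le {β F : Type*} [MeasurableSpace β] {ν : Measure β}
    [IsProbabilityMeasure ν] [NormedAddCommGroup F] [NormedSpace ℝ F] {a : β → F}
    (ha : AEStronglyMeasurable a ν) {p : ℝ} (hp : 1 ≤ p) :
    ‖∫ y, a y ∂ν‖ₑ ^ p ≤ ∫⁻ y, ‖a y‖ₑ ^ p ∂ν := by
  have hp0 : 0 < p := by linarith
  have h1 := eLpNorm'_le_eLpNorm'_of_exponent_le one_pos hp ν ha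
  rw [eLpNorm', eLpNorm'] at h1
  simp only [ENNReal.rpow_one, div_one] at h1
  have h2 := ENNReal.rpow_le_rpow ((enorm_integral_le_lintegral_enorm a).trans h1) hp0.le
  rwa [← ENNReal.rpow_mul, one_div_mul_cancel hp0.ne', ENNReal.rpow_one] at h2

/-! ### Distance of a function from its ball averages -/

section Averages

variable {N : ℕ} {p : ℝ}

instance : IsProbabilityMeasure (volume.restrict (Set.Ioc (0 : ℝ) 1)) := ⟨by simp⟩

theorem aestronglyMeasurable_translate {F : Type*} [NormedAddCommGroup F] {g : Euc N → F}
    (hg : AEStronglyMeasurable g volume) (h : Euc N) :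
    AEStronglyMeasurable (fun z : ℝ × Euc N => g (z.2 + z.1 • h))
      ((volume.restrict (Set.Ioc (0 : ℝ) 1)).prod volume) := by
  have := (hg.comp_snd (μ := volume.restrict (Set.Ioc (0 : ℝ) 1))).comp_measurePreserving
    (measurePreserving_shear h)
  exact this

/-- Jensen's inequality in t bounds the p-th power of the segment integral; Tonelli and translation
invariance then remove the shift th. -/
theorem HasWeakGradient.lintegral_translate_sub_le {u : Euc N → ℝ} {g : Euc N → Euc N}
    (hu : HasWeakGradient u g) (hp : 1 ≤ p) (h : Euc N) :
    ∫⁻ x, ‖u (x + h) - u x‖ₑ ^ p ≤ ‖h‖ₑ ^ p * ∫⁻ x, ‖g x‖ₑ ^ p := by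
  have hp0 : 0 < p := by linarith
  have hgm := aestronglyMeasurable_translate hu.2.aestronglyMeasurable h
  have hm2 : AEMeasurable (fun z : Euc N × ℝ => ‖g (z.1 + z.2 • h)‖ₑ ^ p)
      (volume.prod (volume.restrict (Set.Ioc (0 : ℝ) 1))) :=
    (hgm.prod_swap.enorm).pow_const p
  have hslice : ∀ᵐ x : Euc N, AEStronglyMeasurable (fun t : ℝ => g (x + t • h))
      (volume.restrict (Set.Ioc (0 : ℝ) 1)) :=
    hgm.prod_swap.prodMk_left
  calc ∫⁻ x, ‖u (x + h) - u x‖ₑ ^ p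
      ≤ ∫⁻ x, ‖h‖ₑ ^ p * ∫⁻ t in Set.Ioc (0 : ℝ) 1, ‖g (x + t • h)‖ₑ ^ p := by
        refine lintegral_mono_ae ?_
        filter_upwards [hu.translate_sub h, hslice] with x hx hm
        rw [hx]
        refine (enorm_integral_rpow_le (hm.inner aestronglyMeasurable_const) hp).trans ?_
        rw [← lintegral_const_mul'' _ (hm.enorm.pow_const p)]
        refine lintegral_mono fun t => ?_
        rw [← ENNReal.mul_rpow_of_nonneg _ _ hp0.le, mul_comm]
        refine ENNReal.rpow_le_rpow ?_ hp0.le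
        rw [enorm_eq_nnnorm, enorm_eq_nnnorm, enorm_eq_nnnorm]
        exact_mod_cast nnnorm_inner_le_nnnorm (𝕜 := ℝ) _ _
    _ = ‖h‖ₑ ^ p * ∫⁻ x, ∫⁻ t in Set.Ioc (0 : ℝ) 1, ‖g (x + t • h)‖ₑ ^ p := by
        rw [lintegral_const_mul'' _ hm2.lintegral_prod_right']
    _ = ‖h‖ₑ ^ p * ∫⁻ t in Set.Ioc (0 : ℝ) 1, ∫⁻ x, ‖g (x + t • h)‖ₑ ^ p := by
        rw [lintegral_lintegral_swap (f := fun (x : Euc N) (t : ℝ) => ‖g (x + t • h)‖ₑ ^ p) hm2]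
    _ = _ := by
        congr 1
        have : ∀ t : ℝ, ∫⁻ x, ‖g (x + t • h)‖ₑ ^ p = ∫⁻ x, ‖g x‖ₑ ^ p := fun t =>
          lintegral_add_right_eq_self (fun x => ‖g x‖ₑ ^ p) (t • h)
        simp only [this]
        simp

/-- The uniform probability measure on the ball of radius `τ` around the origin. -/
def ballProb (N : ℕ) (τ : ℝ) : Measure (Euc N) :=
  (volume (Metric.ball (0 : Euc N) τ))⁻¹ • volume.restrict (Metric.ball 0 τ)

theorem isProbabilityMeasure_ballProb {τ : ℝ} (hτ : 0 < τ) :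
    IsProbabilityMeasure (ballProb N τ) := by
  refine ⟨?_⟩
  rw [ballProb, Measure.smul_apply, Measure.restrict_apply_univ, smul_eq_mul]
  exact ENNReal.inv_mul_cancel (Metric.measure_ball_pos _ _ hτ).ne' measure_ball_lt_top.ne

/-- The average of `u` over the ball of radius `τ` around `x`. -/
def ballAvg (τ : ℝ) (u : Euc N → ℝ) (x : Euc N) : ℝ :=
  ∫ y, u (x + y) ∂ballProb N τ

theorem ballProb_absolutelyContinuous (τ : ℝ) : ballProb N τ ≪ volume :=
  (Measure.smul_absolutelyContinuous).trans Measure.restrict_le_self.absolutelyContinuous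

theorem aestronglyMeasurable_add_ballProb {u : Euc N → ℝ} (hu : AEStronglyMeasurable u volume)
    {τ : ℝ} (hτ : 0 < τ) :
    AEStronglyMeasurable (fun z : Euc N × Euc N => u (z.1 + z.2))
      (volume.prod (ballProb N τ)) := by
  have := isProbabilityMeasure_ballProb (N := N) hτ
  have hq : Measure.QuasiMeasurePreserving (fun z : Euc N × Euc N => z.1 + z.2)
      (volume.prod volume) volume :=
    quasiMeasurePreserving_add ..
  have h1 := hu.comp_quasiMeasurePreserving hq
  exact h1.mono_ac (Measure.AbsolutelyContinuous.rfl.prod (ballProb_absolutelyContinuous τ))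

theorem aestronglyMeasurable_ballAvg {u : Euc N → ℝ} (hu : AEStronglyMeasurable u volume)
    {τ : ℝ} (hτ : 0 < τ) : AEStronglyMeasurable (ballAvg τ u) volume := by
  have := isProbabilityMeasure_ballProb (N := N) hτ
  exact (aestronglyMeasurable_add_ballProb hu hτ).integral_prod_right'

theorem aestronglyMeasurable_add_left {u : Euc N → ℝ} (hu : AEStronglyMeasurable u volume)
    (τ : ℝ) (x : Euc N) : AEStronglyMeasurable (fun y => u (x + y)) (ballProb N τ) :=
  (hu.comp_measurePreserving (measurePreserving_add_left volume x)).mono_ac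
    (ballProb_absolutelyContinuous τ)

theorem integrable_add_ballProb {u : Euc N → ℝ} (hu : LocallyIntegrable u volume)
    {τ : ℝ} (hτ : 0 < τ) (x : Euc N) : Integrable (fun y => u (x + y)) (ballProb N τ) := by
  refine Integrable.smul_measure ?_
    (ENNReal.inv_ne_top.2 (Metric.measure_ball_pos _ _ hτ).ne')
  have h1 : IntegrableOn u (Metric.closedBall x τ) volume :=
    hu.integrableOn_isCompact (isCompact_closedBall _ _)
  have h2 : IntegrableOn u ((fun y => x + y) '' Metric.ball 0 τ) volume := by
    refine h1.mono_set ?_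
    rintro _ ⟨y, hy, rfl⟩
    rw [mem_ball_zero_iff] at hy
    simpa using hy.le
  exact ((measurePreserving_add_left volume x).integrableOn_image
    (MeasurableEquiv.addLeft x).measurableEmbedding).1 h2

/-- Jensen's inequality on the ball, followed by enlarging the domain of integration to the whole
space. -/
theorem enorm_ballAvg_rpow_le {u : Euc N → ℝ} (hu : AEStronglyMeasurable u volume)
    (hp : 1 ≤ p) {τ : ℝ} (hτ : 0 < τ) (x : Euc N) :
    ‖ballAvg τ u x‖ₑ ^ p ≤ (volume (Metric.ball (0 : Euc N) τ))⁻¹ * ∫⁻ y, ‖u y‖ₑ ^ p := by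
  have := isProbabilityMeasure_ballProb (N := N) hτ
  refine (enorm_integral_rpow_le (aestronglyMeasurable_add_left hu τ x) hp).trans ?_
  rw [ballProb, lintegral_smul_measure, smul_eq_mul]
  refine mul_le_mul_right ((setLIntegral_le_lintegral _ _).trans_eq ?_) _
  exact lintegral_add_left_eq_self (fun y => ‖u y‖ₑ ^ p) x

/-- The translation estimate averaged over shifts |y| < τ. It is the source of both the Sobolev
inequality and the compact embedding. -/
theorem HasWeakGradient.lintegral_sub_ballAvg_le {u : Euc N → ℝ} {g : Euc N → Euc N}
    (hu : HasWeakGradient u g) (hp : 1 ≤ p) {τ : ℝ} (hτ : 0 < τ) :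
    ∫⁻ x, ‖u x - ballAvg τ u x‖ₑ ^ p ≤ ENNReal.ofReal τ ^ p * ∫⁻ x, ‖g x‖ₑ ^ p := by
  have := isProbabilityMeasure_ballProb (N := N) hτ
  have hp0 : 0 < p := by linarith
  have hm : AEMeasurable (fun z : Euc N × Euc N => ‖u (z.1 + z.2) - u z.1‖ₑ ^ p)
      (volume.prod (ballProb N τ)) :=
    (((aestronglyMeasurable_add_ballProb hu.1.aestronglyMeasurable hτ).sub
      hu.1.aestronglyMeasurable.comp_fst).enorm).pow_const p
  calc ∫⁻ x, ‖u x - ballAvg τ u x‖ₑ ^ p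
      ≤ ∫⁻ x, ∫⁻ y, ‖u (x + y) - u x‖ₑ ^ p ∂ballProb N τ := by
        refine lintegral_mono fun x => ?_
        have h1 : ballAvg τ u x - u x = ∫ y, (u (x + y) - u x) ∂ballProb N τ := by
          rw [integral_sub (integrable_add_ballProb hu.1 hτ x) (integrable_const _)]
          simp [ballAvg]
        simp only
        rw [← enorm_neg, neg_sub, h1]
        exact enorm_integral_rpow_le ((aestronglyMeasurable_add_left
          hu.1.aestronglyMeasurable τ x).sub aestronglyMeasurable_const) hp
    _ = ∫⁻ y, (∫⁻ x, ‖u (x + y) - u x‖ₑ ^ p) ∂ballProb N τ :=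
        lintegral_lintegral_swap (f := fun x y => ‖u (x + y) - u x‖ₑ ^ p) hm
    _ ≤ ∫⁻ _, (ENNReal.ofReal τ ^ p * ∫⁻ x, ‖g x‖ₑ ^ p) ∂ballProb N τ := by
        have hball : ∀ᵐ y ∂ballProb N τ, y ∈ Metric.ball (0 : Euc N) τ :=
          Measure.smul_absolutelyContinuous.ae_le (ae_restrict_mem Metric.isOpen_ball.measurableSet)
        refine lintegral_mono_ae ?_
        filter_upwards [hball] with y hy
        refine (hu.lintegral_translate_sub_le hp y).trans (mul_le_mul_left ?_ _)
        refine ENNReal.rpow_le_rpow ?_ hp0.le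
        rw [mem_ball_zero_iff] at hy
        rw [← ofReal_norm]
        exact ENNReal.ofReal_le_ofReal hy.le
    _ = _ := by simp

end Averages

/-! ### The subcritical Sobolev inequality by bootstrapping -/

section Sobolev

variable {N : ℕ} {p : ℝ}

/-- The `L^r` integral is bounded on the unit ball of `W^{1,p}(ℝ^N)`. -/
def SobolevBound (N : ℕ) (p r : ℝ) : Prop :=
  ∃ C : ℝ, ∀ (u : Euc N → ℝ) (g : Euc N → Euc N), HasWeakGradient u g →
    ∫⁻ x, ‖u x‖ₑ ^ p ≤ 1 → ∫⁻ x, ‖g x‖ₑ ^ p ≤ 1 → ∫⁻ x, ‖u x‖ₑ ^ r ≤ ENNReal.ofReal C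

theorem measure_ge_le_rpow {u : Euc N → ℝ} (hu : AEStronglyMeasurable u volume) (hp : 0 < p)
    {A t : ℝ} (hA : ∫⁻ x, ‖u x‖ₑ ^ p ≤ ENNReal.ofReal A) (ht : 0 < t) :
    volume {x | t ≤ |u x|} ≤ ENNReal.ofReal (A / t ^ p) := by
  have h1 := meas_ge_le_lintegral_div (μ := volume) ((hu.enorm).pow_const p)
    (ε := ENNReal.ofReal (t ^ p)) (by simpa using Real.rpow_pos_of_pos ht p) ENNReal.ofReal_ne_top
  have h2 : {x | t ≤ |u x|} ⊆ {x | ENNReal.ofReal (t ^ p) ≤ ‖u x‖ₑ ^ p} := fun x hx => by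
    rw [Set.mem_ofPred_eq, ← ofReal_norm, ENNReal.ofReal_rpow_of_nonneg (norm_nonneg _) hp.le]
    exact ENNReal.ofReal_le_ofReal (Real.rpow_le_rpow ht.le hx hp.le)
  refine (measure_mono h2).trans (h1.trans ?_)
  rw [ENNReal.ofReal_div_of_pos (Real.rpow_pos_of_pos ht p)]
  exact ENNReal.div_le_div_right hA _

/-- At height s take balls so large that the L^r bound forces the averages below s/2. Then |u| ≥ s
implies that u is at least s/2 away from its average, and Chebyshev's inequality with the gradient
estimate yields τ^p (s/2)^(-p), where τ is proportional to s^(-r/N). -/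
theorem SobolevBound.measure_ge_le (hN : 1 ≤ N) (hp : 1 ≤ p) {r : ℝ} (hr : 1 ≤ r)
    (h : SobolevBound N p r) :
    ∃ D : ℝ, 0 ≤ D ∧ ∀ (u : Euc N → ℝ) (g : Euc N → Euc N), HasWeakGradient u g →
      ∫⁻ x, ‖u x‖ₑ ^ p ≤ 1 → ∫⁻ x, ‖g x‖ₑ ^ p ≤ 1 → ∀ s : ℝ, 0 < s →
      volume {x | s ≤ |u x|} ≤ ENNReal.ofReal (D * s ^ (-(p + r * p / N))) := by
  obtain ⟨C₀, hC₀⟩ := h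
  have hp0 : 0 < p := by linarith
  have hr0 : 0 < r := by linarith
  have hN0 : (0 : ℝ) < N := by exact_mod_cast hN
  set C := max C₀ 1 with hCdef
  have hC1 : 0 < C := lt_of_lt_of_le one_pos (le_max_right _ _)
  set β := (volume (Metric.ball (0 : Euc N) 1)).toReal with hβ
  have hβt : volume (Metric.ball (0 : Euc N) 1) ≠ ⊤ := measure_ball_lt_top.ne
  have hβ0 : 0 < β := ENNReal.toReal_pos (Metric.measure_ball_pos _ _ one_pos).ne' hβt
  set κ := 2 ^ r * C / β with hκ
  have hκ0 : 0 < κ := by positivity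
  refine ⟨κ ^ (p / N) * 2 ^ p, by positivity, fun u g hu hup hgp s hs => ?_⟩
  -- Chosen so that the ball has volume 2^r C / s^r, which makes the bound C / volume equal to
  -- (s/2)^r.
  set τ := (κ / s ^ r) ^ (1 / (N : ℝ)) with hτ
  have hτ0 : 0 < τ := by positivity
  have hτN : τ ^ N = κ / s ^ r := by
    rw [hτ, ← Real.rpow_natCast, ← Real.rpow_mul (by positivity), one_div_mul_cancel hN0.ne',
      Real.rpow_one]
  have hvol : volume (Metric.ball (0 : Euc N) τ) = ENNReal.ofReal (τ ^ N * β) := by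
    rw [Measure.addHaar_ball_of_pos _ _ hτ0, finrank_euclideanSpace_fin,
      ENNReal.ofReal_mul (by positivity), hβ, ENNReal.ofReal_toReal hβt]
  have havg : ∀ x, |ballAvg τ u x| ≤ s / 2 := fun x => by
    have h1 := enorm_ballAvg_rpow_le hu.1.aestronglyMeasurable hr hτ0 x
    have h2 : (volume (Metric.ball (0 : Euc N) τ))⁻¹ * ∫⁻ y, ‖u y‖ₑ ^ r ≤
        ENNReal.ofReal ((s / 2) ^ r) := by
      rw [hvol, ← ENNReal.ofReal_inv_of_pos (by positivity)]
      have h3 : ∫⁻ y, ‖u y‖ₑ ^ r ≤ ENNReal.ofReal C :=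
        (hC₀ u g hu hup hgp).trans (ENNReal.ofReal_le_ofReal (le_max_left _ _))
      refine (mul_le_mul_right h3 _).trans ?_
      rw [← ENNReal.ofReal_mul (by positivity)]
      refine ENNReal.ofReal_le_ofReal (le_of_eq ?_)
      rw [hτN, hκ, Real.div_rpow hs.le zero_le_two]
      field_simp
    have h4 := h1.trans h2
    rw [← ofReal_norm, ENNReal.ofReal_rpow_of_nonneg (norm_nonneg _) hr0.le,
      ENNReal.ofReal_le_ofReal_iff (by positivity)] at h4
    exact (Real.rpow_le_rpow_iff (norm_nonneg _) (by positivity) hr0).1 h4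
  have hsub : {x | s ≤ |u x|} ⊆ {x | s / 2 ≤ |u x - ballAvg τ u x|} := fun x hx => by
    have h1 := havg x
    have h2 := abs_sub_abs_le_abs_sub (u x) (ballAvg τ u x)
    simp only [Set.mem_ofPred_eq] at hx ⊢
    linarith
  have hI : ∫⁻ x, ‖u x - ballAvg τ u x‖ₑ ^ p ≤ ENNReal.ofReal (τ ^ p) := by
    refine (hu.lintegral_sub_ballAvg_le hp hτ0).trans ?_
    rw [ENNReal.ofReal_rpow_of_nonneg hτ0.le hp0.le]
    exact mul_le_of_le_one_right' hgp
  refine (measure_mono hsub).trans ((measure_ge_le_rpow (hu.1.aestronglyMeasurable.sub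
    (aestronglyMeasurable_ballAvg hu.1.aestronglyMeasurable hτ0)) hp0 hI (by positivity)).trans ?_)
  refine ENNReal.ofReal_le_ofReal (le_of_eq ?_)
  have e1 : τ ^ p = κ ^ (p / N) * s ^ (-(r * p / N)) := by
    rw [hτ, ← Real.rpow_mul (by positivity), Real.div_rpow hκ0.le (by positivity),
      ← Real.rpow_mul hs.le, div_eq_mul_inv, ← Real.rpow_neg hs.le]
    congr 2 <;> ring
  rw [e1, Real.div_rpow hs.le zero_le_two, neg_add, Real.rpow_add hs, Real.rpow_neg hs.le p]
  field_simp

/-- Layer-cake integration of t^(r'-1) |{|u| ≥ t}|: on (0, 1] the L^p Chebyshev bound suffices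
because r' > p, and on (1, ∞) the decay of order p + rp/N does because r' lies below it. -/
theorem SobolevBound.improve (hN : 1 ≤ N) (hp : 1 ≤ p) {r r' : ℝ} (hr : 1 ≤ r)
    (h : SobolevBound N p r) (hpr : p ≤ r') (hr' : r' < p + r * p / N) :
    SobolevBound N p r' := by
  -- For r' = p the integrand t^(r'-1-p) is not integrable at 0, but the claim is the normalisation
  -- itself.
  rcases hpr.eq_or_lt with rfl | hlt
  · exact ⟨1, fun u g _ hup _ => by simpa using hup⟩
  obtain ⟨D, hD0, hD⟩ := h.measure_ge_le hN hp hr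
  have hp0 : 0 < p := by linarith
  have hr'0 : 0 < r' := by linarith
  have i1 : IntegrableOn (fun t : ℝ => t ^ (r' - 1 - p)) (Set.Ioc 0 1) :=
    (intervalIntegrable_iff_integrableOn_Ioc_of_le zero_le_one).1
      (intervalIntegral.intervalIntegrable_rpow' (by linarith))
  have i2 : IntegrableOn (fun t : ℝ => D * t ^ (r' - 1 - (p + r * p / N))) (Set.Ioi 1) :=
    (integrableOn_Ioi_rpow_of_lt (by linarith) one_pos).const_mul D
  refine ⟨r' * ((∫ t in Set.Ioc (0 : ℝ) 1, t ^ (r' - 1 - p)) +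
    ∫ t in Set.Ioi (1 : ℝ), D * t ^ (r' - 1 - (p + r * p / N))), fun u g hu hup hgp => ?_⟩
  have hum := hu.1.aestronglyMeasurable
  have e1 : ∫⁻ x, ‖u x‖ₑ ^ r' = ∫⁻ x, ENNReal.ofReal (|u x| ^ r') := by
    refine lintegral_congr fun x => ?_
    rw [← ofReal_norm, ENNReal.ofReal_rpow_of_nonneg (norm_nonneg _) hr'0.le, Real.norm_eq_abs]
  rw [e1, lintegral_rpow_eq_lintegral_meas_le_mul volume
    (Eventually.of_forall fun x => abs_nonneg (u x)) hum.norm.aemeasurable hr'0,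
    ENNReal.ofReal_mul hr'0.le]
  refine mul_le_mul_right ?_ _
  rw [← Set.Ioc_union_Ioi_eq_Ioi zero_le_one]
  refine (lintegral_union_le _ _ _).trans ?_
  have n1 : 0 ≤ᵐ[volume.restrict (Set.Ioc (0 : ℝ) 1)] fun t : ℝ => t ^ (r' - 1 - p) := by
    filter_upwards [ae_restrict_mem measurableSet_Ioc] with t ht
    exact Real.rpow_nonneg ht.1.le _
  have n2 : 0 ≤ᵐ[volume.restrict (Set.Ioi (1 : ℝ))]
      fun t : ℝ => D * t ^ (r' - 1 - (p + r * p / N)) := by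
    filter_upwards [ae_restrict_mem measurableSet_Ioi] with t ht
    exact mul_nonneg hD0 (Real.rpow_nonneg (zero_le_one.trans (le_of_lt ht)) _)
  rw [ENNReal.ofReal_add (integral_nonneg_of_ae n1) (integral_nonneg_of_ae n2),
    ofReal_integral_eq_lintegral_ofReal i1 n1, ofReal_integral_eq_lintegral_ofReal i2 n2]
  refine add_le_add (setLIntegral_mono' measurableSet_Ioc fun t ht => ?_)
    (setLIntegral_mono' measurableSet_Ioi fun t ht => ?_)
  · have h1 := measure_ge_le_rpow hum hp0 (A := 1) (by simpa using hup) ht.1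
    refine (mul_le_mul_left h1 _).trans ?_
    rw [← ENNReal.ofReal_mul (by have := Real.rpow_nonneg ht.1.le p; positivity)]
    refine ENNReal.ofReal_le_ofReal (le_of_eq ?_)
    rw [Real.rpow_sub ht.1 (r' - 1) p]
    ring
  · have ht0 : (0 : ℝ) < t := one_pos.trans ht
    have h1 := hD u g hu hup hgp t ht0
    refine (mul_le_mul_left h1 _).trans ?_
    rw [← ENNReal.ofReal_mul (by positivity)]
    refine ENNReal.ofReal_le_ofReal (le_of_eq ?_)
    rw [mul_assoc, ← Real.rpow_add ht0]
    congr 2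
    ring

/-- The subcritical Sobolev embedding. -/
theorem sobolevBound_of_lt (hN : 1 ≤ N) (hp : 1 < p) {q : ℝ} (hpq : p ≤ q)
    (hq : (q : EReal) < criticalExponent N p) : SobolevBound N p q := by
  by_contra hcon
  have hp0 : 0 < p := by linarith
  have hN0 : (0 : ℝ) < N := by exact_mod_cast hN
  -- If q fails, the supremum s of the admissible exponents leads to a contradiction, because one
  -- improvement step from near s passes beyond s.
  set S : Set ℝ := {r | p ≤ r ∧ r ≤ q ∧ SobolevBound N p r} with hS
  have hpS : p ∈ S := ⟨le_rfl, hpq, 1, fun u g _ hup _ => by simpa using hup⟩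
  have hbdd : BddAbove S := ⟨q, fun r hr => hr.2.1⟩
  set s := sSup S with hs
  have hsq : s ≤ q := csSup_le ⟨p, hpS⟩ fun r hr => hr.2.1
  have hps : p ≤ s := le_csSup hbdd hpS
  -- For p < N the map r ↦ p + rp/N has p* as its fixed point, and s ≤ q < p*; for p ≥ N it lies
  -- above the identity on positive r.
  have hsN : s < p + s * p / N := by
    rw [criticalExponent] at hq
    have hsub : s * p / N = s * (p / N) := by ring
    split_ifs at hq with hpN
    · have hq' : q < N * p / (N - p) := by exact_mod_cast hq
      have hd : 0 < (N : ℝ) - p := by linarith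
      have h1 : s * (N - p) < N * p := (lt_div_iff₀ hd).1 (hsq.trans_lt hq')
      rw [← sub_pos]
      have : p + s * p / N - s = (N * p - s * (N - p)) / N := by field_simp; ring
      rw [this]
      exact div_pos (by linarith) hN0
    · have h1 : 1 ≤ p / N := (one_le_div hN0).2 (not_lt.1 hpN)
      have : s * 1 ≤ s * (p / N) := mul_le_mul_of_nonneg_left h1 (by linarith)
      rw [hsub]
      linarith
  -- The left side is the r with p + rp/N = s; any admissible exponent above it improves strictly
  -- past s.
  have hε : (s - p) * N / p < s := by
    rw [div_lt_iff₀ hp0]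
    have : (s - p) * N < s * p / N * N := mul_lt_mul_of_pos_right (by linarith) hN0
    rwa [div_mul_cancel₀ _ hN0.ne'] at this
  obtain ⟨r, hrS, hr⟩ := exists_lt_of_lt_csSup ⟨p, hpS⟩ hε
  have hsr : s < p + r * p / N := by
    rw [div_lt_iff₀ hp0] at hr
    have : s - p < r * p / N := (lt_div_iff₀ hN0).2 hr
    linarith
  set m := (s + (p + r * p / N)) / 2 with hm
  have hsm : s < m := by linarith
  have h1 : SobolevBound N p (min q m) :=
    hrS.2.2.improve hN hp.le (by linarith [hrS.1]) (le_min hpq (by linarith))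
      ((min_le_right _ _).trans_lt (by linarith))
  rcases min_cases q m with h | h
  · rw [h.1] at h1
    exact hcon h1
  · rw [h.1] at h1
    have : m ≤ s := le_csSup hbdd ⟨by linarith, by linarith, h1⟩
    linarith

end Sobolev

theorem Lp.lintegral_enorm_rpow {α E : Type*} [MeasurableSpace α] {μ : Measure α}
    [NormedAddCommGroup E] {r : ℝ} (hr : 0 < r) (u : Lp E (ENNReal.ofReal r) μ) :
    ∫⁻ x, ‖u x‖ₑ ^ r ∂μ = ENNReal.ofReal (‖u‖ ^ r) := by
  rw [Lp.norm_rpow_eq_integral hr, ofReal_integral_eq_lintegral_ofReal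
    (Lp.integrable_norm_rpow hr u) (Eventually.of_forall fun x => by positivity)]
  refine lintegral_congr fun x => ?_
  rw [← ofReal_norm, ENNReal.ofReal_rpow_of_nonneg (norm_nonneg _) hr.le]

/-! ### Norm comparison and the subcritical embedding of 𝒲 -/

section WSpace

variable {N : ℕ} {p : ℝ} {b : Euc N → ℝ} {hp : 1 < p} {hb : ConditionB b}

/-- The element `b^{1/p} u` of `L^p`. -/
def WSpace.weight : WSpace hp hb →ₗ[ℝ] Lp ℝ (ENNReal.ofReal p) (volume : Measure (Euc N)) where
  toFun u := (WithLp.ofLp (WSpace.embed u)).1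
  map_add' u v := by rw [map_add]; rfl
  map_smul' c u := by rw [map_smul]; rfl

theorem WSpace.weight_ae (u : WSpace hp hb) :
    WSpace.weight u =ᵐ[volume] fun x => b x ^ (1 / p) * u x :=
  MemLp.coeFn_toLp u.memLp_weight

theorem weight_rpow {b₀ : ℝ} (hp0 : 0 < p) (hb₀ : 0 ≤ b₀) (t : ℝ) :
    ‖b₀ ^ (1 / p) * t‖ ^ p = b₀ * |t| ^ p := by
  rw [norm_mul, Real.mul_rpow (norm_nonneg _) (norm_nonneg _), Real.norm_eq_abs,
    Real.norm_eq_abs, abs_of_nonneg (Real.rpow_nonneg hb₀ _), ← Real.rpow_mul hb₀,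
    one_div_mul_cancel hp0.ne', Real.rpow_one]

theorem ConditionB.pos (hb : ConditionB b) (x : Euc N) : 0 < b x := by
  obtain ⟨b₀, hb₀, hb₁⟩ := hb.lower_bound
  exact hb₀.trans_le (hb₁ x)

theorem WSpace.norm_weight_rpow (u : WSpace hp hb) :
    ‖WSpace.weight u‖ ^ p = ∫ x, b x * |u x| ^ p := by
  have hp0 : 0 < p := by linarith
  rw [Lp.norm_rpow_eq_integral hp0]
  refine integral_congr_ae ?_
  filter_upwards [u.weight_ae] with x hx
  rw [hx, weight_rpow hp0 (hb.pos x).le]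

theorem WSpace.norm_grad_rpow (u : WSpace hp hb) :
    ‖u.grad‖ ^ p = ∫ x, ‖u.grad x‖ ^ p :=
  Lp.norm_rpow_eq_integral (by linarith) _

theorem WSpace.norm_rpow_eq_integral (u : WSpace hp hb) :
    ‖u‖ ^ p = ∫ x, (‖u.grad x‖ ^ p + b x * |u x| ^ p) := by
  have hp0 : 0 < p := by linarith
  rw [WSpace.norm_def, ← Real.rpow_mul, one_div_mul_cancel hp0.ne', Real.rpow_one]
  refine integral_nonneg fun x => ?_
  have := (hb.pos x).le
  positivity

theorem WSpace.norm_rpow (u : WSpace hp hb) :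
    ‖u‖ ^ p = ‖u.grad‖ ^ p + ‖WSpace.weight u‖ ^ p := by
  rw [WSpace.norm_rpow_eq_integral, integral_add u.integrable_grad u.integrable_weight,
    u.norm_grad_rpow, u.norm_weight_rpow]

theorem WSpace.norm_toLp_rpow (u : WSpace hp hb) :
    ‖WSpace.toLp u‖ ^ p = ∫ x, |u x| ^ p :=
  Lp.norm_rpow_eq_integral (by linarith) _

theorem WSpace.integrable_abs_rpow (u : WSpace hp hb) :
    Integrable (fun x => |u x| ^ p) volume :=
  Lp.integrable_norm_rpow (by linarith) (WSpace.toLp u)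

variable [Fact (1 ≤ ENNReal.ofReal p)]

theorem WSpace.norm_grad_le (u : WSpace hp hb) : ‖u.grad‖ ≤ ‖u‖ := by
  have hp0 : 0 < p := by linarith
  refine (Real.rpow_le_rpow_iff (norm_nonneg _) (norm_nonneg _) hp0).1 ?_
  rw [u.norm_rpow]
  linarith [Real.rpow_nonneg (norm_nonneg (WSpace.weight u)) p]

theorem WSpace.norm_weight_le (u : WSpace hp hb) : ‖WSpace.weight u‖ ≤ ‖u‖ := by
  have hp0 : 0 < p := by linarith
  refine (Real.rpow_le_rpow_iff (norm_nonneg _) (norm_nonneg _) hp0).1 ?_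
  rw [u.norm_rpow]
  linarith [Real.rpow_nonneg (norm_nonneg u.grad) p]

theorem WSpace.mul_norm_toLp_rpow_le {b₀ : ℝ} (hb₀ : ∀ x, b₀ ≤ b x) (u : WSpace hp hb) :
    b₀ * ‖WSpace.toLp u‖ ^ p ≤ ‖u‖ ^ p := by
  rw [u.norm_rpow, u.norm_weight_rpow, u.norm_toLp_rpow, ← integral_const_mul]
  have h1 : ∫ x, b₀ * |u x| ^ p ≤ ∫ x, b x * |u x| ^ p :=
    integral_mono (u.integrable_abs_rpow.const_mul _) u.integrable_weight
      fun x => mul_le_mul_of_nonneg_right (hb₀ x) (by positivity)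
  linarith [Real.rpow_nonneg (norm_nonneg u.grad) p]

theorem WSpace.exists_norm_toLp_le (hp : 1 < p) (hb : ConditionB b) :
    ∃ K : ℝ, 0 < K ∧ ∀ u : WSpace hp hb, ‖WSpace.toLp u‖ ≤ K * ‖u‖ := by
  have hp0 : 0 < p := by linarith
  obtain ⟨b₀, hb₀, hb₁⟩ := hb.lower_bound
  refine ⟨(b₀ ^ (1 / p))⁻¹, by positivity, fun u => ?_⟩
  rw [← div_eq_inv_mul, le_div_iff₀ (by positivity)]
  refine (Real.rpow_le_rpow_iff (by positivity) (norm_nonneg _) hp0).1 ?_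
  rw [Real.mul_rpow (norm_nonneg _) (by positivity), ← Real.rpow_mul hb₀.le,
    one_div_mul_cancel hp0.ne', Real.rpow_one, mul_comm]
  exact u.mul_norm_toLp_rpow_le hb₁

/-- The subcritical embedding of `𝒲`. -/
theorem WSpace.exists_norm_rpow_le (hN : 1 ≤ N) (hp : 1 < p) (hb : ConditionB b) {q : ℝ}
    (hpq : p ≤ q) (hq : (q : EReal) < criticalExponent N p) :
    ∃ K : ℝ, 0 < K ∧ ∀ u : WSpace hp hb, ∫⁻ x, ‖u x‖ₑ ^ q ≤ ENNReal.ofReal ((K * ‖u‖) ^ q) := by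
  have hp0 : 0 < p := by linarith
  have hq0 : 0 < q := by linarith
  obtain ⟨C, hC⟩ := sobolevBound_of_lt hN hp hpq hq
  obtain ⟨K, hK, hKu⟩ := WSpace.exists_norm_toLp_le hp hb
  set M := max K 1 with hM
  have hM0 : 0 < M := lt_of_lt_of_le hK (le_max_left _ _)
  set C' := max C 1 with hC'
  have hC'0 : 0 < C' := lt_of_lt_of_le one_pos (le_max_right _ _)
  refine ⟨C' ^ (1 / q) * M, by positivity, fun u => ?_⟩
  rcases eq_or_ne u 0 with rfl | hu
  · rw [map_zero]
    have : ∫⁻ x, ‖(0 : Lp ℝ (ENNReal.ofReal p) (volume : Measure (Euc N))) x‖ₑ ^ q = 0 := by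
      rw [lintegral_congr_ae (g := fun _ => 0), lintegral_zero]
      filter_upwards [Lp.coeFn_zero ℝ (ENNReal.ofReal p) (volume : Measure (Euc N))] with x hx
      rw [hx]
      simp [hq0]
    rw [this]
    exact zero_le
  have hu0 : 0 < ‖u‖ := norm_pos_iff.2 hu
  -- Scaling by c brings both u and its gradient into the unit balls where the Sobolev bound
  -- applies; M = max K 1 serves the two norms at once.
  set c := (M * ‖u‖)⁻¹ with hc
  have hc0 : 0 < c := by positivity
  have hcu : ∀ x : ℝ, x ≤ M * ‖u‖ → c * x ≤ 1 := fun x hx => by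
    rw [hc, inv_mul_le_iff₀ (by positivity), mul_one]
    exact hx
  have h1 : ∫⁻ x, ‖(c • u) x‖ₑ ^ p ≤ 1 := by
    rw [Lp.lintegral_enorm_rpow hp0, ENNReal.ofReal_le_one]
    refine Real.rpow_le_one (norm_nonneg _) ?_ hp0.le
    rw [map_smul, norm_smul, Real.norm_of_nonneg hc0.le]
    exact hcu _ ((hKu u).trans (mul_le_mul_of_nonneg_right (le_max_left _ _) hu0.le))
  have h2 : ∫⁻ x, ‖(c • u).grad x‖ₑ ^ p ≤ 1 := by
    rw [Lp.lintegral_enorm_rpow hp0, ENNReal.ofReal_le_one]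
    refine Real.rpow_le_one (norm_nonneg _) ?_ hp0.le
    rw [WSpace.grad_smul, norm_smul, Real.norm_of_nonneg hc0.le]
    refine hcu _ (u.norm_grad_le.trans ?_)
    exact le_mul_of_one_le_left hu0.le (le_max_right _ _)
  have h3 := hC _ _ (c • u).hasWeakGradient h1 h2
  have h4 : ∫⁻ x, ‖(c • u) x‖ₑ ^ q = ENNReal.ofReal (c ^ q) * ∫⁻ x, ‖u x‖ₑ ^ q := by
    rw [← lintegral_const_mul'' _ ((Lp.aestronglyMeasurable _).enorm.pow_const q)]
    refine lintegral_congr_ae ?_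
    filter_upwards [Lp.coeFn_smul c (WSpace.toLp u)] with x hx
    rw [map_smul, hx, Pi.smul_apply, smul_eq_mul, enorm_mul, ENNReal.mul_rpow_of_nonneg _ _ hq0.le,
      Real.enorm_of_nonneg hc0.le, ENNReal.ofReal_rpow_of_nonneg hc0.le hq0.le]
  rw [h4] at h3
  have h5 : ∫⁻ x, ‖u x‖ₑ ^ q =
      ENNReal.ofReal ((c ^ q)⁻¹) * (ENNReal.ofReal (c ^ q) * ∫⁻ x, ‖u x‖ₑ ^ q) := by
    rw [← mul_assoc, ← ENNReal.ofReal_mul (by positivity), inv_mul_cancel₀ (by positivity),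
      ENNReal.ofReal_one, one_mul]
  rw [h5]
  refine (mul_le_mul_right (h3.trans (ENNReal.ofReal_le_ofReal (le_max_left C 1))) _).trans ?_
  rw [← ENNReal.ofReal_mul (by positivity)]
  refine ENNReal.ofReal_le_ofReal (le_of_eq ?_)
  rw [hc, Real.inv_rpow (by positivity), inv_inv, mul_assoc,
    Real.mul_rpow (x := C' ^ (1 / q)) (by positivity) (by positivity), ← Real.rpow_mul hC'0.le, one_div_mul_cancel hq0.ne', Real.rpow_one, mul_comm]

/-- The embedding of `𝒲` into `L^q` for subcritical `q`, as a continuous linear map. -/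
theorem WSpace.exists_embedding (hN : 1 ≤ N) (hp : 1 < p) (hb : ConditionB b) {q : ℝ}
    (hpq : p ≤ q) (hq : (q : EReal) < criticalExponent N p) [Fact (1 ≤ ENNReal.ofReal q)] :
    ∃ T : WSpace hp hb →L[ℝ] Lp ℝ (ENNReal.ofReal q) (volume : Measure (Euc N)),
      ∀ u : WSpace hp hb, T u =ᵐ[volume] u := by
  have hq0 : 0 < q := by linarith
  obtain ⟨K, hK, hKu⟩ := WSpace.exists_norm_rpow_le hN hp hb hpq hq
  have hmem : ∀ u : WSpace hp hb, MemLp u (ENNReal.ofReal q) volume := fun u => by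
    refine ⟨Lp.aestronglyMeasurable _, ?_⟩
    rw [eLpNorm_lt_top_iff_lintegral_rpow_enorm_lt_top (ofReal_ne_zero_of_pos hq0)
      ENNReal.ofReal_ne_top, ENNReal.toReal_ofReal hq0.le]
    exact (hKu u).trans_lt ENNReal.ofReal_lt_top
  let T₀ : WSpace hp hb →ₗ[ℝ] Lp ℝ (ENNReal.ofReal q) (volume : Measure (Euc N)) :=
    { toFun := fun u => (hmem u).toLp
      map_add' := fun u v => by
        rw [← MemLp.toLp_add]
        refine MemLp.toLp_congr _ _ ?_
        rw [map_add]
        exact Lp.coeFn_add _ _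
      map_smul' := fun c u => by
        rw [RingHom.id_apply, ← MemLp.toLp_const_smul]
        refine MemLp.toLp_congr _ _ ?_
        rw [map_smul]
        exact Lp.coeFn_smul _ _ }
  refine ⟨T₀.mkContinuous K fun u => ?_, fun u => (hmem u).coeFn_toLp⟩
  have h1 : ENNReal.ofReal (‖T₀ u‖ ^ q) ≤ ENNReal.ofReal ((K * ‖u‖) ^ q) := by
    rw [← Lp.lintegral_enorm_rpow hq0]
    refine le_trans (le_of_eq (lintegral_congr_ae ?_)) (hKu u)
    filter_upwards [(hmem u).coeFn_toLp] with x hx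
    rw [← hx]
    rfl
  rw [ENNReal.ofReal_le_ofReal_iff (by positivity)] at h1
  exact (Real.rpow_le_rpow_iff (norm_nonneg _) (by positivity) hq0).1 h1

end WSpace

/-! ### Compactness of the embedding into L^p and interpolation -/

/-- A bounded sequence in `L^p` has a subsequence whose integrals over all sets of finite measure
converge. -/
theorem exists_subseq_tendsto_setIntegral {N : ℕ} {p : ℝ} (hp : 1 < p)
    [Fact (1 ≤ ENNReal.ofReal p)]
    (w : ℕ → Lp ℝ (ENNReal.ofReal p) (volume : Measure (Euc N))) {B : ℝ} (hB : ∀ k, ‖w k‖ ≤ B) :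
    ∃ σ : ℕ → ℕ, StrictMono σ ∧ ∀ s : Set (Euc N), MeasurableSet s → volume s ≠ ⊤ →
      ∃ l : ℝ, Tendsto (fun k => ∫ x in s, w (σ k) x) atTop (𝓝 l) := by
  have hconj : p.HolderConjugate p.conjExponent := Real.HolderConjugate.conjExponent hp
  set q := p.conjExponent with hq
  have : Fact (1 ≤ ENNReal.ofReal q) := fact_one_le hconj.symm.lt
  have : Fact (ENNReal.ofReal q ≠ ⊤) := ⟨ENNReal.ofReal_ne_top⟩
  have : ENNReal.HolderConjugate (ENNReal.ofReal p) (ENNReal.ofReal q) :=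
    ⟨by simpa using hconj.inv_add_inv_ennreal⟩
  let P := (ContinuousLinearMap.mul ℝ ℝ).lpPairing (volume : Measure (Euc N))
    (ENNReal.ofReal p) (ENNReal.ofReal q)
  have hPB : ∀ k, ‖P (w k)‖ ≤ ‖P‖ * B := fun k =>
    (P.le_opNorm _).trans (mul_le_mul_of_nonneg_left (hB k) (norm_nonneg _))
  -- Sequential Banach–Alaoglu in the dual of L^q for the conjugate exponent q < ∞; evaluating the
  -- weak-* limit at indicator functions gives the set integrals.
  obtain ⟨l, -, σ, hσ, hl⟩ := WeakDual.isSeqCompact_closedBall ℝ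
    (Lp ℝ (ENNReal.ofReal q) (volume : Measure (Euc N))) 0 (‖P‖ * B)
    (x := fun k => StrongDual.toWeakDual (P (w k))) (fun k => by
      simpa using hPB k)
  refine ⟨σ, hσ, fun s hs hμs => ⟨l (indicatorConstLp _ hs hμs 1), ?_⟩⟩
  have h1 := ((WeakDual.eval_continuous (𝕜 := ℝ)
    (indicatorConstLp (ENNReal.ofReal q) hs hμs (1 : ℝ))).tendsto l).comp hl
  refine h1.congr fun k => ?_
  change P (w (σ k)) _ = _
  rw [ContinuousLinearMap.lpPairing_eq_integral, ← integral_indicator hs]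
  refine integral_congr_ae ?_
  filter_upwards [indicatorConstLp_coeFn (p := ENNReal.ofReal q) (hs := hs) (hμs := hμs)
    (c := (1 : ℝ))] with x hx
  rw [hx]
  by_cases hxs : x ∈ s <;> simp [hxs]

/-- An average is a multiple of an integral over a set of finite measure, so convergence of set
integrals becomes convergence of the averages at every point. -/
theorem ballAvg_eq_setIntegral {N : ℕ} (u : Euc N → ℝ) (τ : ℝ) (x : Euc N) :
    ballAvg τ u x = (volume (Metric.ball (0 : Euc N) τ))⁻¹.toReal * ∫ y in Metric.ball x τ, u y := by
  rw [ballAvg, ballProb, integral_smul_measure, smul_eq_mul]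
  congr 1
  have h := (measurePreserving_add_left (volume : Measure (Euc N)) x).setIntegral_preimage_emb
    (MeasurableEquiv.addLeft x).measurableEmbedding u (Metric.ball x τ)
  rw [← h]
  congr 2
  ext y
  simp

section WSpace

variable {N : ℕ} {p : ℝ} {b : Euc N → ℝ} {hp : 1 < p} {hb : ConditionB b}

/-- The truncation to `s` of the ball averages of `u`. -/
theorem memLp_indicator_ballAvg [Fact (1 ≤ ENNReal.ofReal p)] {s : Set (Euc N)}
    (hs : MeasurableSet s) (hμs : volume s < ⊤) {τ : ℝ} (hτ : 0 < τ)
    {u : Euc N → ℝ} (hu : AEStronglyMeasurable u volume) {A : ℝ}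
    (hA : ∀ x, |ballAvg τ u x| ≤ A) :
    MemLp (s.indicator (ballAvg τ u)) (ENNReal.ofReal p) volume := by
  have : IsFiniteMeasure (volume.restrict s) := ⟨by simpa using hμs⟩
  rw [memLp_indicator_iff_restrict hs]
  exact MemLp.of_bound (aestronglyMeasurable_ballAvg hu hτ).restrict A
    (Eventually.of_forall hA)

/-- The bound is uniform in x and over L^p-bounded families; on a set of finite measure it supplies
the majorant for dominated convergence. -/
theorem abs_ballAvg_le (hp : 1 ≤ p) {τ : ℝ} (hτ : 0 < τ) :
    ∃ V : ℝ, 0 < V ∧ ∀ (u : Lp ℝ (ENNReal.ofReal p) (volume : Measure (Euc N))) x,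
      |ballAvg τ u x| ^ p ≤ V * ‖u‖ ^ p := by
  have hp0 : 0 < p := by linarith
  have h0 : 0 < volume (Metric.ball (0 : Euc N) τ) := Metric.measure_ball_pos _ _ hτ
  have h1 : volume (Metric.ball (0 : Euc N) τ) ≠ ⊤ := measure_ball_lt_top.ne
  refine ⟨(volume (Metric.ball (0 : Euc N) τ))⁻¹.toReal,
    ENNReal.toReal_pos (ENNReal.inv_ne_zero.2 h1) (ENNReal.inv_ne_top.2 h0.ne'), fun u x => ?_⟩
  have h2 := enorm_ballAvg_rpow_le (Lp.aestronglyMeasurable u) hp hτ x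
  rw [Lp.lintegral_enorm_rpow hp0, ← ENNReal.ofReal_toReal (ENNReal.inv_ne_top.2 h0.ne'),
    ← ENNReal.ofReal_mul ENNReal.toReal_nonneg, ← ofReal_norm,
    ENNReal.ofReal_rpow_of_nonneg (norm_nonneg _) hp0.le, ENNReal.ofReal_le_ofReal_iff] at h2
  · exact h2
  · exact mul_nonneg ENNReal.toReal_nonneg (Real.rpow_nonneg ENNReal.toReal_nonneg _)

/-- The embedding of `𝒲` into `L^p` is compact. -/
theorem WSpace.exists_subseq_cauchySeq [Fact (1 ≤ ENNReal.ofReal p)] (u : ℕ → WSpace hp hb)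
    {B : ℝ} (hB : ∀ k, ‖u k‖ ≤ B) :
    ∃ σ : ℕ → ℕ, StrictMono σ ∧ CauchySeq fun k => WSpace.toLp (u (σ k)) := by
  have hp0 : 0 < p := by linarith
  have hB0 : 0 ≤ B := (norm_nonneg _).trans (hB 0)
  obtain ⟨K, hK, hKu⟩ := WSpace.exists_norm_toLp_le hp hb
  have hKB : ∀ k, ‖WSpace.toLp (u k)‖ ≤ K * B := fun k =>
    (hKu _).trans (mul_le_mul_of_nonneg_left (hB k) hK.le)
  obtain ⟨σ, hσ, hlim⟩ := exists_subseq_tendsto_setIntegral hp (fun k => WSpace.toLp (u k)) hKB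
  refine ⟨σ, hσ, Metric.cauchySeq_iff'.2 fun ε hε => ?_⟩
  -- choose the averaging radius and the truncation level
  set δ := (ε / 5) ^ p / (2 * (B ^ p + 1)) with hδ
  have hBp : 0 ≤ B ^ p := Real.rpow_nonneg hB0 p
  have hδ0 : 0 < δ := by positivity
  set τ := δ ^ (1 / p) with hτdef
  have hτ : 0 < τ := by positivity
  have hτp : τ ^ p = δ := by
    rw [hτdef, ← Real.rpow_mul hδ0.le, one_div_mul_cancel hp0.ne', Real.rpow_one]
  set s : Set (Euc N) := {x | b x ≤ 1 / δ} with hs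
  have hsm : MeasurableSet s := (isClosed_le hb.continuous continuous_const).measurableSet
  have hsμ : volume s < ⊤ := hb.finite_sublevel _ (by positivity)
  obtain ⟨V, hV, hVu⟩ := abs_ballAvg_le (N := N) hp.le hτ
  set A := (V * (K * B) ^ p) ^ (1 / p) with hA
  have hA0 : 0 ≤ A := by positivity
  have hAk : ∀ k x, |ballAvg τ (u k) x| ≤ A := fun k x => by
    refine (Real.rpow_le_rpow_iff (abs_nonneg _) hA0 hp0).1 ?_
    rw [hA, ← Real.rpow_mul (by positivity), one_div_mul_cancel hp0.ne', Real.rpow_one]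
    refine (hVu _ x).trans (mul_le_mul_of_nonneg_left ?_ hV.le)
    exact Real.rpow_le_rpow (norm_nonneg _) (hKB k) hp0.le
  have hum : ∀ k, AEStronglyMeasurable (u k) volume := fun k => Lp.aestronglyMeasurable _
  have hmem : ∀ k, MemLp (s.indicator (ballAvg τ (u k))) (ENNReal.ofReal p) volume :=
    fun k => memLp_indicator_ballAvg hsm hsμ hτ (hum k) (hAk k)
  set v : ℕ → Lp ℝ (ENNReal.ofReal p) (volume : Measure (Euc N)) := fun k => (hmem k).toLp with hv
  -- On s the error is u - average, controlled by τ^p‖∇u‖^p = δ‖∇u‖^p. Off s the truncation is zero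
  -- and b > 1/δ gives |u|^p ≤ δ b|u|^p.
  have hclose : ∀ k, dist (WSpace.toLp (u k)) (v k) ≤ ε / 5 := fun k => by
    rw [dist_eq_norm]
    refine (Real.rpow_le_rpow_iff (norm_nonneg _) (by positivity) hp0).1 ?_
    rw [← ENNReal.ofReal_le_ofReal_iff (by positivity), ← Lp.lintegral_enorm_rpow hp0]
    have hpt : ∀ᵐ x, ‖(WSpace.toLp (u k) - v k) x‖ₑ ^ p ≤
        ‖u k x - ballAvg τ (u k) x‖ₑ ^ p + ENNReal.ofReal (δ * (b x * |u k x| ^ p)) := by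
      filter_upwards [Lp.coeFn_sub (WSpace.toLp (u k)) (v k), (hmem k).coeFn_toLp] with x h1 h2
      rw [h1, Pi.sub_apply, h2]
      by_cases hxs : x ∈ s
      · rw [Set.indicator_of_mem hxs]
        exact le_self_add
      · rw [Set.indicator_of_notMem hxs, sub_zero]
        refine le_trans ?_ le_add_self
        rw [← ofReal_norm, ENNReal.ofReal_rpow_of_nonneg (norm_nonneg _) hp0.le]
        refine ENNReal.ofReal_le_ofReal ?_
        rw [Real.norm_eq_abs, ← mul_assoc]
        refine le_mul_of_one_le_left (by positivity) ?_
        have : 1 / δ < b x := not_le.1 hxs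
        rw [div_lt_iff₀ hδ0] at this
        linarith
    have hi : ∫ x, δ * (b x * |u k x| ^ p) ≤ δ * B ^ p := by
      rw [integral_const_mul]
      refine mul_le_mul_of_nonneg_left ?_ hδ0.le
      rw [← WSpace.norm_weight_rpow]
      exact Real.rpow_le_rpow (norm_nonneg _) ((u k).norm_weight_le.trans (hB k)) hp0.le
    refine (lintegral_mono_ae hpt).trans ?_
    have hm : AEMeasurable (fun x => ‖u k x - ballAvg τ (u k) x‖ₑ ^ p) volume :=
      ((hum k).sub (aestronglyMeasurable_ballAvg (hum k) hτ)).enorm.pow_const p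
    rw [lintegral_add_left' hm, ← ofReal_integral_eq_lintegral_ofReal ((u k).integrable_weight.const_mul δ)
      (Eventually.of_forall fun x => by have := (hb.pos x).le; positivity)]
    have h3 := (u k).hasWeakGradient.lintegral_sub_ballAvg_le hp.le hτ
    rw [Lp.lintegral_enorm_rpow hp0, ENNReal.ofReal_rpow_of_nonneg hτ.le hp0.le, hτp,
      ← ENNReal.ofReal_mul hδ0.le] at h3
    have h4 : ‖(u k).grad‖ ^ p ≤ B ^ p :=
      Real.rpow_le_rpow (norm_nonneg _) ((u k).norm_grad_le.trans (hB k)) hp0.le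
    refine (add_le_add h3 (ENNReal.ofReal_le_ofReal hi)).trans ?_
    rw [← ENNReal.ofReal_add (by positivity) (by positivity)]
    refine ENNReal.ofReal_le_ofReal ?_
    have h5 : δ * (2 * (B ^ p + 1)) = (ε / 5) ^ p := by
      rw [hδ, div_mul_cancel₀ _ (by positivity)]
    have h6 : δ * ‖(u k).grad‖ ^ p ≤ δ * B ^ p := mul_le_mul_of_nonneg_left h4 hδ0.le
    linarith
  -- The averages converge at every point along σ, which was chosen independently of ε, and are
  -- bounded by A on the finite-measure set s.
  have hcauchy : ∃ w, Tendsto (fun k => v (σ k)) atTop (𝓝 w) := by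
    have hpt : ∀ x, ∃ l : ℝ, Tendsto (fun k => ballAvg τ (u (σ k)) x) atTop (𝓝 l) := fun x => by
      obtain ⟨l, hl⟩ := hlim (Metric.ball x τ) Metric.isOpen_ball.measurableSet
        measure_ball_lt_top.ne
      exact ⟨_, (hl.const_mul _).congr fun k => (ballAvg_eq_setIntegral _ _ _).symm⟩
    choose a ha using hpt
    have ham : AEStronglyMeasurable a volume :=
      aestronglyMeasurable_of_tendsto_ae atTop
        (fun k => aestronglyMeasurable_ballAvg (hum (σ k)) hτ) (Eventually.of_forall ha)
    have haA : ∀ x, |a x| ≤ A := fun x =>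
      le_of_tendsto (ha x).abs (Eventually.of_forall fun k => hAk _ x)
    have : IsFiniteMeasure (volume.restrict s) := ⟨by simpa using hsμ⟩
    have hamem : MemLp (s.indicator a) (ENNReal.ofReal p) volume := by
      rw [memLp_indicator_iff_restrict hsm]
      exact MemLp.of_bound ham.restrict A (Eventually.of_forall haA)
    set a' : Lp ℝ (ENNReal.ofReal p) (volume : Measure (Euc N)) := hamem.toLp with ha'
    refine ⟨a', ?_⟩
    rw [tendsto_iff_norm_sub_tendsto_zero]
    have h1 : Tendsto (fun k => ∫ x, ‖v (σ k) x - a' x‖ ^ p) atTop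
        (𝓝 (∫ _ : Euc N, (0 : ℝ))) := by
      refine tendsto_integral_of_dominated_convergence (s.indicator fun _ => (2 * A) ^ p)
        (fun k => (Lp.integrable_norm_sub_rpow hp0 _ _).aestronglyMeasurable)
        ((integrable_indicator_iff hsm).2 (integrableOn_const hsμ.ne)) (fun k => ?_) ?_
      · filter_upwards [(hmem (σ k)).coeFn_toLp, hamem.coeFn_toLp] with x h1 h2
        rw [h1, h2, Real.norm_of_nonneg (by positivity)]
        by_cases hxs : x ∈ s
        · simp only [Set.indicator_of_mem hxs]
          refine Real.rpow_le_rpow (norm_nonneg _) ?_ hp0.le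
          refine (norm_sub_le _ _).trans ?_
          rw [Real.norm_eq_abs, Real.norm_eq_abs]
          linarith [hAk (σ k) x, haA x]
        · simp [Set.indicator_of_notMem hxs, Real.zero_rpow hp0.ne']
      · filter_upwards [ae_all_iff.2 fun k => (hmem (σ k)).coeFn_toLp, hamem.coeFn_toLp]
          with x h1 h2
        simp only [hv, ha', h1, h2]
        by_cases hxs : x ∈ s
        · simp only [Set.indicator_of_mem hxs]
          have := (tendsto_iff_norm_sub_tendsto_zero.1 (ha x)).rpow_const (p := p)
            (Or.inr hp0.le)
          rwa [Real.zero_rpow hp0.ne'] at this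
        · simp [Set.indicator_of_notMem hxs, Real.zero_rpow hp0.ne']
    rw [integral_zero] at h1
    have h2 := h1.rpow_const (p := 1 / p) (Or.inr (by positivity))
    rw [Real.zero_rpow (by positivity)] at h2
    refine h2.congr fun k => ?_
    rw [← Lp.norm_sub_rpow_eq_integral hp0, ← Real.rpow_mul (norm_nonneg _),
      mul_one_div_cancel hp0.ne', Real.rpow_one]
  obtain ⟨w, hw⟩ := hcauchy
  obtain ⟨n, hn⟩ := Metric.cauchySeq_iff'.1 hw.cauchySeq (ε / 5) (by positivity)
  refine ⟨n, fun k hk => ?_⟩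
  have h1 := hclose (σ k)
  have h2 := hclose (σ n)
  have h3 := hn k hk
  have h4 := dist_triangle4 (WSpace.toLp (u (σ k))) (v (σ k)) (v (σ n)) (WSpace.toLp (u (σ n)))
  rw [dist_comm (v (σ n))] at h4
  linarith

/-- On bounded sets the `L^q` norm is controlled by the `L^p` norm. -/
theorem WSpace.tendsto_embedding_zero (hN : 1 ≤ N) {q : ℝ} (hpq : p < q)
    (hq : (q : EReal) < criticalExponent N p) [Fact (1 ≤ ENNReal.ofReal q)]
    {T : WSpace hp hb →L[ℝ] Lp ℝ (ENNReal.ofReal q) (volume : Measure (Euc N))}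
    (hT : ∀ u : WSpace hp hb, T u =ᵐ[volume] u) [Fact (1 ≤ ENNReal.ofReal p)] {ι : Type*}
    {l : Filter ι} {w : ι → WSpace hp hb} {B : ℝ} (hB : ∀ i, ‖w i‖ ≤ B)
    (hw : Tendsto (fun i => ‖WSpace.toLp (w i)‖) l (𝓝 0)) :
    Tendsto (fun i => ‖T (w i)‖) l (𝓝 0) := by
  have hp0 : 0 < p := by linarith
  have hq0 : 0 < q := by linarith
  -- Room above q: the L^r norm with q < r < p* is bounded on bounded sets and controls the large
  -- values.
  obtain ⟨r, hqr, hr⟩ := EReal.lt_iff_exists_real_btwn.1 hq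
  have hqr' : q < r := by exact_mod_cast hqr
  obtain ⟨K, hK, hKu⟩ := WSpace.exists_norm_rpow_le hN hp hb (by linarith) hr
  have hr0 : 0 < r := by linarith
  -- Splitting at height R: values above R are charged to the r-th power, values below it to the
  -- p-th power.
  have hpt : ∀ R t : ℝ, 0 < R → |t| ^ q ≤ R ^ (q - r) * |t| ^ r + R ^ (q - p) * |t| ^ p :=
    fun R t hR => by
      rcases eq_or_ne t 0 with rfl | ht
      · rw [abs_zero, Real.zero_rpow hq0.ne']
        positivity
      have ht0 : 0 < |t| := abs_pos.2 ht
      rcases le_total R |t| with h | h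
      · have e : |t| ^ q = |t| ^ (q - r) * |t| ^ r := by
          rw [← Real.rpow_add ht0, sub_add_cancel]
        have : |t| ^ (q - r) ≤ R ^ (q - r) :=
          Real.rpow_le_rpow_of_nonpos hR h (by linarith)
        rw [e]
        have := mul_le_mul_of_nonneg_right this (Real.rpow_nonneg ht0.le r)
        have h0 : 0 ≤ R ^ (q - p) * |t| ^ p := by positivity
        linarith
      · have e : |t| ^ q = |t| ^ (q - p) * |t| ^ p := by
          rw [← Real.rpow_add ht0, sub_add_cancel]
        have : |t| ^ (q - p) ≤ R ^ (q - p) :=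
          Real.rpow_le_rpow ht0.le h (by linarith)
        rw [e]
        have := mul_le_mul_of_nonneg_right this (Real.rpow_nonneg ht0.le p)
        have h0 : 0 ≤ R ^ (q - r) * |t| ^ r := by positivity
        linarith
  have hB' : ∀ i, 0 ≤ B := fun i => (norm_nonneg _).trans (hB i)
  have hbound : ∀ R : ℝ, 0 < R → ∀ i, ‖T (w i)‖ ^ q ≤
      R ^ (q - r) * (K * |B|) ^ r + R ^ (q - p) * ‖WSpace.toLp (w i)‖ ^ p := fun R hR i => by
    rw [← ENNReal.ofReal_le_ofReal_iff (by positivity), ← Lp.lintegral_enorm_rpow hq0,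
      ENNReal.ofReal_add (by positivity) (by positivity), ENNReal.ofReal_mul (by positivity),
      ENNReal.ofReal_mul (by positivity), ← Lp.lintegral_enorm_rpow hp0]
    have hm := (Lp.aestronglyMeasurable (WSpace.toLp (w i))).enorm
    have h1 : ∫⁻ x, ‖w i x‖ₑ ^ r ≤ ENNReal.ofReal ((K * |B|) ^ r) := by
      refine (hKu (w i)).trans (ENNReal.ofReal_le_ofReal ?_)
      refine Real.rpow_le_rpow (by positivity) ?_ hr0.le
      exact mul_le_mul_of_nonneg_left ((hB i).trans (le_abs_self B)) hK.le
    refine le_trans ?_ (add_le_add (mul_le_mul_right h1 _) le_rfl)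
    rw [← lintegral_const_mul'' _ (hm.pow_const r), ← lintegral_const_mul'' _ (hm.pow_const p),
      ← lintegral_add_left' ((hm.pow_const r).const_mul _)]
    refine lintegral_mono_ae ?_
    filter_upwards [hT (w i)] with x hx
    rw [hx, ← ofReal_norm, ENNReal.ofReal_rpow_of_nonneg (norm_nonneg _) hq0.le,
      ENNReal.ofReal_rpow_of_nonneg (norm_nonneg _) hr0.le,
      ENNReal.ofReal_rpow_of_nonneg (norm_nonneg _) hp0.le, ← ENNReal.ofReal_mul (by positivity),
      ← ENNReal.ofReal_mul (by positivity), ← ENNReal.ofReal_add (by positivity) (by positivity)]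
    exact ENNReal.ofReal_le_ofReal (hpt R _ hR)
  have hq' : Tendsto (fun i => ‖T (w i)‖ ^ q) l (𝓝 0) := by
    rw [Metric.tendsto_nhds]
    intro ε hε
    -- First R is taken large, making the L^r term small uniformly in i; for that fixed R the L^p
    -- term then tends to zero.
    have hR : Tendsto (fun R : ℝ => R ^ (q - r) * (K * |B|) ^ r) atTop (𝓝 0) := by
      have := (tendsto_rpow_neg_atTop (y := r - q) (by linarith)).mul_const ((K * |B|) ^ r)
      simpa using this
    obtain ⟨R, hRε, hR0⟩ := ((hR.eventually (gt_mem_nhds (half_pos hε))).and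
      (eventually_gt_atTop 0)).exists
    have h2 : Tendsto (fun i => R ^ (q - p) * ‖WSpace.toLp (w i)‖ ^ p) l (𝓝 0) := by
      have := (hw.rpow_const (p := p) (Or.inr hp0.le)).const_mul (R ^ (q - p))
      rwa [Real.zero_rpow hp0.ne', mul_zero] at this
    filter_upwards [h2.eventually (gt_mem_nhds (half_pos hε))] with i hi
    rw [dist_zero_right, Real.norm_of_nonneg (by positivity)]
    linarith [hbound R hR0 i]
  have h3 := hq'.rpow_const (p := 1 / q) (Or.inr (by positivity))
  rw [Real.zero_rpow (by positivity)] at h3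
  refine h3.congr fun i => ?_
  rw [← Real.rpow_mul (norm_nonneg _), mul_one_div_cancel hq0.ne', Real.rpow_one]

end WSpace

/-! ### Closedness of the weak gradient and completeness of 𝒲 -/

theorem tendsto_integral_bilin {α E F G ι : Type*} [MeasurableSpace α] {μ : Measure α}
    [NormedAddCommGroup E] [NormedAddCommGroup F] [NormedAddCommGroup G] [NormedSpace ℝ E]
    [NormedSpace ℝ F] [NormedSpace ℝ G] [CompleteSpace G] (L : E →L[ℝ] F →L[ℝ] G) {p q : ℝ≥0∞}
    [Fact (1 ≤ p)] [Fact (1 ≤ q)] [ENNReal.HolderConjugate p q] {ψ : α → F} (hψ : MemLp ψ q μ)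
    {l : Filter ι} {w : ι → Lp E p μ} {w₀ : Lp E p μ} (hw : Tendsto w l (𝓝 w₀)) :
    Tendsto (fun i => ∫ x, L (w i x) (ψ x) ∂μ) l (𝓝 (∫ x, L (w₀ x) (ψ x) ∂μ)) := by
  have key : ∀ v : Lp E p μ, ∫ x, L (v x) (ψ x) ∂μ = L.lpPairing μ p q v hψ.toLp := fun v => by
    rw [ContinuousLinearMap.lpPairing_eq_integral]
    refine integral_congr_ae ?_
    filter_upwards [hψ.coeFn_toLp] with x hx
    rw [hx]
  simp only [key]
  have hc : Continuous fun v : Lp E p μ => L.lpPairing μ p q v hψ.toLp := by fun_prop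
  exact (hc.tendsto w₀).comp hw

section WSpace

variable {N : ℕ} {p : ℝ} {b : Euc N → ℝ} {hp : 1 < p} {hb : ConditionB b}

theorem WSpace.norm_sub_rpow (u v : WSpace hp hb) :
    ‖u - v‖ ^ p = ‖u.grad - v.grad‖ ^ p + ‖WSpace.weight u - WSpace.weight v‖ ^ p := by
  rw [WSpace.norm_rpow, map_sub]
  congr 3
  rw [sub_eq_add_neg, sub_eq_add_neg, WSpace.grad_add, ← neg_one_smul ℝ v, WSpace.grad_smul,
    neg_one_smul]

variable [Fact (1 ≤ ENNReal.ofReal p)]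

/-- Test functions and their gradients lie in the dual exponent's space, so both sides of the
integration-by-parts identity pass to L^p limits. -/
theorem HasWeakGradient.of_tendsto (hp : 1 < p)
    {u : ℕ → Lp ℝ (ENNReal.ofReal p) (volume : Measure (Euc N))}
    {g : ℕ → Lp (Euc N) (ENNReal.ofReal p) (volume : Measure (Euc N))}
    (h : ∀ k, HasWeakGradient (u k) (g k))
    {u₀ : Lp ℝ (ENNReal.ofReal p) (volume : Measure (Euc N))}
    {g₀ : Lp (Euc N) (ENNReal.ofReal p) (volume : Measure (Euc N))}
    (hu : Tendsto u atTop (𝓝 u₀)) (hg : Tendsto g atTop (𝓝 g₀)) : HasWeakGradient u₀ g₀ where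
  locallyIntegrable := (Lp.memLp u₀).locallyIntegrable Fact.out
  locallyIntegrable_grad := (Lp.memLp g₀).locallyIntegrable Fact.out
  integral_eq φ hφ hc := by
    have hconj : p.HolderConjugate p.conjExponent := Real.HolderConjugate.conjExponent hp
    have : Fact (1 ≤ ENNReal.ofReal p.conjExponent) := fact_one_le hconj.symm.lt
    have : ENNReal.HolderConjugate (ENNReal.ofReal p) (ENNReal.ofReal p.conjExponent) :=
      ⟨by simpa using hconj.inv_add_inv_ennreal⟩
    have h1 := tendsto_integral_bilin (ContinuousLinearMap.lsmul ℝ ℝ (E := Euc N))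
      (q := ENNReal.ofReal p.conjExponent)
      ((continuous_gradient hφ).memLp_of_hasCompactSupport (μ := (volume : Measure (Euc N)))
        (hasCompactSupport_gradient hc)) hu
    have h2 := tendsto_integral_bilin (ContinuousLinearMap.lsmul ℝ ℝ (E := Euc N)).flip
      (q := ENNReal.ofReal p.conjExponent)
      (hφ.continuous.memLp_of_hasCompactSupport (μ := (volume : Measure (Euc N))) hc) hg
    refine tendsto_nhds_unique h1 (h2.neg.congr fun k => ?_)
    exact ((h k).3 φ hφ hc).symm

theorem tendsto_of_norm_sub_rpow {X : Type*} [NormedAddCommGroup X] {r : ℝ} (hr : 0 < r)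
    {ι : Type*} {l : Filter ι} {u : ι → X} {u₀ : X}
    (h : Tendsto (fun i => ‖u i - u₀‖ ^ r) l (𝓝 0)) : Tendsto u l (𝓝 u₀) := by
  rw [tendsto_iff_norm_sub_tendsto_zero]
  have h3 := h.rpow_const (p := 1 / r) (Or.inr (by positivity))
  rw [Real.zero_rpow (by positivity)] at h3
  refine h3.congr fun i => ?_
  rw [← Real.rpow_mul (norm_nonneg _), mul_one_div_cancel hr.ne', Real.rpow_one]

/-- The classes of u, b^{1/p}u and ∇u form Cauchy sequences in their L^p spaces; it remains to see
that the three limits belong to one element of 𝒲. -/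
theorem WSpace.completeSpace : CompleteSpace (WSpace hp hb) := by
  have hp0 : 0 < p := by linarith
  refine Metric.complete_of_cauchySeq_tendsto fun u hu => ?_
  obtain ⟨K, hK, hKu⟩ := WSpace.exists_norm_toLp_le hp hb
  have hle : ∀ {X : Type _} [NormedAddCommGroup X] (T : WSpace hp hb → X) (C : ℝ), 0 ≤ C →
      (∀ u v, ‖T u - T v‖ ≤ C * ‖u - v‖) → CauchySeq fun k => T (u k) := fun T C hC hT => by
    have : LipschitzWith C.toNNReal T := LipschitzWith.of_dist_le_mul fun u v => by
      rw [dist_eq_norm, dist_eq_norm, Real.coe_toNNReal _ hC]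
      exact hT u v
    exact this.uniformContinuous.comp_cauchySeq hu
  obtain ⟨w, hw⟩ := cauchySeq_tendsto_of_complete
    (hle (fun u => WSpace.toLp u) K hK.le fun u v => by rw [← map_sub]; exact hKu _)
  obtain ⟨z, hz⟩ := cauchySeq_tendsto_of_complete
    (hle (fun u => WSpace.weight u) 1 zero_le_one fun u v => by
      rw [← map_sub, one_mul]; exact WSpace.norm_weight_le _)
  obtain ⟨g, hg⟩ := cauchySeq_tendsto_of_complete
    (hle (fun u => u.grad) 1 zero_le_one fun u v => by
      rw [one_mul]
      refine (Real.rpow_le_rpow_iff (norm_nonneg _) (norm_nonneg _) hp0).1 ?_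
      rw [WSpace.norm_sub_rpow]
      linarith [Real.rpow_nonneg (norm_nonneg (WSpace.weight u - WSpace.weight v)) p])
  have hwg : HasWeakGradient w g :=
    HasWeakGradient.of_tendsto hp (fun k => (u k).hasWeakGradient) hw hg
  -- Multiplication by b^{1/p} is unbounded in general, so the limits are matched pointwise along a
  -- common a.e. convergent subsequence.
  have hzw : z =ᵐ[volume] fun x => b x ^ (1 / p) * w x := by
    obtain ⟨ns, hns, hae⟩ := (tendstoInMeasure_of_tendsto_Lp hw).exists_seq_tendsto_ae
    obtain ⟨ms, hms, hae'⟩ := (tendstoInMeasure_of_tendsto_Lp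
      (hz.comp hns.tendsto_atTop)).exists_seq_tendsto_ae
    filter_upwards [hae, hae', ae_all_iff.2 fun k => (u k).weight_ae] with x h1 h2 h3
    refine tendsto_nhds_unique h2 ?_
    refine ((h1.comp hms.tendsto_atTop).const_mul (b x ^ (1 / p))).congr fun k => ?_
    simp only [Function.comp_apply, h3]
  have hmem : Integrable (fun x => b x * |w x| ^ p) volume := by
    rw [integrable_weight_iff hp hb (Lp.aestronglyMeasurable _)]
    exact (Lp.memLp z).ae_eq hzw
  let U : WSpace hp hb := (⟨w, ⟨g, hwg⟩, hmem⟩ : ↥(weightedSubspace hp hb))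
  have hUg : U.grad = g := WSpace.grad_eq hwg
  have hUz : WSpace.weight U = z := Lp.ext (U.weight_ae.trans hzw.symm)
  refine ⟨U, tendsto_of_norm_sub_rpow hp0 ?_⟩
  simp only [WSpace.norm_sub_rpow, hUg, hUz]
  have h1 := (tendsto_iff_norm_sub_tendsto_zero.1 hg).rpow_const (p := p) (Or.inr hp0.le)
  have h2 := (tendsto_iff_norm_sub_tendsto_zero.1 hz).rpow_const (p := p) (Or.inr hp0.le)
  have h3 := h1.add h2
  rwa [Real.zero_rpow hp0.ne', add_zero] at h3

end WSpace

/-! ### Convexity and uniform convexity of ‖·‖^p -/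

section UniformConvexity

theorem convexOn_norm_rpow {X : Type*} [NormedAddCommGroup X] [NormedSpace ℝ X] {p : ℝ}
    (hp : 1 ≤ p) : ConvexOn ℝ Set.univ fun x : X => ‖x‖ ^ p := by
  refine ⟨convex_univ, fun x _ y _ s t hs ht hst => ?_⟩
  have h1 : ‖s • x + t • y‖ ≤ s * ‖x‖ + t * ‖y‖ := by
    refine (norm_add_le _ _).trans_eq ?_
    rw [norm_smul, norm_smul, Real.norm_of_nonneg hs, Real.norm_of_nonneg ht]
  refine (Real.rpow_le_rpow (norm_nonneg _) h1 (by linarith)).trans ?_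
  exact (convexOn_rpow hp).2 (norm_nonneg x) (norm_nonneg y) hs ht hst

theorem convexOn_add_fderiv_le {X : Type*} [NormedAddCommGroup X] [NormedSpace ℝ X] {Ψ : X → ℝ}
    (hΨ : ConvexOn ℝ Set.univ Ψ) {D : X →L[ℝ] ℝ} {u : X} (hD : HasFDerivAt Ψ D u) (v : X) :
    Ψ u + D (v - u) ≤ Ψ v := by
  have h1 : HasDerivAt (fun t : ℝ => Ψ (AffineMap.lineMap u v t)) (D (v - u)) 0 := by
    have h2 : HasDerivAt (fun t : ℝ => AffineMap.lineMap u v t) (v - u) (0 : ℝ) :=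
      AffineMap.hasDerivAt_lineMap
    have h3 : HasFDerivAt Ψ D (AffineMap.lineMap u v (0 : ℝ)) := by simpa using hD
    exact h3.comp_hasDerivAt (0 : ℝ) h2
  have h4 : ConvexOn ℝ Set.univ (fun t : ℝ => Ψ (AffineMap.lineMap u v t)) :=
    hΨ.comp_affineMap (AffineMap.lineMap u v)
  have h5 := h4.le_slope_of_hasDerivAt (Set.mem_univ 0) (Set.mem_univ 1) one_pos h1
  rw [slope_def_field] at h5
  simp only [AffineMap.lineMap_apply_one, AffineMap.lineMap_apply_zero, sub_zero, div_one] at h5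
  linarith

/-- The midpoint defect of a convex function is controlled by the monotonicity of its
derivative. -/
theorem convexOn_midpoint_defect_le {X : Type*} [NormedAddCommGroup X] [NormedSpace ℝ X]
    {Ψ : X → ℝ} (hΨ : ConvexOn ℝ Set.univ Ψ) {D D' : X →L[ℝ] ℝ} {u v : X}
    (hD : HasFDerivAt Ψ D u) (hD' : HasFDerivAt Ψ D' v) :
    (1 / 2 : ℝ) * Ψ u + (1 / 2 : ℝ) * Ψ v - Ψ ((1 / 2 : ℝ) • (u + v)) ≤
      1 / 4 * (D (u - v) - D' (u - v)) := by
  -- The tangent inequalities at u and at v, both evaluated at the midpoint; their average is the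
  -- claim.
  have h1 := convexOn_add_fderiv_le hΨ hD ((1 / 2 : ℝ) • (u + v))
  have h2 := convexOn_add_fderiv_le hΨ hD' ((1 / 2 : ℝ) • (u + v))
  have e1 : (1 / 2 : ℝ) • (u + v) - u = (-(1 / 2) : ℝ) • (u - v) := by module
  have e2 : (1 / 2 : ℝ) • (u + v) - v = (1 / 2 : ℝ) • (u - v) := by module
  rw [e1, map_smul, smul_eq_mul] at h1
  rw [e2, map_smul, smul_eq_mul] at h2
  linarith

variable {E : Type*} [NormedAddCommGroup E] [InnerProductSpace ℝ E]

/-- For equal norms strictness comes from strict convexity of the Hilbert norm, for different norms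
from that of t ↦ t^p. -/
theorem midpoint_defect_pos {p : ℝ} (hp : 1 < p) {x y : E} (hxy : x ≠ y) :
    0 < (1 / 2 : ℝ) * ‖x‖ ^ p + (1 / 2 : ℝ) * ‖y‖ ^ p - ‖(1 / 2 : ℝ) • (x + y)‖ ^ p := by
  have hp0 : 0 < p := by linarith
  rw [sub_pos]
  rcases eq_or_ne ‖x‖ ‖y‖ with h | h
  · have h1 := norm_combo_lt_of_ne (le_refl ‖x‖) h.ge hxy (by norm_num : (0 : ℝ) < 1 / 2)
      (by norm_num : (0 : ℝ) < 1 / 2) (by norm_num)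
    rw [← smul_add] at h1
    have h2 := Real.rpow_lt_rpow (norm_nonneg _) h1 hp0
    rw [← h]
    linarith
  · have h1 := (strictConvexOn_rpow hp).2 (norm_nonneg x) (norm_nonneg y) h
      (by norm_num : (0 : ℝ) < 1 / 2) (by norm_num : (0 : ℝ) < 1 / 2) (by norm_num)
    simp only [smul_eq_mul] at h1
    refine lt_of_le_of_lt (Real.rpow_le_rpow (norm_nonneg _) ?_ hp0.le) h1
    rw [norm_smul, Real.norm_of_nonneg (by norm_num)]
    linarith [norm_add_le x y]

theorem midpoint_defect_nonneg {X : Type*} [NormedAddCommGroup X] [NormedSpace ℝ X] {p : ℝ}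
    (hp : 1 ≤ p) (x y : X) :
    0 ≤ (1 / 2 : ℝ) * ‖x‖ ^ p + (1 / 2 : ℝ) * ‖y‖ ^ p - ‖(1 / 2 : ℝ) • (x + y)‖ ^ p := by
  have h := (convexOn_norm_rpow (X := X) hp).2 (Set.mem_univ x) (Set.mem_univ y)
    (by norm_num : (0 : ℝ) ≤ 1 / 2) (by norm_num : (0 : ℝ) ≤ 1 / 2) (by norm_num)
  rw [← smul_add] at h
  simp only [smul_eq_mul] at h
  linarith

/-- Uniform convexity of `|·|^p` in additive form. -/
theorem exists_norm_sub_rpow_le [ProperSpace E] {p : ℝ} (hp : 1 < p) {ε : ℝ} (hε : 0 < ε) :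
    ∃ C : ℝ, 0 ≤ C ∧ ∀ x y : E, ‖x - y‖ ^ p ≤ ε * (‖x‖ ^ p + ‖y‖ ^ p) +
      C * ((1 / 2 : ℝ) * ‖x‖ ^ p + (1 / 2 : ℝ) * ‖y‖ ^ p - ‖(1 / 2 : ℝ) • (x + y)‖ ^ p) := by
  have hp0 : 0 < p := by linarith
  set defect : E × E → ℝ := fun z => (1 / 2 : ℝ) * ‖z.1‖ ^ p + (1 / 2 : ℝ) * ‖z.2‖ ^ p -
    ‖(1 / 2 : ℝ) • (z.1 + z.2)‖ ^ p with hdef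
  have hpow : Continuous fun t : ℝ => t ^ p := Real.continuous_rpow_const hp0.le
  have hdc : Continuous defect := by
    refine ((continuous_const.mul (hpow.comp ?_)).add (continuous_const.mul (hpow.comp ?_))).sub
      (hpow.comp ?_) <;> fun_prop
  -- By homogeneity it suffices to treat pairs with ‖x‖^p + ‖y‖^p = 1. Those with ‖x - y‖^p ≥ ε form
  -- a compact set, on which the positive continuous defect has a positive minimum δ.
  set S : Set (E × E) := {z | ‖z.1‖ ^ p + ‖z.2‖ ^ p = 1 ∧ ε ≤ ‖z.1 - z.2‖ ^ p} with hS
  have hSclosed : IsClosed S := by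
    refine (isClosed_eq ((hpow.comp ?_).add (hpow.comp ?_)) continuous_const).inter
      (isClosed_le continuous_const (hpow.comp ?_)) <;> fun_prop
  have hle1 : ∀ {s t : ℝ}, 0 ≤ s → 0 ≤ t → s ^ p + t ^ p = 1 → s ≤ 1 := fun {s t} hs ht h => by
    refine (Real.rpow_le_rpow_iff hs zero_le_one hp0).1 ?_
    rw [Real.one_rpow]
    linarith [Real.rpow_nonneg ht p]
  have hScompact : IsCompact S := by
    refine (isCompact_closedBall (0 : E × E) 1).of_isClosed_subset hSclosed fun z hz => ?_
    rw [mem_closedBall_zero_iff, Prod.norm_def, max_le_iff]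
    exact ⟨hle1 (norm_nonneg _) (norm_nonneg _) hz.1,
      hle1 (norm_nonneg _) (norm_nonneg _) ((add_comm _ _).trans hz.1)⟩
  have hδ : ∃ δ : ℝ, 0 < δ ∧ ∀ z ∈ S, δ ≤ defect z := by
    rcases S.eq_empty_or_nonempty with h | h
    · exact ⟨1, one_pos, fun z hz => by simp [h] at hz⟩
    · obtain ⟨z, hz, hmin⟩ := hScompact.exists_isMinOn h hdc.continuousOn
      refine ⟨defect z, midpoint_defect_pos hp fun heq => ?_, fun w hw => hmin hw⟩
      have := hz.2
      rw [heq, sub_self, norm_zero, Real.zero_rpow hp0.ne'] at this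
      linarith
  obtain ⟨δ, hδ0, hδ⟩ := hδ
  have hnorm : ∀ x y : E, ‖x‖ ^ p + ‖y‖ ^ p = 1 →
      ‖x - y‖ ^ p ≤ ε + 2 ^ p / δ * defect (x, y) := fun x y hxy => by
    have hd0 : 0 ≤ defect (x, y) := midpoint_defect_nonneg hp.le x y
    rcases lt_or_ge (‖x - y‖ ^ p) ε with h | h
    · have : 0 ≤ 2 ^ p / δ * defect (x, y) := by positivity
      linarith
    · have h1 : 2 ^ p / δ * δ ≤ 2 ^ p / δ * defect (x, y) :=
        mul_le_mul_of_nonneg_left (hδ (x, y) ⟨hxy, h⟩) (by positivity)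
      rw [div_mul_cancel₀ _ hδ0.ne'] at h1
      have h2 : ‖x - y‖ ^ p ≤ 2 ^ p * (‖x‖ ^ p + ‖y‖ ^ p) :=
        (Real.rpow_le_rpow (norm_nonneg _) (norm_sub_le _ _) hp0.le).trans
          (rpow_add_le (norm_nonneg _) (norm_nonneg _) hp0.le)
      rw [hxy, mul_one] at h2
      linarith
  refine ⟨2 ^ p / δ, by positivity, fun x y => ?_⟩
  set s := ‖x‖ ^ p + ‖y‖ ^ p with hs
  have hs0 : 0 ≤ s := by positivity
  rcases hs0.eq_or_lt with h0 | hspos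
  · have hx : ‖x‖ ^ p = 0 := by
      linarith [Real.rpow_nonneg (norm_nonneg x) p, Real.rpow_nonneg (norm_nonneg y) p]
    have hy : ‖y‖ ^ p = 0 := by
      linarith [Real.rpow_nonneg (norm_nonneg x) p, Real.rpow_nonneg (norm_nonneg y) p]
    rw [Real.rpow_eq_zero (norm_nonneg _) hp0.ne', norm_eq_zero] at hx hy
    rw [← h0, hx, hy]
    simp [Real.zero_rpow hp0.ne']
  · set c := s⁻¹ ^ (1 / p) with hc
    have hc0 : 0 < c := by positivity
    have hcp : c ^ p = s⁻¹ := by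
      rw [hc, ← Real.rpow_mul (by positivity), one_div_mul_cancel hp0.ne', Real.rpow_one]
    have hsc : ∀ v : E, ‖c • v‖ ^ p = s⁻¹ * ‖v‖ ^ p := fun v => by
      rw [norm_smul, Real.norm_of_nonneg hc0.le, Real.mul_rpow hc0.le (norm_nonneg _), hcp]
    have h1 := hnorm (c • x) (c • y) (by
      rw [hsc, hsc, ← mul_add, inv_mul_cancel₀ hspos.ne'])
    have e1 : (1 / 2 : ℝ) • (c • x + c • y) = c • ((1 / 2 : ℝ) • (x + y)) := by module
    simp only [hdef] at h1
    rw [← smul_sub, e1, hsc, hsc, hsc, hsc, inv_mul_le_iff₀ hspos] at h1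
    refine h1.trans_eq ?_
    field_simp

/-- The additive form is linear in p-th powers, so the pointwise inequality simply integrates with
the same constant; no case distinction p ≥ 2 or p < 2 arises. -/
theorem Lp.exists_norm_sub_rpow_le [ProperSpace E] {α : Type*} [MeasurableSpace α]
    (μ : Measure α) {p : ℝ} (hp : 1 < p) {ε : ℝ} (hε : 0 < ε) :
    ∃ C : ℝ, 0 ≤ C ∧ ∀ u v : Lp E (ENNReal.ofReal p) μ,
      ‖u - v‖ ^ p ≤ ε * (‖u‖ ^ p + ‖v‖ ^ p) +
      C * ((1 / 2 : ℝ) * ‖u‖ ^ p + (1 / 2 : ℝ) * ‖v‖ ^ p - ‖(1 / 2 : ℝ) • (u + v)‖ ^ p) := by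
  have hp0 : 0 < p := by linarith
  obtain ⟨C, hC0, hC⟩ := PLaplace.exists_norm_sub_rpow_le (E := E) hp hε
  refine ⟨C, hC0, fun u v => ?_⟩
  have iu := Lp.integrable_norm_rpow hp0 u
  have iv := Lp.integrable_norm_rpow hp0 v
  have im := Lp.integrable_norm_rpow hp0 ((1 / 2 : ℝ) • (u + v))
  have i1 := iu.const_mul (1 / 2)
  have i2 := iv.const_mul (1 / 2)
  have i3 : Integrable (fun x => 1 / 2 * ‖u x‖ ^ p + 1 / 2 * ‖v x‖ ^ p) μ := i1.add i2
  have i4 : Integrable (fun x => C * (1 / 2 * ‖u x‖ ^ p + 1 / 2 * ‖v x‖ ^ p -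
      ‖((1 / 2 : ℝ) • (u + v) : Lp E (ENNReal.ofReal p) μ) x‖ ^ p)) μ := (i3.sub im).const_mul C
  have i5 : Integrable (fun x => ε * (‖u x‖ ^ p + ‖v x‖ ^ p)) μ := (iu.add iv).const_mul ε
  rw [Lp.norm_rpow_eq_integral hp0 u, Lp.norm_rpow_eq_integral hp0 v,
    Lp.norm_rpow_eq_integral hp0 ((1 / 2 : ℝ) • (u + v)), Lp.norm_sub_rpow_eq_integral hp0,
    ← integral_add iu iv, ← integral_const_mul, ← integral_const_mul, ← integral_const_mul,
    ← integral_add i1 i2, ← integral_sub i3 im, ← integral_const_mul, ← integral_add i5 i4]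
  refine integral_mono_ae (Lp.integrable_norm_sub_rpow hp0 u v) (i5.add i4) ?_
  filter_upwards [Lp.coeFn_smul (1 / 2 : ℝ) (u + v), Lp.coeFn_add u v] with x h1 h2
  have h3 := hC (u x) (v x)
  rw [h1, Pi.smul_apply, h2, Pi.add_apply]
  exact h3

theorem WSpace.exists_norm_sub_rpow_le {N : ℕ} {p : ℝ} {b : Euc N → ℝ} (hp : 1 < p)
    (hb : ConditionB b) [Fact (1 ≤ ENNReal.ofReal p)] {ε : ℝ} (hε : 0 < ε) :
    ∃ C : ℝ, 0 ≤ C ∧ ∀ u v : WSpace hp hb,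
      ‖u - v‖ ^ p ≤ ε * (‖u‖ ^ p + ‖v‖ ^ p) +
      C * ((1 / 2 : ℝ) * ‖u‖ ^ p + (1 / 2 : ℝ) * ‖v‖ ^ p - ‖(1 / 2 : ℝ) • (u + v)‖ ^ p) := by
  obtain ⟨C₁, hC₁, h₁⟩ := Lp.exists_norm_sub_rpow_le (E := ℝ) (volume : Measure (Euc N)) hp hε
  obtain ⟨C₂, hC₂, h₂⟩ := Lp.exists_norm_sub_rpow_le (E := Euc N) (volume : Measure (Euc N)) hp hε
  refine ⟨C₁ + C₂, by positivity, fun u v => ?_⟩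
  have a1 := h₁ (WSpace.weight u) (WSpace.weight v)
  have a2 := h₂ u.grad v.grad
  have d1 := mul_nonneg hC₂ (midpoint_defect_nonneg hp.le (WSpace.weight u) (WSpace.weight v))
  have d2 := mul_nonneg hC₁ (midpoint_defect_nonneg hp.le u.grad v.grad)
  rw [WSpace.norm_sub_rpow, u.norm_rpow, v.norm_rpow,
    WSpace.norm_rpow ((1 / 2 : ℝ) • (u + v)), WSpace.grad_smul, WSpace.grad_add, map_smul, map_add]
  linarith

end UniformConvexity

/-! ### The concrete potentials -/

section Potentials

variable {α E : Type*} [MeasurableSpace α] {μ : Measure α}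

theorem IsPotential.exists_abs_integral_le [NormedAddCommGroup E] [NormedSpace ℝ E] {r : ℝ}
    {G : α → E → ℝ} {g : α → E → E →L[ℝ] ℝ} (hG : IsPotential μ r G g) (hr : 1 < r) :
    ∃ K : ℝ, ∀ u : Lp E (ENNReal.ofReal r) μ, |∫ x, G x (u x) ∂μ| ≤ K * ‖u‖ ^ r := by
  obtain ⟨C, hC0, hC⟩ := hG.growth hr
  have hr0 : 0 < r := by linarith
  refine ⟨C, fun u => ?_⟩
  rw [Lp.norm_rpow_eq_integral hr0, ← integral_const_mul]
  refine norm_integral_le_of_norm_le (f := fun x => G x (u x))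
    ((Lp.integrable_norm_rpow hr0 u).const_mul C) ?_
  filter_upwards [hC] with x hx
  exact hx _

/-- Used twice: with the weight V it yields the functional I, and with V = 1 it shows that ‖·‖^p is
C^1 on L^p. -/
theorem isPotential_norm_rpow [NormedAddCommGroup E] [InnerProductSpace ℝ E] {p : ℝ}
    (hp : 1 < p) {V : α → ℝ} (hV : MemLp V ⊤ μ) :
    IsPotential μ p (fun x (ξ : E) => V x * ‖ξ‖ ^ p)
      (fun x ξ => V x • fderiv ℝ (fun η : E => ‖η‖ ^ p) ξ) := by
  have hcd : ContDiff ℝ 1 fun η : E => ‖η‖ ^ p := contDiff_norm_rpow hp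
  have hc := hcd.continuous_fderiv one_ne_zero
  exact {
    measurable := fun u hu => hV.1.mul (hcd.continuous.comp_aestronglyMeasurable hu)
    measurable_deriv := fun u hu => hV.1.smul (hc.comp_aestronglyMeasurable hu)
    zero := fun x => by simp [Real.zero_rpow (by linarith : p ≠ 0)]
    hasFDerivAt := fun x ξ =>
      ((hcd.differentiable one_ne_zero ξ).hasFDerivAt).const_mul (V x)
    continuous_deriv := fun x => hc.const_smul (V x)
    bound := by
      refine ⟨(eLpNormEssSup V μ).toReal * p, ?_⟩
      filter_upwards [ae_le_eLpNormEssSup (f := V) (μ := μ)] with x hx ξ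
      rw [norm_smul, norm_fderiv_norm_id_rpow ξ hp, mul_assoc]
      refine mul_le_mul_of_nonneg_right ?_ (by positivity)
      have hfin : eLpNormEssSup V μ ≠ ⊤ := by
        rw [← eLpNorm_exponent_top]
        exact hV.2.ne
      have := ENNReal.toReal_mono hfin hx
      simpa using this }

theorem continuous_primitive {N : ℕ} {h : Euc N → ℝ → ℝ}
    (hc : Continuous fun z : Euc N × ℝ => h z.1 z.2) :
    Continuous fun z : Euc N × ℝ => primitive h z.1 z.2 := by
  refine intervalIntegral.continuous_parametric_intervalIntegral_of_continuous
    (f := fun (z : Euc N × ℝ) (t : ℝ) => h z.1 t) ?_ continuous_snd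
  exact hc.comp (by fun_prop : Continuous fun w : (Euc N × ℝ) × ℝ => (w.1.1, w.2))

theorem continuous_slice {N : ℕ} {h : Euc N → ℝ → ℝ}
    (hc : Continuous fun z : Euc N × ℝ => h z.1 z.2) (x : Euc N) : Continuous (h x) :=
  hc.comp (by fun_prop : Continuous fun t : ℝ => (x, t))

theorem isPotential_primitive {N : ℕ} {h : Euc N → ℝ → ℝ} {r C : ℝ}
    (hc : Continuous fun z : Euc N × ℝ => h z.1 z.2)
    (hb : ∀ x t, |h x t| ≤ C * |t| ^ (r - 1)) :
    IsPotential (volume : Measure (Euc N)) r (primitive h)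
      (fun x t => ContinuousLinearMap.toSpanSingleton ℝ (h x t)) where
  measurable u hu := (continuous_primitive hc).comp_aestronglyMeasurable
    (continuous_id.aestronglyMeasurable.prodMk hu)
  measurable_deriv u hu := by
    have h1 : AEStronglyMeasurable (fun x => h x (u x)) volume :=
      hc.comp_aestronglyMeasurable (continuous_id.aestronglyMeasurable.prodMk hu)
    exact (ContinuousLinearMap.toSpanSingletonCLE (𝕜 := ℝ)
      (E := ℝ)).continuous.comp_aestronglyMeasurable h1
  zero x := by simp [primitive]
  hasFDerivAt x t := by
    have := intervalIntegral.integral_hasDerivAt_right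
      ((continuous_slice hc x).intervalIntegrable 0 t)
      (continuous_slice hc x).stronglyMeasurable.stronglyMeasurableAtFilter
      (continuous_slice hc x).continuousAt
    exact this.hasFDerivAt
  continuous_deriv x :=
    (ContinuousLinearMap.toSpanSingletonCLE (𝕜 := ℝ) (E := ℝ)).continuous.comp
      (continuous_slice hc x)
  bound := ⟨C, Eventually.of_forall fun x t => by
    rw [ContinuousLinearMap.norm_toSpanSingleton]
    exact hb x t⟩

end Potentials

/-! ### Splitting the nonlinearity -/

section Splitting

variable {N : ℕ} {p : ℝ} {f : Euc N → ℝ → ℝ}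

/-- The truncation of `t` to `[-1, 1]`. -/
def clamp (t : ℝ) : ℝ := max (-1) (min 1 t)

theorem continuous_clamp : Continuous clamp := by unfold clamp; fun_prop

theorem clamp_of_abs_le {t : ℝ} (h : |t| ≤ 1) : clamp t = t := by
  rw [abs_le] at h
  rw [clamp, min_eq_right h.2, max_eq_right h.1]

theorem abs_clamp_of_le {t : ℝ} (h : 1 ≤ |t|) : |clamp t| = 1 := by
  rcases le_abs.1 h with h | h
  · rw [clamp, min_eq_left h, max_eq_right (by norm_num), abs_one]
  · rw [clamp, min_eq_right (by linarith), max_eq_left (by linarith), abs_neg, abs_one]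

/-- The nonlinearity is the sum of a term of growth `p - 1` and a term of growth `q - 1`. -/
theorem exists_splitting (hp : 1 < p) (hf1 : ConditionF1 p f) (hf3 : ConditionF3 p f) :
    ∃ q C : ℝ, p < q ∧ (q : EReal) < criticalExponent N p ∧
      (∀ x t, |f x (clamp t)| ≤ C * |t| ^ (p - 1)) ∧
      ∀ x t, |f x t - f x (clamp t)| ≤ C * |t| ^ (q - 1) := by
  obtain ⟨q, hpq, hq, C, hC⟩ := hf1.growth
  obtain ⟨δ, hδ, hfδ⟩ := hf3 1 one_pos
  have hp1 : 0 < p - 1 := by linarith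
  -- The entry 1 handles |t| < δ by (f₃) with ε = 1. For δ ≤ |t| ≤ 1 the growth condition gives |f|
  -- ≤ 2|C|, absorbed by the other entry since |t|^(p-1) ≥ δ^(p-1).
  set C₁ := max 1 (2 * |C| / δ ^ (p - 1)) with hC₁
  have hC₁1 : 1 ≤ C₁ := le_max_left _ _
  have hsmall : ∀ x t, |t| ≤ 1 → |f x t| ≤ C₁ * |t| ^ (p - 1) := fun x t ht => by
    rcases lt_or_ge |t| δ with h | h
    · exact (hfδ x t h).trans (mul_le_mul_of_nonneg_right hC₁1 (by positivity))
    · have h1 : |t| ^ (q - 1) ≤ 1 := Real.rpow_le_one (abs_nonneg _) ht (by linarith)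
      have h2 : |f x t| ≤ 2 * |C| := by
        refine (hC x t).trans ?_
        have : C * (1 + |t| ^ (q - 1)) ≤ |C| * (1 + |t| ^ (q - 1)) :=
          mul_le_mul_of_nonneg_right (le_abs_self C) (by positivity)
        nlinarith [abs_nonneg C]
      have h3 : 2 * |C| / δ ^ (p - 1) * δ ^ (p - 1) ≤ C₁ * |t| ^ (p - 1) :=
        mul_le_mul (le_max_right _ _) (Real.rpow_le_rpow hδ.le h hp1.le) (by positivity)
          (by linarith)
      rw [div_mul_cancel₀ _ (by positivity)] at h3
      exact h2.trans h3
  have hbig : ∀ x t, 1 ≤ |t| → |f x (clamp t)| ≤ C₁ := fun x t ht => by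
    have h1 := abs_clamp_of_le ht
    have h2 := hsmall x (clamp t) h1.le
    rwa [h1, Real.one_rpow, mul_one] at h2
  refine ⟨q, C₁ + 2 * |C|, hpq, hq, fun x t => ?_, fun x t => ?_⟩
  · have h0 : 0 ≤ 2 * |C| * |t| ^ (p - 1) := by positivity
    rw [add_mul]
    rcases le_total |t| 1 with h | h
    · rw [clamp_of_abs_le h]
      linarith [hsmall x t h]
    · have h1 : C₁ * 1 ≤ C₁ * |t| ^ (p - 1) :=
        mul_le_mul_of_nonneg_left (Real.one_le_rpow h hp1.le) (by linarith)
      linarith [hbig x t h]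
  · rcases le_total |t| 1 with h | h
    · rw [clamp_of_abs_le h, sub_self, abs_zero]
      positivity
    · have h1 : 1 ≤ |t| ^ (q - 1) := Real.one_le_rpow h (by linarith)
      have h2 : |f x t| ≤ |C| * (1 + |t| ^ (q - 1)) :=
        (hC x t).trans (mul_le_mul_of_nonneg_right (le_abs_self C) (by positivity))
      have h3 := abs_sub (f x t) (f x (clamp t))
      have h4 := hbig x t h
      have h5 : C₁ * 1 ≤ C₁ * |t| ^ (q - 1) := mul_le_mul_of_nonneg_left h1 (by linarith)
      nlinarith [abs_nonneg C]

end Splitting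

/-! ### Derivatives of H, I and J on 𝒲 -/

section Composition

variable {X Y : Type*} [NormedAddCommGroup X] [NormedSpace ℝ X] [NormedAddCommGroup Y]
  [NormedSpace ℝ Y] {D : Y → Y →L[ℝ] ℝ}

theorem continuous_comp_clm (hD : Continuous D) (A : X →L[ℝ] Y) :
    Continuous fun u => (D (A u)).comp A :=
  (hD.comp A.continuous).clm_comp continuous_const

theorem hasFDerivAt_comp_clm {Ψ : Y → ℝ} (hD : ∀ y, HasFDerivAt Ψ (D y) y) (A : X →L[ℝ] Y)
    (u : X) : HasFDerivAt (fun u => Ψ (A u)) ((D (A u)).comp A) u :=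
  (hD (A u)).comp u A.hasFDerivAt

end Composition

section Functionals

variable {N : ℕ} {p : ℝ} {b : Euc N → ℝ} {hp : 1 < p} {hb : ConditionB b}

theorem functionalH_eq (u : WSpace hp hb) : functionalH u = 1 / p * ‖u‖ ^ p := by
  rw [functionalH, WSpace.norm_rpow_eq_integral]

/-- Homogeneity of degree p, from which Euler's identity gives the derivative of H at u in the
direction u without an explicit formula. -/
theorem functionalH_smul {t : ℝ} (ht : 0 < t) (u : WSpace hp hb) :
    functionalH (t • u) = t ^ p * functionalH u := by
  rw [functionalH_eq, functionalH_eq, norm_smul, Real.norm_of_nonneg ht.le,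
    Real.mul_rpow ht.le (norm_nonneg _)]
  ring

theorem functionalI_smul (V : Euc N → ℝ) {t : ℝ} (ht : 0 < t) (u : WSpace hp hb) :
    functionalI V (t • u) = t ^ p * functionalI V u := by
  have e : ∫ x, V x * |(t • u) x| ^ p = ∫ x, t ^ p * (V x * |u x| ^ p) := by
    refine integral_congr_ae ?_
    filter_upwards [Lp.coeFn_smul t (WSpace.toLp u)] with x hx
    rw [map_smul, hx, Pi.smul_apply, smul_eq_mul, abs_mul, abs_of_pos ht,
      Real.mul_rpow ht.le (abs_nonneg _)]
    ring
  rw [functionalI, functionalI, e, integral_const_mul]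
  ring

theorem exists_hasFDerivAt_integral_primitive {h : Euc N → ℝ → ℝ} {r C : ℝ} (hr : 1 < r)
    (hc : Continuous fun z : Euc N × ℝ => h z.1 z.2) (hb : ∀ x t, |h x t| ≤ C * |t| ^ (r - 1))
    [Fact (1 ≤ ENNReal.ofReal r)] :
    (∀ u : Lp ℝ (ENNReal.ofReal r) (volume : Measure (Euc N)),
      Integrable (fun x => primitive h x (u x)) volume ∧
      Integrable (fun x => h x (u x) * u x) volume) ∧
    ∃ (D : Lp ℝ (ENNReal.ofReal r) (volume : Measure (Euc N)) →
        Lp ℝ (ENNReal.ofReal r) (volume : Measure (Euc N)) →L[ℝ] ℝ) (K : ℝ), Continuous D ∧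
      (∀ u, HasFDerivAt (fun w : Lp ℝ (ENNReal.ofReal r) (volume : Measure (Euc N)) =>
        ∫ x, primitive h x (w x)) (D u) u) ∧
      (∀ u, D u u = ∫ x, h x (u x) * u x) ∧
      (∀ u v, |D u v| ≤ K * ‖u‖ ^ (r - 1) * ‖v‖) ∧
      ∀ u : Lp ℝ (ENNReal.ofReal r) (volume : Measure (Euc N)),
        |∫ x, primitive h x (u x)| ≤ K * ‖u‖ ^ r := by
  have P := isPotential_primitive hc hb
  obtain ⟨D, hDc, hD, hDe, K, hK⟩ := P.exists_hasFDerivAt hr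
  obtain ⟨K', hK'⟩ := P.exists_abs_integral_le hr
  refine ⟨fun u => ⟨P.integrable hr (Lp.memLp u), ?_⟩, D, max K K', hDc, hD, fun u => ?_,
    fun u v => ?_, fun u => (hK' u).trans ?_⟩
  · refine ((Lp.integrable_norm_rpow (by linarith) u).const_mul C).mono' ?_
      (Eventually.of_forall fun x => ?_)
    · exact (hc.comp_aestronglyMeasurable (continuous_id.aestronglyMeasurable.prodMk
        (Lp.aestronglyMeasurable u))).mul (Lp.aestronglyMeasurable u)
    · rw [norm_mul, Real.norm_eq_abs, Real.norm_eq_abs]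
      refine (mul_le_mul_of_nonneg_right (hb x _) (abs_nonneg _)).trans_eq ?_
      rcases eq_or_ne (u x) 0 with h0 | h0
      · simp [h0, Real.zero_rpow (by linarith : r ≠ 0)]
      · rw [mul_assoc, ← Real.rpow_add_one (abs_ne_zero.2 h0), sub_add_cancel]
  · rw [hDe]
    refine integral_congr_ae (Eventually.of_forall fun x => ?_)
    beta_reduce
    rw [ContinuousLinearMap.toSpanSingleton_apply, smul_eq_mul, mul_comm]
  · refine ((D u).le_opNorm v).trans
      (mul_le_mul_of_nonneg_right ((hK u).trans ?_) (norm_nonneg _))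
    exact mul_le_mul_of_nonneg_right (le_max_left _ _) (by positivity)
  · exact mul_le_mul_of_nonneg_right (le_max_right _ _) (by positivity)

theorem integrable_functionalI {V : Euc N → ℝ} (hV : ConditionV V) (u : WSpace hp hb) :
    Integrable (fun x => V x * |u x| ^ p) volume :=
  (isPotential_norm_rpow (E := ℝ) hp hV).integrable hp (Lp.memLp (WSpace.toLp u))

variable [Fact (1 ≤ ENNReal.ofReal p)]

/-- The embedding of `𝒲` into `L^p`. -/
def WSpace.toLpL : WSpace hp hb →L[ℝ] Lp ℝ (ENNReal.ofReal p) (volume : Measure (Euc N)) :=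
  WSpace.toLp.mkContinuousOfExistsBound
    ((WSpace.exists_norm_toLp_le hp hb).imp fun _ h => h.2)

theorem WSpace.toLpL_apply (u : WSpace hp hb) : WSpace.toLpL u = WSpace.toLp u := rfl

/-- The map `u ↦ b^{1/p} u` as a continuous linear map. -/
def WSpace.weightL : WSpace hp hb →L[ℝ] Lp ℝ (ENNReal.ofReal p) (volume : Measure (Euc N)) :=
  WSpace.weight.mkContinuous 1 fun u => by rw [one_mul]; exact u.norm_weight_le

/-- The weak gradient as a continuous linear map. -/
def WSpace.gradL : WSpace hp hb →L[ℝ] Lp (Euc N) (ENNReal.ofReal p) (volume : Measure (Euc N)) :=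
  LinearMap.mkContinuous
    { toFun := WSpace.grad
      map_add' := WSpace.grad_add
      map_smul' := WSpace.grad_smul } 1 fun u => by rw [one_mul]; exact u.norm_grad_le

theorem exists_hasFDerivAt_Lp_norm_rpow {α E : Type*} [MeasurableSpace α] {μ : Measure α}
    [NormedAddCommGroup E] [InnerProductSpace ℝ E] (hp : 1 < p) :
    ∃ D : Lp E (ENNReal.ofReal p) μ → Lp E (ENNReal.ofReal p) μ →L[ℝ] ℝ, Continuous D ∧
      ∀ u, HasFDerivAt (fun w : Lp E (ENNReal.ofReal p) μ => ‖w‖ ^ p) (D u) u := by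
  have h := isPotential_norm_rpow (E := E) hp (memLp_top_const (1 : ℝ) (μ := μ))
  obtain ⟨D, hDc, hD, -⟩ := h.exists_hasFDerivAt hp
  refine ⟨D, hDc, fun u => ?_⟩
  have e : (fun w : Lp E (ENNReal.ofReal p) μ => ‖w‖ ^ p) = fun w => ∫ x, 1 * ‖w x‖ ^ p ∂μ := by
    ext w
    simp only [one_mul]
    exact Lp.norm_rpow_eq_integral (by linarith) w
  rw [e]
  exact hD u

theorem exists_hasFDerivAt_functionalH :
    ∃ D : WSpace hp hb → WSpace hp hb →L[ℝ] ℝ, Continuous D ∧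
      ∀ u, HasFDerivAt (functionalH : WSpace hp hb → ℝ) (D u) u := by
  obtain ⟨D₁, hD₁c, hD₁⟩ := exists_hasFDerivAt_Lp_norm_rpow (α := Euc N) (E := ℝ)
    (μ := volume) hp
  obtain ⟨D₂, hD₂c, hD₂⟩ := exists_hasFDerivAt_Lp_norm_rpow (α := Euc N) (E := Euc N)
    (μ := volume) hp
  refine ⟨fun u => (1 / p) • ((D₂ (WSpace.gradL u)).comp WSpace.gradL +
    (D₁ (WSpace.weightL u)).comp WSpace.weightL), ?_, fun u => ?_⟩
  · exact ((continuous_comp_clm hD₂c WSpace.gradL).add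
      (continuous_comp_clm hD₁c WSpace.weightL)).const_smul (1 / p)
  · have e : (functionalH : WSpace hp hb → ℝ) =
        fun u => 1 / p * (‖WSpace.gradL u‖ ^ p + ‖WSpace.weightL u‖ ^ p) := by
      ext u
      rw [functionalH_eq, WSpace.norm_rpow]
      rfl
    rw [e]
    exact ((hasFDerivAt_comp_clm hD₂ WSpace.gradL u).add
      (hasFDerivAt_comp_clm hD₁ WSpace.weightL u)).const_mul (1 / p)

theorem exists_hasFDerivAt_functionalI {V : Euc N → ℝ} (hV : ConditionV V) :
    ∃ (D : WSpace hp hb → WSpace hp hb →L[ℝ] ℝ) (K : ℝ), Continuous D ∧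
      (∀ u, HasFDerivAt (functionalI V : WSpace hp hb → ℝ) (D u) u) ∧
      (∀ u v, |D u v| ≤ K * ‖WSpace.toLp u‖ ^ (p - 1) * ‖WSpace.toLp v‖) ∧
      ∀ u : WSpace hp hb, |functionalI V u| ≤ K * ‖WSpace.toLp u‖ ^ p := by
  have h := isPotential_norm_rpow (E := ℝ) hp hV
  have hp0 : 0 < p := by linarith
  obtain ⟨D, hDc, hD, -, K, hK⟩ := h.exists_hasFDerivAt hp
  obtain ⟨K', hK'⟩ := h.exists_abs_integral_le hp
  refine ⟨fun u => (1 / p) • (D (WSpace.toLpL u)).comp WSpace.toLpL, 1 / p * max K K',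
    ?_, fun u => ?_, fun u v => ?_, fun u => ?_⟩
  · exact (continuous_comp_clm hDc WSpace.toLpL).const_smul (1 / p)
  · exact (hasFDerivAt_comp_clm hD WSpace.toLpL u).const_mul (1 / p)
  · change |1 / p * D (WSpace.toLp u) (WSpace.toLp v)| ≤ _
    rw [abs_mul, abs_of_nonneg (by positivity : (0 : ℝ) ≤ 1 / p), mul_assoc, mul_assoc,
      ← mul_assoc _ _ ‖_‖]
    refine mul_le_mul_of_nonneg_left ?_ (by positivity)
    refine ((D (WSpace.toLp u)).le_opNorm _).trans
      (mul_le_mul_of_nonneg_right ((hK _).trans ?_) (norm_nonneg _))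
    exact mul_le_mul_of_nonneg_right (le_max_left _ _) (by positivity)
  · rw [functionalI, abs_mul, abs_of_nonneg (by positivity : (0 : ℝ) ≤ 1 / p), mul_assoc]
    refine mul_le_mul_of_nonneg_left ((hK' (WSpace.toLp u)).trans ?_) (by positivity)
    exact mul_le_mul_of_nonneg_right (le_max_right _ _) (by positivity)

/-- The clamped part of f acts through L^p and the remainder through the embedding T into L^q, each
being C^1 on its own space. The bounds keep the two norms separate, so that smallness in L^p and L^q
can be used later. -/
theorem exists_hasFDerivAt_functionalJ {f : Euc N → ℝ → ℝ}
    (hf : Continuous fun z : Euc N × ℝ => f z.1 z.2) {q C : ℝ} (hq : 1 < q)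
    (h₁ : ∀ x t, |f x (clamp t)| ≤ C * |t| ^ (p - 1))
    (h₂ : ∀ x t, |f x t - f x (clamp t)| ≤ C * |t| ^ (q - 1)) [Fact (1 ≤ ENNReal.ofReal q)]
    {T : WSpace hp hb →L[ℝ] Lp ℝ (ENNReal.ofReal q) (volume : Measure (Euc N))}
    (hT : ∀ u : WSpace hp hb, T u =ᵐ[volume] u) :
    (∀ u : WSpace hp hb, Integrable (fun x => primitive f x (u x)) volume ∧
      Integrable (fun x => f x (u x) * u x) volume) ∧
    ∃ (D : WSpace hp hb → WSpace hp hb →L[ℝ] ℝ) (K : ℝ), Continuous D ∧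
      (∀ u, HasFDerivAt (functionalJ f : WSpace hp hb → ℝ) (D u) u) ∧
      (∀ u : WSpace hp hb, D u u = ∫ x, f x (u x) * u x) ∧
      (∀ u v, |D u v| ≤ K * ‖WSpace.toLp u‖ ^ (p - 1) * ‖WSpace.toLp v‖ +
        K * ‖T u‖ ^ (q - 1) * ‖T v‖) ∧
      ∀ u : WSpace hp hb, |functionalJ f u| ≤ K * ‖WSpace.toLp u‖ ^ p + K * ‖T u‖ ^ q := by
  set f₁ : Euc N → ℝ → ℝ := fun x t => f x (clamp t) with hf₁
  set f₂ : Euc N → ℝ → ℝ := fun x t => f x t - f x (clamp t) with hf₂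
  have hc₁ : Continuous fun z : Euc N × ℝ => f₁ z.1 z.2 :=
    hf.comp (continuous_fst.prodMk (continuous_clamp.comp continuous_snd))
  have hc₂ : Continuous fun z : Euc N × ℝ => f₂ z.1 z.2 := hf.sub hc₁
  obtain ⟨i₁, D₁, K₁, hD₁c, hD₁, hD₁e, hD₁b, hK₁⟩ :=
    exists_hasFDerivAt_integral_primitive hp hc₁ h₁
  obtain ⟨i₂, D₂, K₂, hD₂c, hD₂, hD₂e, hD₂b, hK₂⟩ :=
    exists_hasFDerivAt_integral_primitive hq hc₂ h₂
  have hfsum : ∀ x t, f x t = f₁ x t + f₂ x t := fun x t => by simp [hf₁, hf₂]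
  have hsplit : ∀ x t, primitive f x t = primitive f₁ x t + primitive f₂ x t := fun x t => by
    rw [primitive, primitive, primitive, ← intervalIntegral.integral_add
      ((continuous_slice hc₁ x).intervalIntegrable _ _)
      ((continuous_slice hc₂ x).intervalIntegrable _ _)]
    simp only [hfsum]
  have i₂' : ∀ u : WSpace hp hb, Integrable (fun x => primitive f₂ x (u x)) volume := fun u =>
    (i₂ (T u)).1.congr ((hT u).mono fun x hx => by simp only [hx])
  have j₂' : ∀ u : WSpace hp hb, Integrable (fun x => f₂ x (u x) * u x) volume := fun u =>
    (i₂ (T u)).2.congr ((hT u).mono fun x hx => by simp only [hx])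
  have eJ : ∀ u : WSpace hp hb, functionalJ f u =
      (∫ x, primitive f₁ x (WSpace.toLpL u x)) + ∫ x, primitive f₂ x (T u x) := fun u => by
    have e2 : ∫ x, primitive f₂ x (T u x) = ∫ x, primitive f₂ x (u x) :=
      integral_congr_ae ((hT u).mono fun x hx => by simp only [hx])
    rw [functionalJ, e2, WSpace.toLpL_apply, ← integral_add (i₁ _).1 (i₂' u)]
    simp only [hsplit]
  have hmax : ∀ {x : ℝ}, 0 ≤ x → K₁ * x ≤ max K₁ K₂ * x ∧ K₂ * x ≤ max K₁ K₂ * x := fun hx =>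
    ⟨mul_le_mul_of_nonneg_right (le_max_left _ _) hx,
      mul_le_mul_of_nonneg_right (le_max_right _ _) hx⟩
  refine ⟨fun u => ⟨?_, ?_⟩, fun u => (D₁ (WSpace.toLpL u)).comp WSpace.toLpL +
    (D₂ (T u)).comp T, max K₁ K₂, ?_, fun u => ?_, fun u => ?_, fun u v => ?_, fun u => ?_⟩
  · simp only [hsplit]
    exact (i₁ (WSpace.toLp u)).1.add (i₂' u)
  · simp only [hfsum, add_mul]
    exact (i₁ (WSpace.toLp u)).2.add (j₂' u)
  · exact (continuous_comp_clm hD₁c WSpace.toLpL).add (continuous_comp_clm hD₂c T)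
  · rw [show (functionalJ f : WSpace hp hb → ℝ) = _ from funext eJ]
    exact (hasFDerivAt_comp_clm hD₁ WSpace.toLpL u).add (hasFDerivAt_comp_clm hD₂ T u)
  · change D₁ (WSpace.toLp u) (WSpace.toLp u) + D₂ (T u) (T u) = _
    have e2 : ∫ x, f₂ x (T u x) * T u x = ∫ x, f₂ x (u x) * u x :=
      integral_congr_ae ((hT u).mono fun x hx => by simp only [hx])
    rw [hD₁e, hD₂e, e2, ← integral_add (i₁ _).2 (j₂' u)]
    simp only [hfsum, add_mul]
  · change |D₁ (WSpace.toLp u) (WSpace.toLp v) + D₂ (T u) (T v)| ≤ _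
    refine (abs_add_le _ _).trans (add_le_add ((hD₁b _ _).trans ?_) ((hD₂b _ _).trans ?_))
    · exact mul_le_mul_of_nonneg_right (hmax (by positivity)).1 (norm_nonneg _)
    · exact mul_le_mul_of_nonneg_right (hmax (by positivity)).2 (norm_nonneg _)
  · rw [eJ]
    refine (abs_add_le _ _).trans (add_le_add ((hK₁ _).trans ?_) ((hK₂ _).trans ?_))
    · exact (hmax (by positivity)).1
    · exact (hmax (by positivity)).2

/-- Euler's identity for homogeneous functions. -/
theorem fderiv_apply_self_of_homogeneous {X : Type*} [NormedAddCommGroup X] [NormedSpace ℝ X]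
    {Ψ : X → ℝ} {r : ℝ} {u : X} {D : X →L[ℝ] ℝ}
    (hΨ : ∀ t : ℝ, 0 < t → Ψ (t • u) = t ^ r * Ψ u) (hD : HasFDerivAt Ψ D u) :
    D u = r * Ψ u := by
  have h1 : HasDerivAt (fun t : ℝ => Ψ (t • u)) (D u) 1 := by
    have h2 : HasDerivAt (fun t : ℝ => t • u) u (1 : ℝ) := by
      simpa using (hasDerivAt_id (1 : ℝ)).smul_const u
    have h3 : HasFDerivAt Ψ D ((1 : ℝ) • u) := by simpa using hD
    exact h3.comp_hasDerivAt (1 : ℝ) h2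
  have h4 : HasDerivAt (fun t : ℝ => t ^ r * Ψ u) (r * Ψ u) 1 := by
    have := (Real.hasDerivAt_rpow_const (x := 1) (p := r) (Or.inl one_ne_zero)).mul_const (Ψ u)
    simpa using this
  refine h1.unique (h4.congr_of_eventuallyEq ?_)
  filter_upwards [lt_mem_nhds (one_pos : (0 : ℝ) < 1)] with t ht
  exact hΨ t ht

end Functionals

/-! ### Radial maxima along Cerami sequences -/

section Rays

/-- If `p Φ(tu) - Φ'(tu)(tu) ≤ θ (p Φ(u) - Φ'(u)u)` for `t ∈ [0, 1]`, then `Φ` cannot be large at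
an intermediate point of the segments `[0, u k]` along a Cerami sequence. -/
theorem false_of_large_on_rays {X : Type*} [NormedAddCommGroup X] [NormedSpace ℝ X] {Φ : X → ℝ}
    {D : X → X →L[ℝ] ℝ} (hD : ∀ u, HasFDerivAt Φ (D u) u) {θ p c : ℝ} (hp : 0 < p)
    (hQ : ∀ (u : X) (t : ℝ), 0 ≤ t → t ≤ 1 →
      p * Φ (t • u) - D (t • u) (t • u) ≤ θ * (p * Φ u - D u u))
    (hΦ0 : Φ 0 = 0) {u : ℕ → X} (hu : Tendsto (fun k => ‖u k‖) atTop atTop)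
    (hc : Tendsto (fun k => Φ (u k)) atTop (𝓝 c))
    (hd : Tendsto (fun k => D (u k) (u k)) atTop (𝓝 0))
    (hray : ∀ A : ℝ, ∃ m : ℝ, 0 < m ∧ ∀ᶠ k in atTop, A ≤ Φ (m • (‖u k‖⁻¹ • u k))) : False := by
  -- A exceeds both c, which keeps the maximum away from t = 1, and θc, which gives the final
  -- contradiction.
  set A : ℝ := |c| + |θ * c| + 1 with hA
  have hA0 : 0 < A := by positivity
  have hAc : c < A := by linarith [le_abs_self c, abs_nonneg (θ * c)]
  have hAθ : θ * (p * c - 0) < p * A := by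
    have : θ * c < A := by linarith [le_abs_self (θ * c), abs_nonneg c]
    nlinarith
  obtain ⟨m, hm, hray⟩ := hray A
  have hlim : Tendsto (fun k => θ * (p * Φ (u k) - D (u k) (u k))) atTop
      (𝓝 (θ * (p * c - 0))) := ((hc.const_mul p).sub hd).const_mul θ
  obtain ⟨k, h1, h2, h3, h4⟩ := (hray.and ((hu.eventually_ge_atTop m).and
    ((hc.eventually_lt_const hAc).and (hlim.eventually_lt_const hAθ)))).exists
  set w := u k with hw
  have hw0 : 0 < ‖w‖ := hm.trans_le h2
  rw [smul_smul] at h1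
  have hline : ∀ t : ℝ, HasDerivAt (fun t : ℝ => Φ (t • w)) (D (t • w) w) t := fun t => by
    have h : HasDerivAt (fun t : ℝ => t • w) w t := by
      simpa using (hasDerivAt_id t).smul_const w
    exact (hD (t • w)).comp_hasDerivAt t h
  have hcont : ContinuousOn (fun t : ℝ => Φ (t • w)) (Set.Icc 0 1) := fun t _ =>
    (hline t).continuousAt.continuousWithinAt
  -- The point m w/‖w‖ lies on the segment because ‖w‖ ≥ m, so the maximum is at least A. The end
  -- values are 0 and Φ(w) < A, hence t is interior and the radial derivative vanishes there.
  obtain ⟨t, ht, hmax⟩ := isCompact_Icc.exists_isMaxOn ⟨(0 : ℝ), by simp⟩ hcont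
  have hmt : A ≤ Φ (t • w) := by
    refine h1.trans (hmax (a := m * ‖w‖⁻¹) ⟨by positivity, ?_⟩)
    rw [← div_eq_mul_inv, div_le_one hw0]
    exact h2
  have ht0 : t ≠ 0 := by
    rintro rfl
    rw [zero_smul, hΦ0] at hmt
    linarith
  have ht1 : t ≠ 1 := by
    rintro rfl
    rw [one_smul] at hmt
    linarith
  have hlt0 : 0 < t := lt_of_le_of_ne ht.1 ht0.symm
  have hlt1 : t < 1 := lt_of_le_of_ne ht.2 ht1
  have hcrit : D (t • w) w = 0 :=
    (hmax.isLocalMax (Icc_mem_nhds hlt0 hlt1)).hasDerivAt_eq_zero (hline t)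
  have h5 := hQ w t ht.1 ht.2
  rw [map_smul, hcrit, smul_zero, sub_zero] at h5
  nlinarith

theorem exists_subseq_norm_tendsto_atTop {X : Type*} [NormedAddCommGroup X] {u : ℕ → X}
    (h : ¬ ∃ B, ∀ k, ‖u k‖ ≤ B) :
    ∃ σ : ℕ → ℕ, StrictMono σ ∧ Tendsto (fun k => ‖u (σ k)‖) atTop atTop := by
  have hfreq : ∀ n : ℕ, ∃ᶠ k in atTop, (n : ℝ) ≤ ‖u k‖ := fun n => by
    by_contra hn
    rw [not_frequently] at hn
    have hb : IsBoundedUnder (· ≤ ·) atTop fun k => ‖u k‖ :=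
      ⟨n, by simpa using hn.mono fun k hk => (not_le.1 hk).le⟩
    obtain ⟨B, hB⟩ := hb.bddAbove_range
    exact h ⟨B, fun k => hB ⟨k, rfl⟩⟩
  obtain ⟨σ, hσ, hσn⟩ := extraction_forall_of_frequently hfreq
  exact ⟨σ, hσ, tendsto_atTop_mono hσn tendsto_natCast_atTop_atTop⟩

end Rays

/-! ### Superlinear growth forces the normalised limit to vanish -/

section Superlinear

variable {α : Type*} [MeasurableSpace α] {μ : Measure α} {r : ℝ}

theorem Lp.integrable_min_rpow (hr : 0 < r) (u : Lp ℝ (ENNReal.ofReal r) μ) {ρ : ℝ} (hρ : 0 ≤ ρ) :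
    Integrable (fun x => (min |u x| ρ) ^ r) μ := by
  refine (Lp.integrable_norm_rpow hr u).mono' ?_ (Eventually.of_forall fun x => ?_)
  · have h : Continuous fun t : ℝ => (min |t| ρ) ^ r :=
      (continuous_abs.min continuous_const).rpow_const fun _ => Or.inr hr.le
    exact h.comp_aestronglyMeasurable (Lp.aestronglyMeasurable u)
  · have h0 : 0 ≤ min |u x| ρ := le_min (abs_nonneg _) hρ
    rw [Real.norm_of_nonneg (by positivity)]
    exact Real.rpow_le_rpow h0 (min_le_left _ _) hr.le

variable [Fact (1 ≤ ENNReal.ofReal r)]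

/-- Replacing w_k by its limit v costs ‖w_k - v‖^r up to a constant, and for the fixed v dominated
convergence applies. It discards the region |u_k| ≤ R, where the normalised function is at most
R/s_k. -/
theorem Lp.tendsto_integral_min_rpow (hr : 0 < r) {w : ℕ → Lp ℝ (ENNReal.ofReal r) μ}
    {v : Lp ℝ (ENNReal.ofReal r) μ} (hw : Tendsto w atTop (𝓝 v)) {ρ : ℕ → ℝ} (hρ0 : ∀ k, 0 ≤ ρ k)
    (hρ : Tendsto ρ atTop (𝓝 0)) :
    Tendsto (fun k => ∫ x, (min |w k x| (ρ k)) ^ r ∂μ) atTop (𝓝 0) := by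
  have hv : Tendsto (fun k => ∫ x, (min |v x| (ρ k)) ^ r ∂μ) atTop (𝓝 0) := by
    have h := tendsto_integral_of_dominated_convergence (μ := μ)
      (F := fun k x => (min |v x| (ρ k)) ^ r) (f := fun _ => 0) (fun x => ‖v x‖ ^ r)
      (fun k => (Lp.integrable_min_rpow hr v (hρ0 k)).aestronglyMeasurable)
      (Lp.integrable_norm_rpow hr v) (fun k => Eventually.of_forall fun x => ?_)
      (Eventually.of_forall fun x => ?_)
    · simpa using h
    · have h0 : 0 ≤ min |v x| (ρ k) := le_min (abs_nonneg _) (hρ0 k)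
      rw [Real.norm_of_nonneg (by positivity)]
      exact Real.rpow_le_rpow h0 (min_le_left _ _) hr.le
    · have h1 : Tendsto (fun k => min |v x| (ρ k)) atTop (𝓝 (min |v x| 0)) :=
        tendsto_const_nhds.min hρ
      rw [min_eq_right (abs_nonneg _)] at h1
      have h2 := h1.rpow_const (p := r) (Or.inr hr.le)
      rwa [Real.zero_rpow hr.ne'] at h2
  have hd : Tendsto (fun k => ‖w k - v‖ ^ r) atTop (𝓝 0) := by
    have h1 := (tendsto_iff_norm_sub_tendsto_zero.1 hw).rpow_const (p := r) (Or.inr hr.le)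
    rwa [Real.zero_rpow hr.ne'] at h1
  have hsum : Tendsto (fun k => 2 ^ r * (‖w k - v‖ ^ r + ∫ x, (min |v x| (ρ k)) ^ r ∂μ)) atTop
      (𝓝 0) := by
    simpa using (hd.add hv).const_mul (2 ^ r)
  refine squeeze_zero (fun k => integral_nonneg fun x => ?_) (fun k => ?_) hsum
  · have h0 : 0 ≤ min |w k x| (ρ k) := le_min (abs_nonneg _) (hρ0 k)
    positivity
  · have i1 := Lp.integrable_norm_sub_rpow hr (w k) v
    have i2 := Lp.integrable_min_rpow hr v (hρ0 k)
    rw [Lp.norm_sub_rpow_eq_integral hr, ← integral_add i1 i2, ← integral_const_mul]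
    refine integral_mono (Lp.integrable_min_rpow hr (w k) (hρ0 k)) ((i1.add i2).const_mul _)
      fun x => ?_
    have h0 : 0 ≤ min |v x| (ρ k) := le_min (abs_nonneg _) (hρ0 k)
    have h1 : min |w k x| (ρ k) ≤ ‖w k x - v x‖ + min |v x| (ρ k) := by
      have h2 : |w k x| ≤ |w k x - v x| + |v x| := by
        simpa using abs_add_le (w k x - v x) (v x)
      rw [Real.norm_eq_abs, ← min_add_add_left]
      exact min_le_min h2 (le_add_of_nonneg_left (abs_nonneg _))
    exact (Real.rpow_le_rpow (le_min (abs_nonneg _) (hρ0 k)) h1 hr.le).trans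
      (rpow_add_le (norm_nonneg _) h0 hr.le)

/-- With w = u_k/s_k, the quantity M(|w|^r - min(|w|, R/s_k)^r) vanishes where |u_k| ≤ R and is at
most s_k^(-r) h(x, u_k) elsewhere by superlinearity. In the limit M‖v‖^r ≤ K for every M > 0. -/
theorem eq_zero_of_integral_superlinear_le {h : α → ℝ → ℝ} (hr : 0 < r) (hh : ∀ x t, 0 ≤ h x t)
    (hsup : ∀ M : ℝ, ∃ R : ℝ, 0 < R ∧ ∀ x t, R ≤ |t| → M ≤ h x t / |t| ^ r)
    {u : ℕ → Lp ℝ (ENNReal.ofReal r) μ} {s : ℕ → ℝ} (hs : Tendsto s atTop atTop)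
    {v : Lp ℝ (ENNReal.ofReal r) μ} (hv : Tendsto (fun k => (s k)⁻¹ • u k) atTop (𝓝 v))
    (hi : ∀ k, Integrable (fun x => h x (u k x)) μ) {K : ℝ}
    (hK : ∀ᶠ k in atTop, ∫ x, h x (u k x) ∂μ ≤ K * s k ^ r) : v = 0 := by
  have key : ∀ M : ℝ, 0 < M → M * ‖v‖ ^ r ≤ K := fun M hM => by
    obtain ⟨R, hR, hRM⟩ := hsup M
    -- The maximum with 1 only keeps ρ nonnegative for all k; eventually it equals s_k.
    have hρ0 : ∀ k, 0 ≤ R / max (s k) 1 := fun k => by positivity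
    have hρ : Tendsto (fun k => R / max (s k) 1) atTop (𝓝 0) :=
      tendsto_const_nhds.div_atTop (tendsto_atTop_mono (fun k => le_max_left _ _) hs)
    have h1 := Lp.tendsto_integral_min_rpow hr hv hρ0 hρ
    have h2 : Tendsto (fun k => ‖(s k)⁻¹ • u k‖ ^ r) atTop (𝓝 (‖v‖ ^ r)) :=
      hv.norm.rpow_const (Or.inr hr.le)
    have h3 := ((h2.sub h1).const_mul M)
    rw [sub_zero] at h3
    refine le_of_tendsto h3 ?_
    filter_upwards [hs.eventually_ge_atTop 1, hK] with k hk hKk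
    have hs0 : 0 < s k := by linarith
    have hsr : 0 < s k ^ r := Real.rpow_pos_of_pos hs0 r
    rw [max_eq_left hk]
    have i1 := Lp.integrable_norm_rpow hr ((s k)⁻¹ • u k)
    have i2 := Lp.integrable_min_rpow hr ((s k)⁻¹ • u k) (div_pos hR hs0).le
    rw [Lp.norm_rpow_eq_integral hr, ← integral_sub i1 i2, ← integral_const_mul]
    have h4 : ∫ x, M * (‖((s k)⁻¹ • u k : Lp ℝ (ENNReal.ofReal r) μ) x‖ ^ r -
        (min |((s k)⁻¹ • u k : Lp ℝ (ENNReal.ofReal r) μ) x| (R / s k)) ^ r) ∂μ ≤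
        ∫ x, (s k ^ r)⁻¹ * h x (u k x) ∂μ := by
      refine integral_mono_ae ((i1.sub i2).const_mul M) ((hi k).const_mul _) ?_
      filter_upwards [Lp.coeFn_smul (s k)⁻¹ (u k)] with x hx
      rw [hx, Pi.smul_apply, smul_eq_mul, Real.norm_eq_abs, abs_mul, abs_of_pos (inv_pos.2 hs0),
        inv_mul_eq_div]
      rcases le_total R |u k x| with hle | hle
      · have hu0 : 0 < |u k x| := hR.trans_le hle
        have h5 := (le_div_iff₀ (Real.rpow_pos_of_pos hu0 r)).1 (hRM x _ hle)
        have h6 : 0 ≤ (min (|u k x| / s k) (R / s k)) ^ r :=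
          Real.rpow_nonneg (le_min (by positivity) (by positivity)) _
        rw [Real.div_rpow (abs_nonneg _) hs0.le, inv_mul_eq_div, le_div_iff₀ hsr]
        have h7 : |u k x| ^ r / s k ^ r * s k ^ r = |u k x| ^ r := div_mul_cancel₀ _ hsr.ne'
        calc M * (|u k x| ^ r / s k ^ r - (min (|u k x| / s k) (R / s k)) ^ r) * s k ^ r
            = M * |u k x| ^ r - M * (min (|u k x| / s k) (R / s k)) ^ r * s k ^ r := by
              rw [mul_sub, sub_mul, mul_assoc M (_ / _), h7]
          _ ≤ M * |u k x| ^ r := sub_le_self _ (by positivity)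
          _ ≤ h x (u k x) := h5
      · rw [min_eq_left (div_le_div_of_nonneg_right hle hs0.le), sub_self, mul_zero]
        exact mul_nonneg (by positivity) (hh _ _)
    refine h4.trans ?_
    rw [integral_const_mul, inv_mul_eq_div, div_le_iff₀ hsr]
    exact hKk
  by_contra hne
  have hpos : 0 < ‖v‖ ^ r := Real.rpow_pos_of_pos (norm_pos_iff.2 hne) r
  have h := key ((|K| + 1) / ‖v‖ ^ r) (by positivity)
  rw [div_mul_cancel₀ _ hpos.ne'] at h
  linarith [le_abs_self K]

end Superlinear

/-! ### The energy: regularity and the lower-order terms -/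

section Energy

variable {N : ℕ} {p : ℝ} {b : Euc N → ℝ} {hp : 1 < p} {hb : ConditionB b}
  {V : Euc N → ℝ} {f : Euc N → ℝ → ℝ}

theorem exists_abs_functionalI_le (hV : ConditionV V) [Fact (1 ≤ ENNReal.ofReal p)] :
    ∃ K : ℝ, ∀ u : WSpace hp hb, |functionalI V u| ≤ K * ‖u‖ ^ p := by
  obtain ⟨-, K, -, -, -, hK⟩ := exists_hasFDerivAt_functionalI (hp := hp) (hb := hb) hV
  obtain ⟨K', hK'0, hK'⟩ := WSpace.exists_norm_toLp_le hp hb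
  refine ⟨|K| * K' ^ p, fun u => (hK u).trans ?_⟩
  rw [mul_assoc, ← Real.mul_rpow hK'0.le (norm_nonneg _)]
  exact mul_le_mul (le_abs_self K) (Real.rpow_le_rpow (norm_nonneg _) (hK' u) (by linarith))
    (by positivity) (abs_nonneg _)

/-- DG is the derivative of λI + J. The last two clauses express its compactness: bounded directions
that vanish in L^p also vanish in L^q, so DG and λI + J tend to zero along them. A general filter is
allowed because these clauses are applied both to sequences and to pairs of indices. -/
theorem exists_hasFDerivAt_energy (hN : 1 ≤ N) (hV : ConditionV V) (hf1 : ConditionF1 p f)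
    (hf3 : ConditionF3 p f) (lam : ℝ) [Fact (1 ≤ ENNReal.ofReal p)] :
    (∀ u : WSpace hp hb, Integrable (fun x => primitive f x (u x)) volume ∧
      Integrable (fun x => f x (u x) * u x) volume) ∧
    ∃ D DH DG : WSpace hp hb → WSpace hp hb →L[ℝ] ℝ, Continuous D ∧
      (∀ u, HasFDerivAt (energy lam V f : WSpace hp hb → ℝ) (D u) u) ∧
      (∀ u, HasFDerivAt (functionalH : WSpace hp hb → ℝ) (DH u) u) ∧
      (∀ u, D u = DH u - DG u) ∧
      (∀ u : WSpace hp hb, D u u =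
        ‖u‖ ^ p - lam * (p * functionalI V u) - ∫ x, f x (u x) * u x) ∧
      (∀ (ι : Type) (l : Filter ι) (u w : ι → WSpace hp hb) (B : ℝ), (∀ i, ‖u i‖ ≤ B) →
        (∀ i, ‖w i‖ ≤ B) → Tendsto (fun i => ‖WSpace.toLp (w i)‖) l (𝓝 0) →
        Tendsto (fun i => DG (u i) (w i)) l (𝓝 0)) ∧
      (∀ (ι : Type) (l : Filter ι) (w : ι → WSpace hp hb) (B : ℝ),
        (∀ i, ‖w i‖ ≤ B) → Tendsto (fun i => ‖WSpace.toLp (w i)‖) l (𝓝 0) →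
        Tendsto (fun i => functionalH (w i) - energy lam V f (w i)) l (𝓝 0)) := by
  have hp0 : 0 < p := by linarith
  obtain ⟨q, C, hpq, hq, h₁, h₂⟩ := exists_splitting hp hf1 hf3
  have hq1 : 1 < q := hp.trans hpq
  have hq0 : 0 < q := by linarith
  have := fact_one_le hq1
  obtain ⟨T, hT⟩ := WSpace.exists_embedding hN hp hb hpq.le hq
  obtain ⟨DH, hDHc, hDH⟩ := exists_hasFDerivAt_functionalH (hp := hp) (hb := hb)
  obtain ⟨DI, KI, hDIc, hDI, hDIb, hIb⟩ :=
    exists_hasFDerivAt_functionalI (hp := hp) (hb := hb) hV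
  obtain ⟨hint, DJ, KJ, hDJc, hDJ, hDJe, hDJb, hJb⟩ :=
    exists_hasFDerivAt_functionalJ hf1.continuous hq1 h₁ h₂ hT
  obtain ⟨Kp, hKp0, hKp⟩ := WSpace.exists_norm_toLp_le hp hb
  refine ⟨hint, fun u => DH u - lam • DI u - DJ u, DH, fun u => lam • DI u + DJ u,
    (hDHc.sub (hDIc.const_smul lam)).sub hDJc,
    fun u => ((hDH u).sub ((hDI u).const_mul lam)).sub (hDJ u), hDH,
    fun u => sub_sub _ _ _, fun u => ?_, fun ι l u w B hu hw hw0 => ?_, fun ι l w B hw hw0 => ?_⟩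
  · have eH : DH u u = ‖u‖ ^ p := by
      rw [fderiv_apply_self_of_homogeneous (fun t ht => functionalH_smul ht u) (hDH u),
        functionalH_eq, ← mul_assoc, mul_one_div_cancel hp0.ne', one_mul]
    have eI : DI u u = p * functionalI V u :=
      fderiv_apply_self_of_homogeneous (fun t ht => functionalI_smul V ht u) (hDI u)
    change DH u u - lam * DI u u - DJ u u = _
    rw [eH, eI, hDJe]
  · have hTw := WSpace.tendsto_embedding_zero hN hpq hq hT hw hw0
    set P : ℝ := (Kp * B) ^ (p - 1)
    set Q : ℝ := (‖T‖ * B) ^ (q - 1)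
    have hP : ∀ i, ‖WSpace.toLp (u i)‖ ^ (p - 1) ≤ P := fun i =>
      Real.rpow_le_rpow (norm_nonneg _)
        ((hKp _).trans (mul_le_mul_of_nonneg_left (hu i) hKp0.le)) (by linarith)
    have hQ : ∀ i, ‖T (u i)‖ ^ (q - 1) ≤ Q := fun i =>
      Real.rpow_le_rpow (norm_nonneg _)
        ((T.le_opNorm _).trans (mul_le_mul_of_nonneg_left (hu i) (norm_nonneg _))) (by linarith)
    have hlim : Tendsto (fun i => |lam| * (|KI| * P * ‖WSpace.toLp (w i)‖) +
        (|KJ| * P * ‖WSpace.toLp (w i)‖ + |KJ| * Q * ‖T (w i)‖)) l (𝓝 0) := by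
      simpa using ((hw0.const_mul (|KI| * P)).const_mul |lam|).add
        ((hw0.const_mul (|KJ| * P)).add (hTw.const_mul (|KJ| * Q)))
    refine squeeze_zero_norm (fun i => ?_) hlim
    have hmul : ∀ {K x y z : ℝ}, 0 ≤ x → x ≤ y → 0 ≤ z → K * x * z ≤ |K| * y * z :=
      fun {K x y z} hx hxy hz => mul_le_mul_of_nonneg_right
        (mul_le_mul (le_abs_self K) hxy hx (abs_nonneg K)) hz
    have a1 := (hDIb (u i) (w i)).trans (hmul (by positivity) (hP i) (norm_nonneg _))
    have a2 := (hDJb (u i) (w i)).trans (add_le_add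
      (hmul (by positivity) (hP i) (norm_nonneg _)) (hmul (by positivity) (hQ i) (norm_nonneg _)))
    change ‖lam * DI (u i) (w i) + DJ (u i) (w i)‖ ≤ _
    refine (norm_add_le _ _).trans (add_le_add ?_ a2)
    rw [norm_mul]
    exact mul_le_mul_of_nonneg_left a1 (abs_nonneg lam)
  · have hTw := WSpace.tendsto_embedding_zero hN hpq hq hT hw hw0
    have h1 := hw0.rpow_const (p := p) (Or.inr hp0.le)
    have h2 := hTw.rpow_const (p := q) (Or.inr hq0.le)
    rw [Real.zero_rpow hp0.ne'] at h1
    rw [Real.zero_rpow hq0.ne'] at h2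
    have hlim : Tendsto (fun i => |lam| * (KI * ‖WSpace.toLp (w i)‖ ^ p) +
        (KJ * ‖WSpace.toLp (w i)‖ ^ p + KJ * ‖T (w i)‖ ^ q)) l (𝓝 0) := by
      simpa using ((h1.const_mul KI).const_mul |lam|).add ((h1.const_mul KJ).add (h2.const_mul KJ))
    refine squeeze_zero_norm (fun i => ?_) hlim
    have e : functionalH (w i) - energy lam V f (w i) =
        lam * functionalI V (w i) + functionalJ f (w i) := by
      rw [energy]
      ring
    rw [e]
    refine (norm_add_le _ _).trans (add_le_add ?_ (hJb _))
    rw [norm_mul]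
    exact mul_le_mul_of_nonneg_left (hIb _) (abs_nonneg lam)

/-- The hypothesis bounds the midpoint defect of H by a null quantity, and uniform convexity
converts a small defect into a small distance. -/
theorem WSpace.cauchySeq_of_tendsto_fderiv [Fact (1 ≤ ENNReal.ofReal p)] {u : ℕ → WSpace hp hb}
    {B : ℝ} (hB : ∀ k, ‖u k‖ ≤ B) {DH : WSpace hp hb → WSpace hp hb →L[ℝ] ℝ}
    (hDH : ∀ u, HasFDerivAt (functionalH : WSpace hp hb → ℝ) (DH u) u)
    (h : Tendsto (fun i : ℕ × ℕ => DH (u i.1) (u i.1 - u i.2) - DH (u i.2) (u i.1 - u i.2)) atTop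
      (𝓝 0)) : CauchySeq u := by
  have hp0 : 0 < p := by linarith
  rw [cauchySeq_iff_tendsto_dist_atTop_0, Metric.tendsto_nhds]
  intro η hη
  have hηp : 0 < η ^ p := Real.rpow_pos_of_pos hη p
  have hB0 : 0 ≤ B := (norm_nonneg _).trans (hB 0)
  have hBp : 0 ≤ B ^ p := Real.rpow_nonneg hB0 p
  -- This ε makes ε(‖u‖^p + ‖v‖^p) < η^p / 2 on the ball of radius B; the defect term gets the other
  -- half.
  obtain ⟨C, hC0, hC⟩ := WSpace.exists_norm_sub_rpow_le hp hb
    (ε := η ^ p / (4 * (B ^ p + 1))) (by positivity)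
  have hconv : ConvexOn ℝ Set.univ (functionalH : WSpace hp hb → ℝ) := by
    rw [show (functionalH : WSpace hp hb → ℝ) = fun u => (1 / p) • ‖u‖ ^ p from
      funext functionalH_eq]
    exact (convexOn_norm_rpow hp.le).smul (by positivity)
  have hlim := h.const_mul (C * p / 4)
  rw [mul_zero] at hlim
  filter_upwards [hlim.eventually_lt_const (half_pos hηp)] with i hi
  have h1 := hC (u i.1) (u i.2)
  have h2 := convexOn_midpoint_defect_le hconv (hDH (u i.1)) (hDH (u i.2))
  rw [functionalH_eq, functionalH_eq, functionalH_eq] at h2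
  have h3 : (1 / 2 : ℝ) * ‖u i.1‖ ^ p + (1 / 2 : ℝ) * ‖u i.2‖ ^ p -
      ‖(1 / 2 : ℝ) • (u i.1 + u i.2)‖ ^ p ≤
      p / 4 * (DH (u i.1) (u i.1 - u i.2) - DH (u i.2) (u i.1 - u i.2)) := by
    have h4 := mul_le_mul_of_nonneg_left h2 hp0.le
    have h5 : ∀ a b c : ℝ, p * (1 / 2 * (1 / p * a) + 1 / 2 * (1 / p * b) - 1 / p * c) =
        1 / 2 * a + 1 / 2 * b - c := fun a b c => by field_simp
    rw [h5] at h4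
    linarith
  have h6 := mul_le_mul_of_nonneg_left h3 hC0
  have h7 : ∀ k, ‖u k‖ ^ p ≤ B ^ p := fun k =>
    Real.rpow_le_rpow (norm_nonneg _) (hB k) hp0.le
  have h8 : η ^ p / (4 * (B ^ p + 1)) * (‖u i.1‖ ^ p + ‖u i.2‖ ^ p) < η ^ p / 2 := by
    rw [div_mul_eq_mul_div, div_lt_iff₀ (by positivity)]
    have := h7 i.1
    have := h7 i.2
    nlinarith
  have h9 : ‖u i.1 - u i.2‖ ^ p < η ^ p := by
    have e : C * (p / 4 * (DH (u i.1) (u i.1 - u i.2) - DH (u i.2) (u i.1 - u i.2))) =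
      C * p / 4 * (DH (u i.1) (u i.1 - u i.2) - DH (u i.2) (u i.1 - u i.2)) := by ring
    linarith
  rw [Real.dist_0_eq_abs, abs_of_nonneg dist_nonneg, dist_eq_norm]
  exact (Real.rpow_lt_rpow_iff (norm_nonneg _) hη.le hp0).1 h9

end Energy

/-! ### Boundedness and convergence of Cerami sequences -/

section Cerami

/-- The weight 1 + ‖u_k‖ is what yields D_k(u_k) → 0 without any bound on u_k. -/
theorem tendsto_norm_of_cerami {X : Type*} [NormedAddCommGroup X] [NormedSpace ℝ X] {u : ℕ → X}
    {D : ℕ → X →L[ℝ] ℝ} (h : Tendsto (fun k => (1 + ‖u k‖) • D k) atTop (𝓝 0)) :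
    Tendsto (fun k => ‖D k‖) atTop (𝓝 0) ∧ Tendsto (fun k => D k (u k)) atTop (𝓝 0) := by
  have hn : Tendsto (fun k => (1 + ‖u k‖) * ‖D k‖) atTop (𝓝 0) := by
    refine (tendsto_zero_iff_norm_tendsto_zero.1 h).congr fun k => ?_
    rw [norm_smul, Real.norm_of_nonneg (by positivity)]
  refine ⟨squeeze_zero (fun k => norm_nonneg _) (fun k => ?_) hn,
    squeeze_zero_norm (fun k => ((D k).le_opNorm _).trans ?_) hn⟩
  · exact le_mul_of_one_le_left (norm_nonneg _) (by linarith [norm_nonneg (u k)])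
  · rw [mul_comm]
    exact mul_le_mul_of_nonneg_right (by linarith) (norm_nonneg _)

variable {N : ℕ} {p : ℝ} {b : Euc N → ℝ} {hp : 1 < p} {hb : ConditionB b}
  {V : Euc N → ℝ} {f : Euc N → ℝ → ℝ}

theorem ConditionF4.exists_integral_calF_le (hf4 : ConditionF4 p f)
    (hi : ∀ u : WSpace hp hb, Integrable (fun x => calF p f x (u x)) volume) :
    ∃ θ : ℝ, ∀ (u : WSpace hp hb) (t : ℝ), 0 ≤ t → t ≤ 1 →
      ∫ x, calF p f x ((t • u) x) ≤ θ * ∫ x, calF p f x (u x) := by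
  obtain ⟨θ, -, hθ⟩ := hf4
  refine ⟨θ, fun u t ht0 ht1 => ?_⟩
  rw [← integral_const_mul]
  refine integral_mono_ae (hi _) ((hi u).const_mul θ) ?_
  filter_upwards [Lp.coeFn_smul t (WSpace.toLp u)] with x hx
  rw [map_smul, hx, Pi.smul_apply, smul_eq_mul]
  exact hθ x (u x) t ht0 ht1

theorem exists_norm_le_of_cerami (hN : 1 ≤ N) (hV : ConditionV V) (hf1 : ConditionF1 p f)
    (hf2 : ConditionF2 p f) (hf3 : ConditionF3 p f) (hf4 : ConditionF4 p f) (lam : ℝ)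
    [Fact (1 ≤ ENNReal.ofReal p)] {u : ℕ → WSpace hp hb} {c : ℝ}
    (hd : Tendsto (fun k => (1 + ‖u k‖) • fderiv ℝ (energy lam V f) (u k)) atTop (𝓝 0))
    (hc : Tendsto (fun k => energy lam V f (u k)) atTop (𝓝 c)) : ∃ B, ∀ k, ‖u k‖ ≤ B := by
  by_contra hunb
  have hp0 : 0 < p := by linarith
  obtain ⟨hint, D, DH, DG, -, hD, -, -, hDe, -, hG⟩ :=
    exists_hasFDerivAt_energy (hp := hp) (hb := hb) hN hV hf1 hf3 lam
  simp only [fun v => (hD v).fderiv] at hd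
  obtain ⟨σ, hσ, hσu⟩ := exists_subseq_norm_tendsto_atTop hunb
  have hnorm : ∀ w : WSpace hp hb, ‖‖w‖⁻¹ • w‖ ≤ 1 := fun w => by
    rw [norm_smul, norm_inv, norm_norm]
    exact inv_mul_le_one
  obtain ⟨τ, hτ, hcau⟩ := WSpace.exists_subseq_cauchySeq
    (fun k => ‖u (σ k)‖⁻¹ • u (σ k)) (fun k => hnorm _)
  have hστ := hσ.tendsto_atTop.comp hτ.tendsto_atTop
  set y : ℕ → WSpace hp hb := fun k => u (σ (τ k)) with hy
  have hyu : Tendsto (fun k => ‖y k‖) atTop atTop := hσu.comp hτ.tendsto_atTop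
  have hyd : Tendsto (fun k => D (y k) (y k)) atTop (𝓝 0) :=
    (tendsto_norm_of_cerami hd).2.comp hστ
  have hyc : Tendsto (fun k => energy lam V f (y k)) atTop (𝓝 c) := hc.comp hστ
  obtain ⟨v, hv⟩ := cauchySeq_tendsto_of_complete hcau
  obtain ⟨KI, hKI⟩ := exists_abs_functionalI_le (hp := hp) (hb := hb) hV
  -- Solve the formula for Φ'(y)y for the integral; the final + 1 absorbs -Φ'(y)y < 1, because ‖y‖ ≥
  -- 1 eventually.
  have hupper : ∀ᶠ k in atTop, ∫ x, f x (y k x) * y k x ≤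
      (1 + |lam| * (p * KI) + 1) * ‖y k‖ ^ p := by
    filter_upwards [hyd.eventually_const_lt (by norm_num : (-1 : ℝ) < 0),
      hyu.eventually_ge_atTop 1] with k h1 h2
    have h3 : 1 ≤ ‖y k‖ ^ p := Real.one_le_rpow h2 hp0.le
    have h4 : |lam * (p * functionalI V (y k))| ≤ |lam| * (p * (KI * ‖y k‖ ^ p)) := by
      rw [abs_mul, abs_mul, abs_of_pos hp0]
      exact mul_le_mul_of_nonneg_left (mul_le_mul_of_nonneg_left (hKI _) hp0.le) (abs_nonneg _)
    rw [hDe] at h1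
    linarith [neg_abs_le (lam * (p * functionalI V (y k)))]
  have hv0 : v = 0 := by
    refine eq_zero_of_integral_superlinear_le (u := fun k => WSpace.toLp (y k)) hp0 hf1.sign hf2
      hyu (hv.congr fun k => ?_) (fun k => (hint (y k)).2) hupper
    exact map_smul _ _ _
  rw [hv0] at hv
  have hv' : Tendsto (fun k => ‖WSpace.toLp (‖y k‖⁻¹ • y k)‖) atTop (𝓝 0) :=
    tendsto_zero_iff_norm_tendsto_zero.1 hv
  have hcalF : ∀ w : WSpace hp hb, Integrable (fun x => calF p f x (w x)) volume := fun w =>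
    (hint w).2.sub ((hint w).1.const_mul p)
  -- The p-homogeneous terms H and I cancel in pΦ(w) - Φ'(w)w, leaving exactly the quantity that
  -- (f₄) compares along rays.
  have hQ : ∀ w : WSpace hp hb,
      p * energy lam V f w - D w w = ∫ x, calF p f x (w x) := fun w => by
    simp only [calF]
    rw [integral_sub (hint w).2 ((hint w).1.const_mul p), integral_const_mul, hDe, energy,
      functionalH_eq, functionalJ]
    field_simp
    ring
  obtain ⟨θ, hθ⟩ := hf4.exists_integral_calF_le hcalF
  -- The smallness clause applied to the constant sequence 0: a constant that tends to zero is zero.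
  have h0 : energy lam V f (0 : WSpace hp hb) = 0 := by
    have h := hG ℕ atTop (fun _ => 0) 0 (fun _ => norm_zero.le) (by simp)
    have h1 := tendsto_const_nhds_iff.1 h
    rw [functionalH_eq, norm_zero, Real.zero_rpow hp0.ne'] at h1
    linarith
  refine false_of_large_on_rays (θ := θ) hD hp0 (fun w t ht0 ht1 => ?_) h0 hyu hyc hyd fun A => ?_
  · rw [hQ, hQ]
    exact hθ w t ht0 ht1
  -- With this radius H equals |A| + 1 on the sphere, leaving a margin of 1 for the vanishing
  -- difference H - Φ.
  · set m : ℝ := (p * (|A| + 1)) ^ (1 / p) with hm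
    have hm0 : 0 < m := by positivity
    have hmp : m ^ p = p * (|A| + 1) := by
      rw [hm, ← Real.rpow_mul (by positivity), one_div_mul_cancel hp0.ne', Real.rpow_one]
    have hlim := hG ℕ atTop (fun k => m • (‖y k‖⁻¹ • y k)) m (fun k => ?_) ?_
    · refine ⟨m, hm0, ?_⟩
      filter_upwards [hlim.eventually_lt_const one_pos, hyu.eventually_gt_atTop 0] with k h1 h2
      rw [functionalH_eq, norm_smul, norm_smul, norm_inv, norm_norm, inv_mul_cancel₀ h2.ne',
        mul_one, Real.norm_of_nonneg hm0.le, hmp, ← mul_assoc, one_div_mul_cancel hp0.ne',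
        one_mul] at h1
      linarith [le_abs_self A]
    · rw [norm_smul, Real.norm_of_nonneg hm0.le]
      exact mul_le_of_le_one_right hm0.le (hnorm _)
    · have h := hv'.const_mul m
      rw [mul_zero] at h
      refine h.congr fun k => ?_
      rw [map_smul _ m, norm_smul, Real.norm_of_nonneg hm0.le]

/-- No weak limit is identified. Working with differences u_k - u_l, the Cauchy property in L^p
makes the DG terms vanish and Φ'(u_k) → 0 handles the rest, so only H' remains and the Cauchy
criterion applies. -/
theorem ceramiCondition_energy (hN : 1 ≤ N) (hV : ConditionV V) (hf1 : ConditionF1 p f)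
    (hf2 : ConditionF2 p f) (hf3 : ConditionF3 p f) (hf4 : ConditionF4 p f) (lam : ℝ) :
    CeramiCondition (energy lam V f : WSpace hp hb → ℝ) := by
  have := fact_one_le hp
  intro u c hd hc
  obtain ⟨B, hB⟩ := exists_norm_le_of_cerami hN hV hf1 hf2 hf3 hf4 lam hd hc
  obtain ⟨-, D, DH, DG, -, hD, hDH, hDHG, -, hDG, -⟩ :=
    exists_hasFDerivAt_energy (hp := hp) (hb := hb) hN hV hf1 hf3 lam
  simp only [fun v => (hD v).fderiv] at hd
  obtain ⟨σ, hσ, hcau⟩ := WSpace.exists_subseq_cauchySeq u hB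
  have hB0 : 0 ≤ B := (norm_nonneg _).trans (hB 0)
  have hDn : Tendsto (fun k => ‖D (u (σ k))‖) atTop (𝓝 0) :=
    (tendsto_norm_of_cerami hd).1.comp hσ.tendsto_atTop
  set w : ℕ × ℕ → WSpace hp hb := fun i => u (σ i.1) - u (σ i.2) with hw
  have hwB : ∀ i, ‖w i‖ ≤ B + B := fun i =>
    (norm_sub_le _ _).trans (add_le_add (hB _) (hB _))
  have huB : ∀ k, ‖u (σ k)‖ ≤ B + B := fun k => (hB _).trans (by linarith)
  have hw0 : Tendsto (fun i => ‖WSpace.toLp (w i)‖) atTop (𝓝 0) := by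
    refine (cauchySeq_iff_tendsto_dist_atTop_0.1 hcau).congr fun i => ?_
    rw [dist_eq_norm, ← map_sub]
  have hfst : Tendsto (Prod.fst : ℕ × ℕ → ℕ) atTop atTop := by
    rw [← prod_atTop_atTop_eq]
    exact tendsto_fst
  have hsnd : Tendsto (Prod.snd : ℕ × ℕ → ℕ) atTop atTop := by
    rw [← prod_atTop_atTop_eq]
    exact tendsto_snd
  -- Stated for a general index map so that both projections, k and l, are covered.
  have hDw : ∀ π : ℕ × ℕ → ℕ, Tendsto π atTop atTop →
      Tendsto (fun i => D (u (σ (π i))) (w i)) atTop (𝓝 0) := fun π hπ => by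
    have h := (hDn.comp hπ).mul_const (B + B)
    rw [zero_mul] at h
    exact squeeze_zero_norm (fun i => ((D _).le_opNorm _).trans
      (mul_le_mul_of_nonneg_left (hwB i) (norm_nonneg _))) h
  have hGw : ∀ π : ℕ × ℕ → ℕ, Tendsto (fun i => DG (u (σ (π i))) (w i)) atTop (𝓝 0) := fun π =>
    hDG _ _ (fun i => u (σ (π i))) w (B + B) (fun i => huB _) hwB hw0
  have hH : Tendsto (fun i => DH (u (σ i.1)) (w i) - DH (u (σ i.2)) (w i)) atTop (𝓝 0) := by
    have h := ((hDw _ hfst).add (hGw Prod.fst)).sub ((hDw _ hsnd).add (hGw Prod.snd))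
    simpa [hDHG] using h
  have hcs : CauchySeq fun k => u (σ k) :=
    WSpace.cauchySeq_of_tendsto_fderiv (fun k => hB (σ k)) hDH hH
  have := WSpace.completeSpace (hp := hp) (hb := hb)
  obtain ⟨u₀, hu₀⟩ := cauchySeq_tendsto_of_complete hcs
  exact ⟨u₀, σ, hσ, hu₀⟩

end Cerami

end PLaplace

end

theorem theorem4p3 {N : ℕ} (hN : 1 ≤ N) {p : ℝ} (hp : 1 < p)
    {b : PLaplace.Euc N → ℝ} (hb : PLaplace.ConditionB b)
    {V : PLaplace.Euc N → ℝ} (hV : PLaplace.ConditionV V)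
    {f : PLaplace.Euc N → ℝ → ℝ}
    (hf1 : PLaplace.ConditionF1 p f) (hf2 : PLaplace.ConditionF2 p f)
    (hf3 : PLaplace.ConditionF3 p f) (hf4 : PLaplace.ConditionF4 p f) (lam : ℝ) :
    (∀ u : PLaplace.WSpace hp hb,
      Integrable (fun x => V x * |u x| ^ p) volume ∧
      Integrable (fun x => PLaplace.primitive f x (u x)) volume) ∧
    ContDiff ℝ 1 (PLaplace.energy lam V f : PLaplace.WSpace hp hb → ℝ) ∧
    PLaplace.CeramiCondition (PLaplace.energy lam V f : PLaplace.WSpace hp hb → ℝ) := by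
  have := PLaplace.fact_one_le hp
  obtain ⟨hint, D, -, -, hDc, hD, -⟩ :=
    PLaplace.exists_hasFDerivAt_energy (hp := hp) (hb := hb) hN hV hf1 hf3 lam
  exact ⟨fun u => ⟨PLaplace.integrable_functionalI hV u, (hint u).1⟩,
    contDiff_one_iff_hasFDerivAt.2 ⟨D, hDc, hD⟩,
    PLaplace.ceramiCondition_energy hN hV hf1 hf2 hf3 hf4 lam⟩
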